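/- **Setting.** Let $\Omega\subseteq\mathbb R^n$ be open. A net $(u_\varepsilon)_{0<\varepsilon\le 1}$ in $C^\infty(\Omega)$ (complex valued) is *moderate* if for every compact $K\subset\Omega$ and every $\alpha\in\mathbb N_0^n$ there is $N$ with $\sup_K|\partial^\alpha u_\varepsilon|=O(\varepsilon^{-N})$ as $\varepsilon\to0$, and *negligible* if $\sup_K|\partial^\alpha u_\varepsilon|=O(\varepsilon^{q})$ for all such $K,\alpha$ and all $q\in\mathbb N$. The Colombeau algebra $\mathcal G(\Omega)$ is the algebra of moderate nets modulo the ideal of negligible nets. A net of real numbers $r_\varepsilon>0$ is of *slow scale* if $r_\varepsilon^{p}=O(\varepsilon^{-1})$ as $\varepsilon\to 0$ for every $p\in\mathbb N$. A *cone* is a subset of $\mathbb R^n\setminus\{0\}$ that is stable under multiplication by positive reals. For $u=[(u_\varepsilon)_\varepsilon]\in\mathcal G(\Omega)$, the *generalized wave front set* $WF_g(u)\subseteq\Omega\times(\mathbb R^n\setminus\{0\})$ is the complement of the set of points $(x_1,\xi_1)$ for which there are $\varphi\in C_c^\infty(\Omega)$ with $\varphi(x_1)=1$, an open cone $\Gamma_1\ni\xi_1$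 and $M\in\mathbb N_0$ such that for every $l\in\mathbb N_0$ there are $C>0$ and $\varepsilon_0\in(0,1)$ with $$\Big|\int\varphi(x)u_\varepsilon(x)e^{-i\xi x}\,dx\Big|\le C\varepsilon^{-M}(1+|\xi|)^{-l}\qquad(\xi\in\Gamma_1,\ 0<\varepsilon<\varepsilon_0).$$ (This does not depend on the representative.) Let $P=\sum_{|\gamma|\le m}a_\gamma D^\gamma$, $D=-i\partial$, be a linear partial differential operator of order (at most) $m$ with coefficients $a_\gamma\in\mathcal G(\Omega)$, acting on $\mathcal G(\Omega)$; let $(a_\gamma^\varepsilon)_\varepsilon$ be representatives of the coefficients and $P_\varepsilon(x,\xi)=\sum_{|\gamma|\le m}a^\varepsilon_\gamma(x)\xi^\gamma$. **Theorem.** Let $(x_0,\xi_0)\in\Omega\times(\mathbb R^n\setminus\{0\})$, let $U\subseteq\Omega$ be an open neighbourhood of $x_0$ and $\Gamma$ an open cone containing $\xi_0$, and let $m_0\in\mathbb R$ and $0\le\delta<\rho\le1$. Suppose that for every compact $K\subset U$ the following hold. 1. There are $q>0$, a slow scale net $r_\varepsilon>0$ and $\varepsilon_0>0$ such that $$|P_\varepsilon(x,\xi)|\ge\varepsilon^{q}(1+|\xi|)^{m_0}$$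 for all $x\in K$, $\xi\in\Gamma$ with $|\xi|\ge r_\varepsilon$, and $0<\varepsilon<\varepsilon_0$. 2. For every $\alpha\in\mathbb N_0^n$ there are slow scale nets $s^\alpha_\varepsilon,r^\alpha_\varepsilon>0$ and $\varepsilon_\alpha>0$ such that for all $\beta\in\mathbb N_0^n$ with $|\beta|\le m$ $$|\partial_x^\alpha\partial_\xi^\beta P_\varepsilon(x,\xi)|\le s^\alpha_\varepsilon\,|P_\varepsilon(x,\xi)|\,(1+|\xi|)^{\delta|\alpha|-\rho|\beta|}$$ for all $x\in K$, $\xi\in\Gamma$ with $|\xi|\ge r^\alpha_\varepsilon$, and $0<\varepsilon<\varepsilon_\alpha$. Then, with $\Lambda=U\times\Gamma$, for every $u\in\mathcal G(\Omega)$ $$\Lambda\cap WF_g(u)=\Lambda\cap WF_g(Pu).$$ -/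

import Mathlib

open Set Filter Topology
open scoped ContDiff

noncomputable section

namespace ColombeauPDO

/-- The partial derivative `∂_i f` of a complex function on `ℝⁿ`. -/
def pd {n : ℕ} (i : Fin n) (f : EuclideanSpace ℝ (Fin n) → ℂ) :
    EuclideanSpace ℝ (Fin n) → ℂ :=
  fun x => fderiv ℝ f x (EuclideanSpace.single i 1)

/-- The iterated partial derivative along a list of indices: for `w = [i₁, …, i_k]` this is
`∂_{i_k} ⋯ ∂_{i₁} f` (for smooth functions the order is immaterial). -/
def pdList {n : ℕ} : List (Fin n) → (EuclideanSpace ℝ (Fin n) → ℂ) →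
    EuclideanSpace ℝ (Fin n) → ℂ
  | [], f => f
  | i :: w, f => pdList w (pd i f)

/-- The list in which each index `i` occurs `α i` times. -/
def multiWord {n : ℕ} (α : Fin n → ℕ) : List (Fin n) :=
  (List.finRange n).flatMap fun i => List.replicate (α i) i

/-- The derivative `∂^α f` for a multi-index `α`. -/
def mpd {n : ℕ} (α : Fin n → ℕ) (f : EuclideanSpace ℝ (Fin n) → ℂ) :
    EuclideanSpace ℝ (Fin n) → ℂ :=
  pdList (multiWord α) f

/-- The length `|α|` of a multi-index. -/
def len {n : ℕ} (α : Fin n → ℕ) : ℕ := ∑ i, α i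

/-- The finite set of all multi-indices `α` with `|α| ≤ m`. -/
def multiIndices (n m : ℕ) : Finset (Fin n → ℕ) :=
  (Finset.Iic (fun _ : Fin n => m)).filter fun α => len α ≤ m

theorem mem_multiIndices {n m : ℕ} {α : Fin n → ℕ} : α ∈ multiIndices n m ↔ len α ≤ m := by
  simp only [multiIndices, Finset.mem_filter, Finset.mem_Iic, and_iff_right_iff_imp]
  intro h i
  exact (Finset.single_le_sum (f := α) (fun _ _ => Nat.zero_le _) (Finset.mem_univ i)).trans h

/-! ### Nets of smooth functions, moderateness and negligibility

A net `(u_ε)` with `0 < ε ≤ 1` is a function `u : ℝ → (ℝⁿ → ℂ)`; only the values at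
`ε ∈ (0, 1]` and at points of `Ω` matter. -/

/-- All `u_ε`, `0 < ε ≤ 1`, are smooth on `Ω`. -/
def IsSmoothNet {n : ℕ} (Ω : TopologicalSpace.Opens (EuclideanSpace ℝ (Fin n)))
    (u : ℝ → EuclideanSpace ℝ (Fin n) → ℂ) : Prop :=
  ∀ ε ∈ Ioc (0 : ℝ) 1, ContDiffOn ℝ ∞ (u ε) Ω

/-- `sup_K |u_ε| = O(ε^{-N})` as `ε → 0`, for some `N`. -/
def ModBound {n : ℕ} (K : Set (EuclideanSpace ℝ (Fin n)))
    (u : ℝ → EuclideanSpace ℝ (Fin n) → ℂ) : Prop :=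
  ∃ (N : ℕ) (C : ℝ), ∀ᶠ ε in 𝓝[>] (0 : ℝ), ∀ x ∈ K, ‖u ε x‖ ≤ C * (ε ^ N)⁻¹

/-- `sup_K |u_ε| = O(ε^q)` as `ε → 0`, for every `q`. -/
def NegBound {n : ℕ} (K : Set (EuclideanSpace ℝ (Fin n)))
    (u : ℝ → EuclideanSpace ℝ (Fin n) → ℂ) : Prop :=
  ∀ q : ℕ, ∃ C : ℝ, ∀ᶠ ε in 𝓝[>] (0 : ℝ), ∀ x ∈ K, ‖u ε x‖ ≤ C * ε ^ q

/-- Moderate nets: on each compact set each derivative is `O(ε^{-N})` for some `N`. -/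
def IsModerate {n : ℕ} (Ω : TopologicalSpace.Opens (EuclideanSpace ℝ (Fin n)))
    (u : ℝ → EuclideanSpace ℝ (Fin n) → ℂ) : Prop :=
  IsSmoothNet Ω u ∧ ∀ K ⊆ (Ω : Set (EuclideanSpace ℝ (Fin n))), IsCompact K →
    ∀ w : List (Fin n), ModBound K fun ε => pdList w (u ε)

/-- Negligible nets: on each compact set each derivative is `O(ε^q)` for all `q`. -/
def IsNegligible {n : ℕ} (Ω : TopologicalSpace.Opens (EuclideanSpace ℝ (Fin n)))
    (u : ℝ → EuclideanSpace ℝ (Fin n) → ℂ) : Prop :=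
  IsSmoothNet Ω u ∧ ∀ K ⊆ (Ω : Set (EuclideanSpace ℝ (Fin n))), IsCompact K →
    ∀ w : List (Fin n), NegBound K fun ε => pdList w (u ε)

section Helpers

variable {n : ℕ} {Ω : TopologicalSpace.Opens (EuclideanSpace ℝ (Fin n))}

theorem pd_congr {f g : EuclideanSpace ℝ (Fin n) → ℂ} (h : EqOn f g Ω) (i : Fin n) :
    EqOn (pd i f) (pd i g) Ω := by
  intro x hx
  have : f =ᶠ[𝓝 x] g := h.eventuallyEq_of_mem (Ω.isOpen.mem_nhds hx)
  simp only [pd, this.fderiv_eq]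

theorem pdList_congr (w : List (Fin n)) {f g : EuclideanSpace ℝ (Fin n) → ℂ}
    (h : EqOn f g Ω) : EqOn (pdList w f) (pdList w g) Ω := by
  induction w generalizing f g with
  | nil => exact h
  | cons i w ih => exact ih (pd_congr h i)

theorem diffAt {f : EuclideanSpace ℝ (Fin n) → ℂ} (h : ContDiffOn ℝ ∞ f Ω)
    {x : EuclideanSpace ℝ (Fin n)} (hx : x ∈ Ω) : DifferentiableAt ℝ f x :=
  (h.contDiffAt (Ω.isOpen.mem_nhds hx)).differentiableAt (by simp)

theorem contDiffOn_pd {f : EuclideanSpace ℝ (Fin n) → ℂ} (h : ContDiffOn ℝ ∞ f Ω)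
    (i : Fin n) : ContDiffOn ℝ ∞ (pd i f) Ω :=
  (h.fderiv_of_isOpen Ω.isOpen (m := ∞) (by simp)).clm_apply contDiffOn_const

theorem pd_add {f g : EuclideanSpace ℝ (Fin n) → ℂ} (hf : ContDiffOn ℝ ∞ f Ω)
    (hg : ContDiffOn ℝ ∞ g Ω) (i : Fin n) : EqOn (pd i (f + g)) (pd i f + pd i g) Ω := by
  intro x hx
  simp [pd, fderiv_add (diffAt hf hx) (diffAt hg hx)]

theorem pd_mul {f g : EuclideanSpace ℝ (Fin n) → ℂ} (hf : ContDiffOn ℝ ∞ f Ω)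
    (hg : ContDiffOn ℝ ∞ g Ω) (i : Fin n) :
    EqOn (pd i (f * g)) (pd i f * g + f * pd i g) Ω := by
  intro x hx
  simp [pd, fderiv_mul (diffAt hf hx) (diffAt hg hx)]
  ring

theorem pdList_add (w : List (Fin n)) {f g : EuclideanSpace ℝ (Fin n) → ℂ}
    (hf : ContDiffOn ℝ ∞ f Ω) (hg : ContDiffOn ℝ ∞ g Ω) :
    EqOn (pdList w (f + g)) (pdList w f + pdList w g) Ω := by
  induction w generalizing f g with
  | nil => intro x _; rfl
  | cons i w ih =>
    exact (pdList_congr w (pd_add hf hg i)).trans (ih (contDiffOn_pd hf i) (contDiffOn_pd hg i))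

theorem pdList_const (w : List (Fin n)) (c : ℂ) :
    ∃ d : ℂ, pdList w (fun _ : EuclideanSpace ℝ (Fin n) => c) = fun _ => d := by
  induction w generalizing c with
  | nil => exact ⟨c, rfl⟩
  | cons i w ih =>
    have : pd i (fun _ : EuclideanSpace ℝ (Fin n) => c) = fun _ => 0 := by
      funext x; simp [pd]
    simpa [pdList, this] using ih 0

theorem ev_unit : ∀ᶠ ε in 𝓝[>] (0 : ℝ), ε ∈ Ioc (0 : ℝ) 1 :=
  Ioc_mem_nhdsGT one_pos

/-- Induction behind the product estimates. -/
theorem prod_bound {A B Q : (ℝ → EuclideanSpace ℝ (Fin n) → ℂ) → Prop}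
    (hA : ∀ u i, A u → A fun ε => pd i (u ε)) (hB : ∀ u i, B u → B fun ε => pd i (u ε))
    (hAs : ∀ u, A u → IsSmoothNet Ω u) (hBs : ∀ u, B u → IsSmoothNet Ω u)
    (hQ : ∀ u v, Q u → Q v → Q (u + v)) (hAB : ∀ u v, A u → B v → Q (u * v))
    (hc : ∀ u v : ℝ → EuclideanSpace ℝ (Fin n) → ℂ,
      (∀ ε ∈ Ioc (0 : ℝ) 1, EqOn (u ε) (v ε) Ω) → Q v → Q u)
    (w : List (Fin n)) : ∀ u v, A u → B v → Q fun ε => pdList w (u ε * v ε) := by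
  induction w with
  | nil => exact hAB
  | cons i w ih =>
    intro u v hu hv
    refine hc _ _ ?_ (hQ _ _ (ih _ _ (hA u i hu) hv) (ih _ _ hu (hB v i hv)))
    intro ε hε
    have h1 := hAs u hu ε hε
    have h2 := hBs v hv ε hε
    exact (pdList_congr w (pd_mul h1 h2 i)).trans
      (pdList_add w ((contDiffOn_pd h1 i).mul h2) (h1.mul (contDiffOn_pd h2 i)))

theorem ModBound.congr {K : Set (EuclideanSpace ℝ (Fin n))}
    (hK : K ⊆ (Ω : Set (EuclideanSpace ℝ (Fin n))))
    {u v : ℝ → EuclideanSpace ℝ (Fin n) → ℂ}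
    (h : ∀ ε ∈ Ioc (0 : ℝ) 1, EqOn (u ε) (v ε) Ω) (hv : ModBound K v) : ModBound K u := by
  obtain ⟨N, C, hv⟩ := hv
  refine ⟨N, C, ?_⟩
  filter_upwards [hv, ev_unit] with ε h1 h2 x hx
  rw [h ε h2 (hK hx)]
  exact h1 x hx

theorem NegBound.congr {K : Set (EuclideanSpace ℝ (Fin n))}
    (hK : K ⊆ (Ω : Set (EuclideanSpace ℝ (Fin n))))
    {u v : ℝ → EuclideanSpace ℝ (Fin n) → ℂ}
    (h : ∀ ε ∈ Ioc (0 : ℝ) 1, EqOn (u ε) (v ε) Ω) (hv : NegBound K v) : NegBound K u := by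
  intro q
  obtain ⟨C, hv⟩ := hv q
  refine ⟨C, ?_⟩
  filter_upwards [hv, ev_unit] with ε h1 h2 x hx
  rw [h ε h2 (hK hx)]
  exact h1 x hx

theorem ModBound.add {K : Set (EuclideanSpace ℝ (Fin n))}
    {u v : ℝ → EuclideanSpace ℝ (Fin n) → ℂ} (hu : ModBound K u) (hv : ModBound K v) :
    ModBound K (u + v) := by
  obtain ⟨N, C, hu⟩ := hu
  obtain ⟨M, D, hv⟩ := hv
  refine ⟨N + M, |C| + |D|, ?_⟩
  filter_upwards [hu, hv, ev_unit] with ε h1 h2 h3 x hx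
  have e1 : (ε ^ N)⁻¹ ≤ (ε ^ (N + M))⁻¹ :=
    inv_anti₀ (pow_pos h3.1 _) (pow_le_pow_of_le_one h3.1.le h3.2 (by omega))
  have e2 : (ε ^ M)⁻¹ ≤ (ε ^ (N + M))⁻¹ :=
    inv_anti₀ (pow_pos h3.1 _) (pow_le_pow_of_le_one h3.1.le h3.2 (by omega))
  have p1 : 0 ≤ (ε ^ N)⁻¹ := inv_nonneg.2 (pow_nonneg h3.1.le _)
  have p2 : 0 ≤ (ε ^ M)⁻¹ := inv_nonneg.2 (pow_nonneg h3.1.le _)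
  calc ‖u ε x + v ε x‖ ≤ ‖u ε x‖ + ‖v ε x‖ := norm_add_le _ _
    _ ≤ C * (ε ^ N)⁻¹ + D * (ε ^ M)⁻¹ := add_le_add (h1 x hx) (h2 x hx)
    _ ≤ |C| * (ε ^ (N + M))⁻¹ + |D| * (ε ^ (N + M))⁻¹ :=
      add_le_add (mul_le_mul (le_abs_self _) e1 p1 (abs_nonneg _))
        (mul_le_mul (le_abs_self _) e2 p2 (abs_nonneg _))
    _ = _ := by ring

theorem ModBound.mul {K : Set (EuclideanSpace ℝ (Fin n))}
    {u v : ℝ → EuclideanSpace ℝ (Fin n) → ℂ} (hu : ModBound K u) (hv : ModBound K v) :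
    ModBound K (u * v) := by
  obtain ⟨N, C, hu⟩ := hu
  obtain ⟨M, D, hv⟩ := hv
  refine ⟨N + M, C * D, ?_⟩
  filter_upwards [hu, hv] with ε h1 h2 x hx
  calc ‖u ε x * v ε x‖ = ‖u ε x‖ * ‖v ε x‖ := norm_mul _ _
    _ ≤ (C * (ε ^ N)⁻¹) * (D * (ε ^ M)⁻¹) :=
      mul_le_mul (h1 x hx) (h2 x hx) (norm_nonneg _) ((norm_nonneg _).trans (h1 x hx))
    _ = _ := by rw [pow_add, mul_inv]; ring

theorem NegBound.add {K : Set (EuclideanSpace ℝ (Fin n))}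
    {u v : ℝ → EuclideanSpace ℝ (Fin n) → ℂ} (hu : NegBound K u) (hv : NegBound K v) :
    NegBound K (u + v) := by
  intro q
  obtain ⟨C, hu⟩ := hu q
  obtain ⟨D, hv⟩ := hv q
  refine ⟨C + D, ?_⟩
  filter_upwards [hu, hv] with ε h1 h2 x hx
  calc ‖u ε x + v ε x‖ ≤ ‖u ε x‖ + ‖v ε x‖ := norm_add_le _ _
    _ ≤ C * ε ^ q + D * ε ^ q := add_le_add (h1 x hx) (h2 x hx)
    _ = _ := by ring

theorem ModBound.mul_neg {K : Set (EuclideanSpace ℝ (Fin n))}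
    {u v : ℝ → EuclideanSpace ℝ (Fin n) → ℂ} (hu : ModBound K u) (hv : NegBound K v) :
    NegBound K (u * v) := by
  intro q
  obtain ⟨N, C, hu⟩ := hu
  obtain ⟨D, hv⟩ := hv (N + q)
  refine ⟨C * D, ?_⟩
  filter_upwards [hu, hv, ev_unit] with ε h1 h2 h3 x hx
  have : ε ^ N ≠ 0 := (pow_pos h3.1 _).ne'
  calc ‖u ε x * v ε x‖ = ‖u ε x‖ * ‖v ε x‖ := norm_mul _ _
    _ ≤ (C * (ε ^ N)⁻¹) * (D * ε ^ (N + q)) :=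
      mul_le_mul (h1 x hx) (h2 x hx) (norm_nonneg _) ((norm_nonneg _).trans (h1 x hx))
    _ = _ := by rw [pow_add]; field_simp

theorem IsModerate.pd {u : ℝ → EuclideanSpace ℝ (Fin n) → ℂ} (h : IsModerate Ω u)
    (i : Fin n) : IsModerate Ω fun ε => pd i (u ε) :=
  ⟨fun ε hε => contDiffOn_pd (h.1 ε hε) i, fun K hK hK' w => h.2 K hK hK' (i :: w)⟩

theorem IsNegligible.pd {u : ℝ → EuclideanSpace ℝ (Fin n) → ℂ} (h : IsNegligible Ω u)
    (i : Fin n) : IsNegligible Ω fun ε => pd i (u ε) :=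
  ⟨fun ε hε => contDiffOn_pd (h.1 ε hε) i, fun K hK hK' w => h.2 K hK hK' (i :: w)⟩

theorem IsModerate.add {u v : ℝ → EuclideanSpace ℝ (Fin n) → ℂ} (hu : IsModerate Ω u)
    (hv : IsModerate Ω v) : IsModerate Ω (u + v) :=
  ⟨fun ε hε => (hu.1 ε hε).add (hv.1 ε hε), fun K hK hK' w =>
    ModBound.congr hK (fun ε hε => pdList_add w (hu.1 ε hε) (hv.1 ε hε))
      ((hu.2 K hK hK' w).add (hv.2 K hK hK' w))⟩

theorem IsModerate.mul {u v : ℝ → EuclideanSpace ℝ (Fin n) → ℂ} (hu : IsModerate Ω u)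
    (hv : IsModerate Ω v) : IsModerate Ω (u * v) :=
  ⟨fun ε hε => (hu.1 ε hε).mul (hv.1 ε hε), fun K hK hK' w =>
    prod_bound (A := IsModerate Ω) (B := IsModerate Ω) (Q := ModBound K)
      (fun _ i h => h.pd i) (fun _ i h => h.pd i) (fun _ h => h.1) (fun _ h => h.1)
      (fun _ _ => ModBound.add)
      (fun _ _ h1 h2 => (h1.2 K hK hK' []).mul (h2.2 K hK hK' []))
      (fun _ _ => ModBound.congr hK) w u v hu hv⟩

theorem isModerate_const (c : ℂ) : IsModerate Ω fun _ _ => c := by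
  refine ⟨fun ε _ => contDiffOn_const, fun K _ _ w => ?_⟩
  obtain ⟨d, hd⟩ := pdList_const (n := n) w c
  exact ⟨0, ‖d‖, Eventually.of_forall fun ε x _ => by simp [hd]⟩

theorem IsNegligible.add {u v : ℝ → EuclideanSpace ℝ (Fin n) → ℂ} (hu : IsNegligible Ω u)
    (hv : IsNegligible Ω v) : IsNegligible Ω (u + v) :=
  ⟨fun ε hε => (hu.1 ε hε).add (hv.1 ε hε), fun K hK hK' w =>
    NegBound.congr hK (fun ε hε => pdList_add w (hu.1 ε hε) (hv.1 ε hε))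
      ((hu.2 K hK hK' w).add (hv.2 K hK hK' w))⟩

theorem IsModerate.mul_neg {u v : ℝ → EuclideanSpace ℝ (Fin n) → ℂ} (hu : IsModerate Ω u)
    (hv : IsNegligible Ω v) : IsNegligible Ω (u * v) :=
  ⟨fun ε hε => (hu.1 ε hε).mul (hv.1 ε hε), fun K hK hK' w =>
    prod_bound (A := IsModerate Ω) (B := IsNegligible Ω) (Q := NegBound K)
      (fun _ i h => h.pd i) (fun _ i h => h.pd i) (fun _ h => h.1) (fun _ h => h.1)
      (fun _ _ => NegBound.add)
      (fun _ _ h1 h2 => (h1.2 K hK hK' []).mul_neg (h2.2 K hK hK' []))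
      (fun _ _ => NegBound.congr hK) w u v hu hv⟩

theorem isNegligible_zero : IsNegligible Ω (0 : ℝ → EuclideanSpace ℝ (Fin n) → ℂ) := by
  refine ⟨fun ε _ => contDiffOn_const, fun K _ _ w q => ⟨0, Eventually.of_forall fun ε x _ => ?_⟩⟩
  have h : ∀ w : List (Fin n), pdList w (0 : EuclideanSpace ℝ (Fin n) → ℂ) = 0 := by
    intro w
    induction w with
    | nil => rfl
    | cons i w ih =>
      have : ColombeauPDO.pd i (0 : EuclideanSpace ℝ (Fin n) → ℂ) = 0 := by
        funext x; simp [ColombeauPDO.pd]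
      simpa [pdList, this] using ih
  simp [h w]

end Helpers

/-- The algebra `ℰ_M(Ω)` of moderate nets. -/
def moderate {n : ℕ} (Ω : TopologicalSpace.Opens (EuclideanSpace ℝ (Fin n))) :
    Subalgebra ℂ (ℝ → EuclideanSpace ℝ (Fin n) → ℂ) where
  carrier := {u | IsModerate Ω u}
  mul_mem' := fun hu hv => IsModerate.mul hu hv
  add_mem' := fun hu hv => IsModerate.add hu hv
  algebraMap_mem' := fun c => isModerate_const c

/-- The ideal `𝒩(Ω)` of negligible nets. -/
def negligible {n : ℕ} (Ω : TopologicalSpace.Opens (EuclideanSpace ℝ (Fin n))) :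
    Ideal (moderate Ω) where
  carrier := {u | IsNegligible Ω (u : ℝ → EuclideanSpace ℝ (Fin n) → ℂ)}
  add_mem' := fun hu hv => IsNegligible.add hu hv
  zero_mem' := isNegligible_zero
  smul_mem' := fun c _ hu => IsModerate.mul_neg c.2 hu

/-- The Colombeau algebra `𝒢(Ω) = ℰ_M(Ω) / 𝒩(Ω)`. -/
abbrev Colombeau {n : ℕ} (Ω : TopologicalSpace.Opens (EuclideanSpace ℝ (Fin n))) : Type :=
  moderate Ω ⧸ negligible Ω

/-- The class in `𝒢(Ω)` of a moderate net. -/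
abbrev toG {n : ℕ} {Ω : TopologicalSpace.Opens (EuclideanSpace ℝ (Fin n))} (u : moderate Ω) :
    Colombeau Ω :=
  Ideal.Quotient.mk (negligible Ω) u

/-- `(u_ε) ↦ (∂_i u_ε)` on moderate nets. -/
def moderatePd {n : ℕ} {Ω : TopologicalSpace.Opens (EuclideanSpace ℝ (Fin n))} (i : Fin n)
    (u : moderate Ω) : moderate Ω :=
  ⟨fun ε => pd i (u.1 ε), IsModerate.pd u.2 i⟩

theorem moderatePd_congr {n : ℕ} {Ω : TopologicalSpace.Opens (EuclideanSpace ℝ (Fin n))}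
    (i : Fin n) (u v : moderate Ω) (h : u - v ∈ negligible Ω) :
    moderatePd i u - moderatePd i v ∈ negligible Ω := by
  have h' : IsNegligible Ω (u.1 - v.1) := h
  have h2 := h'.pd i
  refine ⟨fun ε hε => (contDiffOn_pd (u.2.1 ε hε) i).sub (contDiffOn_pd (v.2.1 ε hε) i), ?_⟩
  intro K hK hK' w
  refine NegBound.congr hK ?_ (h2.2 K hK hK' w)
  intro ε hε
  refine pdList_congr w ?_
  intro x hx
  simp [moderatePd, pd, fderiv_sub (diffAt (u.2.1 ε hε) hx) (diffAt (v.2.1 ε hε) hx)]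

/-- The derivation `∂_i` on `𝒢(Ω)`, acting on representatives. -/
def gPd {n : ℕ} {Ω : TopologicalSpace.Opens (EuclideanSpace ℝ (Fin n))} (i : Fin n)
    (u : Colombeau Ω) : Colombeau Ω :=
  Quotient.lift (fun v : moderate Ω => toG (moderatePd i v))
    (fun a b hab => Ideal.Quotient.eq.2 (moderatePd_congr i a b
      ((Submodule.quotientRel_def _).1 hab))) u

theorem gPd_toG {n : ℕ} {Ω : TopologicalSpace.Opens (EuclideanSpace ℝ (Fin n))} (i : Fin n)
    (u : moderate Ω) : gPd i (toG u) = toG (moderatePd i u) := rfl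

/-- `D^α = (-i)^{|α|} ∂^α` on `𝒢(Ω)`. -/
def gD {n : ℕ} {Ω : TopologicalSpace.Opens (EuclideanSpace ℝ (Fin n))} (α : Fin n → ℕ)
    (u : Colombeau Ω) : Colombeau Ω :=
  (-Complex.I) ^ len α • (multiWord α).foldl (fun v i => gPd i v) u

/-- The operator `P = ∑_{|α| ≤ m} A_α D^α` on `𝒢(Ω)` with coefficients `A_α ∈ 𝒢(Ω)`. -/
def genOp {n : ℕ} {Ω : TopologicalSpace.Opens (EuclideanSpace ℝ (Fin n))} (m : ℕ)
    (A : (Fin n → ℕ) → Colombeau Ω) (u : Colombeau Ω) : Colombeau Ω :=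
  ∑ α ∈ multiIndices n m, A α * gD α u

/-- The symbol `P_ε(x, ξ) = ∑_{|α| ≤ m} a_α^ε(x) ξ^α`. -/
def symbol {n : ℕ} {Ω : TopologicalSpace.Opens (EuclideanSpace ℝ (Fin n))} (m : ℕ)
    (a : (Fin n → ℕ) → moderate Ω) (ε : ℝ) (x ξ : EuclideanSpace ℝ (Fin n)) : ℂ :=
  ∑ α ∈ multiIndices n m, (a α).1 ε x * ∏ i, ((ξ i : ℝ) : ℂ) ^ α i

/-- A net `(r_ε)` of positive real numbers of slow scale: `r_ε^p = O(ε^{-1})` for all `p`. -/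
def IsSlowScale (r : ℝ → ℝ) : Prop :=
  (∀ ε ∈ Ioc (0 : ℝ) 1, 0 < r ε) ∧
    ∀ p : ℕ, ∃ C : ℝ, ∀ᶠ ε in 𝓝[>] (0 : ℝ), r ε ^ p ≤ C * ε⁻¹

/-- An open cone in `ℝⁿ ∖ {0}`. -/
def IsOpenCone {n : ℕ} (Γ : Set (EuclideanSpace ℝ (Fin n))) : Prop :=
  IsOpen Γ ∧ 0 ∉ Γ ∧ ∀ ξ ∈ Γ, ∀ t : ℝ, 0 < t → t • ξ ∈ Γ

/-- `∫ φ(x) v(x) e^{-i ξ x} dx`. -/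
def fourierLoc {n : ℕ} (φ v : EuclideanSpace ℝ (Fin n) → ℂ) (ξ : EuclideanSpace ℝ (Fin n)) : ℂ :=
  ∫ x, φ x * v x * Complex.exp (-Complex.I * ((inner ℝ ξ x : ℝ) : ℂ))

/-- Rapid decrease in `Γ` of the Fourier transforms of `φ v_ε`: the power `ε^{-M}` does not
depend on the order `l` of decrease. -/
def RapidlyDecreasing {n : ℕ} (φ : EuclideanSpace ℝ (Fin n) → ℂ)
    (v : ℝ → EuclideanSpace ℝ (Fin n) → ℂ) (Γ : Set (EuclideanSpace ℝ (Fin n))) : Prop :=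
  ∃ M : ℕ, ∀ l : ℕ, ∃ C : ℝ, ∀ᶠ ε in 𝓝[>] (0 : ℝ), ∀ ξ ∈ Γ,
    ‖fourierLoc φ (v ε) ξ‖ ≤ C * (ε ^ M)⁻¹ * ((1 + ‖ξ‖) ^ l)⁻¹

/-- `u` is microlocally regular at `(x₀, ξ₀)`: for some cut-off `φ ∈ 𝒟(Ω)` with `φ(x₀) = 1` the
Fourier transform of `φ u` is rapidly decreasing in an open conic neighbourhood of `ξ₀`. The
property does not depend on the representative of `u`. -/
def MicrolocallyRegular {n : ℕ} {Ω : TopologicalSpace.Opens (EuclideanSpace ℝ (Fin n))}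
    (u : Colombeau Ω) (x₀ ξ₀ : EuclideanSpace ℝ (Fin n)) : Prop :=
  ∃ v : moderate Ω, toG v = u ∧
    ∃ φ : EuclideanSpace ℝ (Fin n) → ℂ, ContDiff ℝ ∞ φ ∧ HasCompactSupport φ ∧
      tsupport φ ⊆ (Ω : Set (EuclideanSpace ℝ (Fin n))) ∧ φ x₀ = 1 ∧
      ∃ Γ : Set (EuclideanSpace ℝ (Fin n)), IsOpenCone Γ ∧ ξ₀ ∈ Γ ∧ RapidlyDecreasing φ v.1 Γ

/-- The generalized wave front set `WF_g(u) ⊆ T*(Ω) ∖ 0`. -/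
def WFg {n : ℕ} {Ω : TopologicalSpace.Opens (EuclideanSpace ℝ (Fin n))} (u : Colombeau Ω) :
    Set (EuclideanSpace ℝ (Fin n) × EuclideanSpace ℝ (Fin n)) :=
  {p | p.1 ∈ Ω ∧ p.2 ≠ 0 ∧ ¬ MicrolocallyRegular u p.1 p.2}

end ColombeauPDO

end

noncomputable section

namespace ColombeauPDO

/-! Write `P` for `P_ε(·, ξ)` when it multiplies a function of `x`. The Fourier transform of `ψ v`
at `ξ` is `∫ v e^{-iξx} ψ`, and integration by parts gives `∫ (Pv) e^{-iξx} h = ∫ v e^{-iξx} T_ξ h`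
with the conjugated transpose `T_ξ = e^{iξx} ᵗP e^{-iξx}` (`integral_diffOp_mul_osc`). Since `T_ξ`
is the symbol evaluated at `ξ + i∂`, with the coefficients acting first, Taylor's formula in the
commuting operators `i∂_j` splits it into terms of order `k ≤ m`: `k` derivatives `∂_ξ` fall on the
symbol, and `k` derivatives in `x` fall on the product of the result with `h`. The term `k = 0` is
multiplication by `P`. By hypothesis 2 the term of order `k` has size `|P_ε| (1+|ξ|)^{-(ρ-δ)k}`, so
`T_ξ P⁻¹ = 1 - R`, where `R` gains a factor `(1+|ξ|)^{-(ρ-δ)}` (`parametrixError_bound`).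

If `Pv` is regular, the finite geometric series gives `ψ = T_ξ P⁻¹ (∑_{j<k} R^j) ψ + R^k ψ`. Paired
with `v e^{-iξx}`, the first part becomes an integral of `Pv` against an amplitude, and the second
decays like `(1+|ξ|)^{-(ρ-δ)k}` with `k` at choice (`rapidlyDecreasing_of_diffOp`). If `v` is
regular, the transform of `ψ Pv` is already the integral of `v` against the amplitude `T_ξ ψ`
(`rapidlyDecreasing_diffOp`). In both cases `rapid_mul` concludes: rapid decrease in a cone
survives, in a smaller cone, multiplication by amplitudes depending on `(ε, ξ)` whose
`x`-derivatives each cost at most `(1+|ξ|)^δ` with `δ < 1`.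

The point specific to generalized functions is that the power of `ε` must not depend on the order
`l` of decrease. Slow scale is what guarantees this. Slow scale factors are dominated by `(1+|ξ|)^η`
once `|ξ|` exceeds another slow scale net (`IsSlowScale.eventually_le_rpow`), hence are absorbed by
a small change of `δ` and `ρ`. On the remaining frequencies `|ξ| < r_ε` every power of `1+|ξ|` is
`O(ε⁻¹)`, so the trivial estimate loses a single factor `ε⁻¹` whatever `l` is
(`rapidlyDecreasing_of_slowFilter`). -/

/-- The space `ℝⁿ`. -/
abbrev Euc (n : ℕ) : Type := EuclideanSpace ℝ (Fin n)

/-! ### Partial derivatives along words -/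

section Words

variable {n : ℕ} {Ω : TopologicalSpace.Opens (Euc n)}

theorem contDiffOn_pdList {f : Euc n → ℂ} (h : ContDiffOn ℝ ∞ f Ω) (w : List (Fin n)) :
    ContDiffOn ℝ ∞ (pdList w f) Ω := by
  induction w generalizing f with
  | nil => exact h
  | cons i w ih => exact ih (contDiffOn_pd h i)

theorem contDiff_pd {f : Euc n → ℂ} (h : ContDiff ℝ ∞ f) (i : Fin n) : ContDiff ℝ ∞ (pd i f) :=
  (h.fderiv_right (m := ∞) (by simp)).clm_apply contDiff_const

theorem pd_comm {f : Euc n → ℂ} (h : ContDiffOn ℝ ∞ f Ω) (i j : Fin n) :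
    EqOn (pd i (pd j f)) (pd j (pd i f)) Ω := by
  intro x hx
  have hf : ContDiffAt ℝ ∞ f x := h.contDiffAt (Ω.isOpen.mem_nhds hx)
  have hd : DifferentiableAt ℝ (fderiv ℝ f) x :=
    (hf.fderiv_right (m := ∞) (by simp)).differentiableAt (by simp)
  have key : ∀ k l : Fin n, pd k (pd l f) x =
      fderiv ℝ (fderiv ℝ f) x (EuclideanSpace.single k 1) (EuclideanSpace.single l 1) := by
    intro k l
    have : pd l f = fun y => (fderiv ℝ f y) (EuclideanSpace.single l 1) := rfl
    rw [pd, this, fderiv_clm_apply hd (differentiableAt_const _)]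
    simp
  rw [key, key]
  exact (hf.isSymmSndFDerivAt (by
    rw [minSmoothness_of_isRCLikeNormedField]; exact WithTop.coe_le_coe.2 le_top)) _ _

/-- Symmetry of second derivatives settles a transposition, and transpositions generate all
permutations. Induction is done over words, while the hypotheses use multi-indices; this lemma links
the two. -/
theorem pdList_perm {w w' : List (Fin n)} (hw : w.Perm w') {f : Euc n → ℂ}
    (h : ContDiffOn ℝ ∞ f Ω) : EqOn (pdList w f) (pdList w' f) Ω := by
  induction hw generalizing f with
  | nil => intro x _; rfl
  | cons i _ ih => exact ih (contDiffOn_pd h i)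
  | swap i j w => exact pdList_congr w (pd_comm h i j)
  | trans _ _ ih₁ ih₂ => exact (ih₁ h).trans (ih₂ h)

theorem count_multiWord (α : Fin n → ℕ) (i : Fin n) : (multiWord α).count i = α i := by
  have : ∀ L : List (Fin n), L.Nodup →
      (L.flatMap fun j => List.replicate (α j) j).count i = if i ∈ L then α i else 0 := by
    intro L
    induction L with
    | nil => simp
    | cons j L ih =>
      intro hL
      rw [List.flatMap_cons, List.count_append, ih hL.of_cons, List.count_replicate]
      have hj : j ∉ L := (List.nodup_cons.1 hL).1
      by_cases hij : j = i
      · subst hij; simp [hj]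
      · simp [hij, Ne.symm hij]
  simpa [multiWord] using this _ (List.nodup_finRange n)

theorem perm_multiWord_count (w : List (Fin n)) : w.Perm (multiWord fun i => w.count i) :=
  List.perm_iff_count.2 fun i => (count_multiWord (fun i => w.count i) i).symm

theorem length_multiWord (α : Fin n → ℕ) : (multiWord α).length = len α := by
  simp [multiWord, len, List.length_flatMap, ← List.ofFn_eq_map, List.sum_ofFn]

theorem len_count (w : List (Fin n)) : len (fun i => w.count i) = w.length := by
  rw [← length_multiWord, (perm_multiWord_count w).length_eq]

end Words

/-! ### Smooth functions supported in a compact set -/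

section TestSpace

variable {n : ℕ}

/-- The smooth functions on `ℝⁿ` that vanish outside the compact set `S`. -/
def testSpace (S : TopologicalSpace.Compacts (Euc n)) : Submodule ℂ (Euc n → ℂ) where
  carrier := {f | ContDiff ℝ ∞ f ∧ ∀ x ∉ S, f x = 0}
  add_mem' := fun hf hg => ⟨hf.1.add hg.1, fun x hx => by simp [hf.2 x hx, hg.2 x hx]⟩
  zero_mem' := ⟨contDiff_const, fun _ _ => rfl⟩
  smul_mem' := fun c _ hf => ⟨contDiff_const.smul hf.1, fun x hx => by simp [hf.2 x hx]⟩

variable {S : TopologicalSpace.Compacts (Euc n)} {O : TopologicalSpace.Opens (Euc n)}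

theorem testSpace_tsupport (f : testSpace S) : tsupport f.1 ⊆ S :=
  closure_minimal (fun x hx => by_contra fun h => hx (f.2.2 x h)) S.isCompact.isClosed

theorem testSpace_hasCompactSupport (f : testSpace S) : HasCompactSupport f.1 :=
  S.isCompact.of_isClosed_subset (isClosed_tsupport _) (testSpace_tsupport f)

/-- The partial derivative on `testSpace S`. -/
def pdV (S : TopologicalSpace.Compacts (Euc n)) (i : Fin n) : testSpace S →ₗ[ℂ] testSpace S where
  toFun f := ⟨pd i f.1, contDiff_pd f.2.1 i, fun x hx => by
    have : f.1 =ᶠ[𝓝 x] fun _ => 0 :=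
      Filter.eventuallyEq_of_mem (S.isCompact.isClosed.isOpen_compl.mem_nhds hx)
        fun y hy => f.2.2 y hy
    simp [pd, this.fderiv_eq]⟩
  map_add' f g := Subtype.ext <| funext fun x => by
    simp [pd, fderiv_add (f.2.1.differentiable (by simp) x) (g.2.1.differentiable (by simp) x)]
  map_smul' c f := Subtype.ext <| funext fun x => by
    simp [pd, fderiv_const_smul (f.2.1.differentiable (by simp) x)]

theorem coe_pdV (i : Fin n) (f : testSpace S) : (pdV S i f).1 = pd i f.1 := rfl

theorem pdV_comm (i j : Fin n) : Commute (pdV S i) (pdV S j) :=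
  LinearMap.ext fun f => Subtype.ext <| funext fun x =>
    pd_comm (Ω := ⊤) f.2.1.contDiffOn i j (mem_univ x)

open Classical in
/-- Multiplication by a function `f` that is smooth on an open set `O ⊇ S`, on `testSpace S`
(the zero map if `f` is not of this kind). -/
def mulV (O : TopologicalSpace.Opens (Euc n)) (S : TopologicalSpace.Compacts (Euc n))
    (f : Euc n → ℂ) : testSpace S →ₗ[ℂ] testSpace S :=
  if h : (S : Set (Euc n)) ⊆ O ∧ ContDiffOn ℝ ∞ f O then
    { toFun := fun g => ⟨f * g.1, by
        refine ⟨contDiff_iff_contDiffAt.2 fun x => ?_, fun x hx => by simp [g.2.2 x hx]⟩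
        by_cases hx : x ∈ S
        · exact (h.2.contDiffAt (O.isOpen.mem_nhds (h.1 hx))).mul g.2.1.contDiffAt
        · have : f * g.1 =ᶠ[𝓝 x] fun _ => 0 :=
            Filter.eventuallyEq_of_mem (S.isCompact.isClosed.isOpen_compl.mem_nhds hx)
              fun y hy => by simp [g.2.2 y hy]
          exact contDiffAt_const.congr_of_eventuallyEq this⟩
      map_add' := fun a b => Subtype.ext (mul_add f a.1 b.1)
      map_smul' := fun c a => Subtype.ext (mul_smul_comm c f a.1) }
  else 0

theorem coe_mulV (hSO : (S : Set (Euc n)) ⊆ O) {f : Euc n → ℂ} (hf : ContDiffOn ℝ ∞ f O)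
    (g : testSpace S) : (mulV O S f g).1 = f * g.1 := by
  rw [mulV, dif_pos ⟨hSO, hf⟩]; rfl

end TestSpace

/-! ### Taylor expansion for commuting elements of an algebra -/

section Taylor

variable {n : ℕ} {R : Type*} [Ring R] [Algebra ℂ R]

/-- The homogeneous part of order `k` in the Taylor expansion of `p(ξ + Y)` at `ξ`. -/
def taylorTerm (Y : Fin n → R) (ξ : Fin n → ℂ) : ℕ → MvPolynomial (Fin n) ℂ → R
  | 0, p => algebraMap ℂ R (MvPolynomial.eval ξ p)
  | k + 1, p => ((k + 1 : ℂ))⁻¹ • ∑ j, Y j * taylorTerm Y ξ k (MvPolynomial.pderiv j p)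

/-- The monomial `X_w` for a word `w`. -/
def wordPoly (w : List (Fin n)) : MvPolynomial (Fin n) ℂ := (w.map MvPolynomial.X).prod

variable {Y : Fin n → R} {ξ : Fin n → ℂ}

theorem taylorTerm_add (k : ℕ) (p q : MvPolynomial (Fin n) ℂ) :
    taylorTerm Y ξ k (p + q) = taylorTerm Y ξ k p + taylorTerm Y ξ k q := by
  induction k generalizing p q with
  | zero => simp [taylorTerm]
  | succ k ih => simp [taylorTerm, ih, mul_add, Finset.sum_add_distrib]

theorem taylorTerm_zero (k : ℕ) : taylorTerm Y ξ k 0 = 0 := by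
  induction k with
  | zero => simp [taylorTerm]
  | succ k ih => simp [taylorTerm, ih]

/-- Compares terms of order `k + 1` in `(ξ_j + Y_j) p(ξ + Y)`. This is the step that makes Taylor's
formula an induction on the length of a monomial, and the place where commutativity of the `Y i`
enters. -/
theorem taylorTerm_X_mul (hY : ∀ i j, Commute (Y i) (Y j)) (j : Fin n) (k : ℕ)
    (p : MvPolynomial (Fin n) ℂ) :
    taylorTerm Y ξ (k + 1) (MvPolynomial.X j * p) =
      ξ j • taylorTerm Y ξ (k + 1) p + Y j * taylorTerm Y ξ k p := by
  have hpd : ∀ i (p : MvPolynomial (Fin n) ℂ), MvPolynomial.pderiv i (MvPolynomial.X j * p) =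
      (if i = j then p else 0) + MvPolynomial.X j * MvPolynomial.pderiv i p := by
    intro i p
    rw [MvPolynomial.pderiv_mul]
    by_cases h : i = j
    · subst h; simp
    · simp [h, MvPolynomial.pderiv_X_of_ne (Ne.symm h)]
  have hsum : ∀ k (p : MvPolynomial (Fin n) ℂ),
      ∑ i, Y i * taylorTerm Y ξ k (if i = j then p else 0) = Y j * taylorTerm Y ξ k p := by
    intro k p
    rw [Finset.sum_eq_single j (fun i _ h => by simp [h, taylorTerm_zero])
      (fun h => absurd (Finset.mem_univ j) h)]
    simp
  induction k generalizing p with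
  | zero =>
    have h1 : ∀ q : MvPolynomial (Fin n) ℂ, taylorTerm Y ξ (0 + 1) q =
        ∑ i, Y i * taylorTerm Y ξ 0 (MvPolynomial.pderiv i q) := fun q => by
      rw [taylorTerm]; simp
    have h0 : ∀ q : MvPolynomial (Fin n) ℂ, taylorTerm Y ξ 0 (MvPolynomial.X j * q) =
        ξ j • taylorTerm Y ξ 0 q := fun q => by simp [taylorTerm, Algebra.smul_def]
    simp only [h1, hpd, taylorTerm_add, mul_add, Finset.sum_add_distrib, hsum, h0, mul_smul_comm,
      ← Finset.smul_sum]
    exact add_comm _ _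
  | succ k ih =>
    have hne : ((k : ℂ) + 1) ≠ 0 := Nat.cast_add_one_ne_zero k
    have hne' : ((k : ℂ) + 1 + 1) ≠ 0 := by exact_mod_cast Nat.cast_add_one_ne_zero (R := ℂ) (k + 1)
    have h1 : ∑ i, Y i * taylorTerm Y ξ k (MvPolynomial.pderiv i p) =
        ((k : ℂ) + 1) • taylorTerm Y ξ (k + 1) p := by
      rw [taylorTerm, smul_smul, mul_inv_cancel₀ hne, one_smul]
    have h2 : ∑ i, Y i * taylorTerm Y ξ (k + 1) (MvPolynomial.pderiv i p) =
        ((k : ℂ) + 1 + 1) • taylorTerm Y ξ (k + 1 + 1) p := by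
      rw [taylorTerm, smul_smul]; push_cast; rw [mul_inv_cancel₀ hne', one_smul]
    rw [taylorTerm]
    simp only [hpd, taylorTerm_add, mul_add, Finset.sum_add_distrib, hsum, ih, mul_smul_comm,
      ← Finset.smul_sum, h2]
    have h3 : ∑ i, Y i * (Y j * taylorTerm Y ξ k (MvPolynomial.pderiv i p)) =
        ((k : ℂ) + 1) • (Y j * taylorTerm Y ξ (k + 1) p) := by
      rw [← mul_smul_comm, ← h1, Finset.mul_sum]
      exact Finset.sum_congr rfl fun i _ => by rw [← mul_assoc, ← mul_assoc, (hY i j).eq]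
    rw [h3]
    push_cast
    rw [smul_comm (ξ j) ((k : ℂ) + 1 + 1)]
    rw [← sub_eq_zero]
    -- Here `a` stands for `ξ_j` times the term of order `k + 2` and `b` for `Y_j` times that of
    -- order `k + 1`. The copy of `b` coming from `∂_j X_j` and the `k + 1` copies coming from
    -- derivatives of `p` add up to cancel the normalisation `1 / (k + 2)`.
    have : ∀ a b : R, ((k : ℂ) + 1 + 1)⁻¹ • (b + (((k : ℂ) + 1 + 1) • a + ((k : ℂ) + 1) • b)) =
        a + b := by
      intro a b
      have e : b + (((k : ℂ) + 1 + 1) • a + ((k : ℂ) + 1) • b) = ((k : ℂ) + 1 + 1) • (a + b) := by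
        rw [smul_add, add_smul ((k : ℂ) + 1) 1 b, one_smul]; abel
      rw [e, smul_smul, inv_mul_cancel₀ hne', one_smul]
    rw [this, sub_self]

theorem taylorTerm_wordPoly_eq_zero (hY : ∀ i j, Commute (Y i) (Y j)) (w : List (Fin n)) (k : ℕ)
    (hk : w.length < k) : taylorTerm Y ξ k (wordPoly w) = 0 := by
  induction w generalizing k with
  | nil =>
    obtain ⟨k, rfl⟩ : ∃ l, k = l + 1 := ⟨k - 1, by simp at hk; omega⟩
    simp [wordPoly, taylorTerm, taylorTerm_zero]
  | cons j w ih =>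
    obtain ⟨k, rfl⟩ : ∃ l, k = l + 1 := ⟨k - 1, by simp at hk; omega⟩
    have hk' : w.length < k := by simpa using hk
    have : wordPoly (j :: w) = MvPolynomial.X j * wordPoly w := by simp [wordPoly]
    rw [this, taylorTerm_X_mul hY, ih _ hk', ih _ (by omega)]
    simp

/-- Taylor's formula for monomials. -/
theorem sum_taylorTerm_wordPoly (hY : ∀ i j, Commute (Y i) (Y j)) (w : List (Fin n)) (K : ℕ)
    (hK : w.length ≤ K) :
    ∑ k ∈ Finset.range (K + 1), taylorTerm Y ξ k (wordPoly w) =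
      (w.map fun i => algebraMap ℂ R (ξ i) + Y i).prod := by
  induction w generalizing K with
  | nil =>
    rw [Finset.sum_eq_single 0]
    · simp [wordPoly, taylorTerm]
    · intro k _ hk
      exact taylorTerm_wordPoly_eq_zero hY [] k (by simpa using Nat.pos_of_ne_zero hk)
    · simp
  | cons j w ih =>
    obtain ⟨K, rfl⟩ : ∃ l, K = l + 1 := ⟨K - 1, by simp at hK; omega⟩
    have hK' : w.length ≤ K := by simpa using hK
    have : wordPoly (j :: w) = MvPolynomial.X j * wordPoly w := by simp [wordPoly]
    rw [Finset.sum_range_succ', this]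
    simp only [taylorTerm_X_mul hY, Finset.sum_add_distrib, List.map_cons, List.prod_cons]
    have h0 : taylorTerm Y ξ 0 (MvPolynomial.X j * wordPoly w) =
        ξ j • taylorTerm Y ξ 0 (wordPoly w) := by
      simp [taylorTerm, Algebra.smul_def]
    rw [h0, add_right_comm, ← Finset.smul_sum, ← smul_add,
      ← Finset.sum_range_succ' (fun k => taylorTerm Y ξ k (wordPoly w)),
      ← Finset.mul_sum, ih K hK', ih (K + 1) (by omega), Algebra.smul_def, add_mul]

end Taylor

/-! ### Integration by parts against oscillating exponentials -/

section Oscillation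

variable {n : ℕ} {S : TopologicalSpace.Compacts (Euc n)} {O : TopologicalSpace.Opens (Euc n)}

/-- The exponential `e^{-i ξ x}`. -/
def osc (ξ x : Euc n) : ℂ := Complex.exp (-Complex.I * ((inner ℝ ξ x : ℝ) : ℂ))

theorem norm_osc (ξ x : Euc n) : ‖osc ξ x‖ = 1 := by
  rw [osc, neg_mul, mul_comm, ← neg_mul, ← Complex.ofReal_neg, Complex.norm_exp_ofReal_mul_I]

theorem contDiff_osc (ξ : Euc n) : ContDiff ℝ ∞ (osc ξ) := by
  refine Complex.contDiff_exp.comp (contDiff_const.mul ?_)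
  exact Complex.ofRealCLM.contDiff.comp (contDiff_const.inner ℝ contDiff_id)

theorem pd_osc (ξ : Euc n) (i : Fin n) (x : Euc n) :
    pd i (osc ξ) x = -Complex.I * ξ i * osc ξ x := by
  have h1 : HasFDerivAt (fun x : Euc n => ((inner ℝ ξ x : ℝ) : ℂ))
      (Complex.ofRealCLM.comp (innerSL ℝ ξ)) x :=
    Complex.ofRealCLM.hasFDerivAt.comp x (innerSL ℝ ξ).hasFDerivAt
  have h2 := (h1.const_mul (-Complex.I)).cexp
  rw [pd, show osc ξ = fun x => Complex.exp (-Complex.I * ((inner ℝ ξ x : ℝ) : ℂ)) from rfl,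
    h2.fderiv]
  simp [EuclideanSpace.inner_single_right]
  ring

/-- The operators `i ∂_j` on `testSpace S`. -/
def negD (S : TopologicalSpace.Compacts (Euc n)) (j : Fin n) : Module.End ℂ (testSpace S) :=
  Complex.I • pdV S j

theorem negD_comm (i j : Fin n) : Commute (negD S i) (negD S j) :=
  ((pdV_comm i j).smul_left _).smul_right _

theorem integrable_mul_testSpace (hSO : (S : Set (Euc n)) ⊆ O) {v : Euc n → ℂ}
    (hv : ContDiffOn ℝ ∞ v O) (k : testSpace S) :
    MeasureTheory.Integrable fun x => v x * k.1 x := by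
  have := (mulV O S v k).2.1.continuous.integrable_of_hasCompactSupport
    (μ := MeasureTheory.volume) (testSpace_hasCompactSupport _)
  rwa [coe_mulV hSO hv] at this

theorem integral_pd_mul (hSO : (S : Set (Euc n)) ⊆ O) {v : Euc n → ℂ}
    (hv : ContDiffOn ℝ ∞ v O) (k : testSpace S) (i : Fin n) :
    ∫ x, pd i v x * k.1 x = -∫ x, v x * pd i k.1 x := by
  rw [eq_comm, neg_eq_iff_eq_neg]
  refine integral_mul_fderiv_eq_neg_fderiv_mul_of_integrable
    (integrable_mul_testSpace hSO (contDiffOn_pd hv i) k)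
    (integrable_mul_testSpace hSO hv (pdV S i k)) (integrable_mul_testSpace hSO hv k) ?_ ?_
  · intro x hx
    exact diffAt hv (hSO (testSpace_tsupport k hx))
  · intro x _
    exact k.2.1.differentiable (by simp) x

/-- Integration by parts turns `-i∂_j` on `v` into `i∂_j` on the test function, and conjugation by
the exponential shifts it: `i∂_j (e^{-iξx} k) = e^{-iξx} (ξ_j + i∂_j) k`. -/
theorem integral_pdList_mul_osc (hSO : (S : Set (Euc n)) ⊆ O) (ξ : Euc n) (w : List (Fin n))
    {v : Euc n → ℂ} (hv : ContDiffOn ℝ ∞ v O) (h : testSpace S) :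
    (-Complex.I) ^ w.length * ∫ x, pdList w v x * (osc ξ x * h.1 x) =
      ∫ x, v x * (osc ξ x * ((w.map fun i =>
        algebraMap ℂ (Module.End ℂ (testSpace S)) (ξ i) + negD S i).prod h).1 x) := by
  induction w generalizing v with
  | nil => simp [pdList]
  | cons i w ih =>
    rw [List.length_cons, pow_succ', mul_assoc, pdList, ih (contDiffOn_pd hv i), List.map_cons,
      List.prod_cons, Module.End.mul_apply]
    set k := (w.map fun i =>
        algebraMap ℂ (Module.End ℂ (testSpace S)) (ξ i) + negD S i).prod h
    have h1 := integral_pd_mul hSO hv (mulV ⊤ S (osc ξ) k) i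
    rw [coe_mulV (O := ⊤) (subset_univ _) (contDiff_osc ξ).contDiffOn] at h1
    simp only [Pi.mul_apply] at h1
    rw [h1, neg_mul_neg, ← MeasureTheory.integral_const_mul]
    congr 1
    funext x
    rw [pd_mul (Ω := ⊤) (contDiff_osc ξ).contDiffOn k.2.1.contDiffOn i (mem_univ x)]
    simp only [Pi.add_apply, Pi.mul_apply, pd_osc, LinearMap.add_apply, Submodule.coe_add,
      Module.algebraMap_end_apply, negD, LinearMap.smul_apply, Submodule.coe_smul, Pi.smul_apply,
      smul_eq_mul, coe_pdV]
    linear_combination -(v x * ξ i * osc ξ x * k.1 x) * Complex.I_mul_I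

end Oscillation

/-! ### The conjugated transpose of a differential operator -/

section Transpose

variable {n : ℕ} {S : TopologicalSpace.Compacts (Euc n)} {O : TopologicalSpace.Opens (Euc n)}

/-- The operator `∑ c_γ D^γ`. -/
def diffOp (m : ℕ) (c : (Fin n → ℕ) → Euc n → ℂ) (v : Euc n → ℂ) (x : Euc n) : ℂ :=
  ∑ γ ∈ multiIndices n m, c γ x * ((-Complex.I) ^ len γ * mpd γ v x)

/-- The operator `e^{iξx} ᵗP e^{-iξx}` on test functions, for `P = ∑ c_γ D^γ`. -/
def conjTranspose (O : TopologicalSpace.Opens (Euc n)) (S : TopologicalSpace.Compacts (Euc n))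
    (m : ℕ) (c : (Fin n → ℕ) → Euc n → ℂ) (ξ : Euc n) : Module.End ℂ (testSpace S) :=
  ∑ γ ∈ multiIndices n m, ((multiWord γ).map fun i =>
    algebraMap ℂ (Module.End ℂ (testSpace S)) (ξ i) + negD S i).prod * mulV O S (c γ)

theorem integral_diffOp_mul_osc (hSO : (S : Set (Euc n)) ⊆ O) (m : ℕ)
    {c : (Fin n → ℕ) → Euc n → ℂ} (hc : ∀ γ, ContDiffOn ℝ ∞ (c γ) O) (ξ : Euc n)
    {v : Euc n → ℂ} (hv : ContDiffOn ℝ ∞ v O) (h : testSpace S) :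
    ∫ x, diffOp m c v x * (osc ξ x * h.1 x) =
      ∫ x, v x * (osc ξ x * (conjTranspose O S m c ξ h).1 x) := by
  have hosc : ∀ k : testSpace S, (fun x => osc ξ x * k.1 x) = (mulV ⊤ S (osc ξ) k).1 := by
    intro k
    rw [coe_mulV (O := ⊤) (subset_univ _) (contDiff_osc ξ).contDiffOn]; rfl
  have hint : ∀ (f : Euc n → ℂ), ContDiffOn ℝ ∞ f O → ∀ k : testSpace S,
      MeasureTheory.Integrable fun x => f x * (osc ξ x * k.1 x) := by
    intro f hf k
    have := integrable_mul_testSpace hSO hf (mulV ⊤ S (osc ξ) k)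
    rwa [← hosc] at this
  have e1 : ∀ x, diffOp m c v x * (osc ξ x * h.1 x) = ∑ γ ∈ multiIndices n m,
      (-Complex.I) ^ len γ * (mpd γ v x * (osc ξ x * (mulV O S (c γ) h).1 x)) := by
    intro x
    rw [diffOp, Finset.sum_mul]
    refine Finset.sum_congr rfl fun γ _ => ?_
    rw [coe_mulV hSO (hc γ)]
    simp only [Pi.mul_apply]
    ring
  have e2 : ∀ x, v x * (osc ξ x * (conjTranspose O S m c ξ h).1 x) =
      ∑ γ ∈ multiIndices n m, v x * (osc ξ x * (((multiWord γ).map fun i =>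
        algebraMap ℂ (Module.End ℂ (testSpace S)) (ξ i) + negD S i).prod
          (mulV O S (c γ) h)).1 x) := by
    intro x
    rw [conjTranspose, LinearMap.sum_apply, Submodule.coe_sum, Finset.sum_apply, Finset.mul_sum,
      Finset.mul_sum]
    rfl
  simp only [e1, e2]
  rw [MeasureTheory.integral_finsetSum, MeasureTheory.integral_finsetSum]
  · refine Finset.sum_congr rfl fun γ _ => ?_
    rw [← integral_pdList_mul_osc hSO ξ (multiWord γ) hv, MeasureTheory.integral_const_mul,
      length_multiWord]
    rfl
  · intro γ _
    exact hint v hv _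
  · intro γ _
    exact (hint _ (contDiffOn_pdList hv _) _).const_mul _

/-- The function `∑ c_γ(x) q_γ(ξ)`. -/
def polySymbol (m : ℕ) (c : (Fin n → ℕ) → Euc n → ℂ) (q : (Fin n → ℕ) → MvPolynomial (Fin n) ℂ)
    (x ξ : Euc n) : ℂ :=
  ∑ γ ∈ multiIndices n m, c γ x * MvPolynomial.eval (fun i => (ξ i : ℂ)) (q γ)

/-- The part of order `k` in the Taylor expansion of `conjTranspose`. -/
def taylorPart (O : TopologicalSpace.Opens (Euc n)) (S : TopologicalSpace.Compacts (Euc n))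
    (m : ℕ) (c : (Fin n → ℕ) → Euc n → ℂ) (ξ : Euc n) (k : ℕ)
    (q : (Fin n → ℕ) → MvPolynomial (Fin n) ℂ) : Module.End ℂ (testSpace S) :=
  ∑ γ ∈ multiIndices n m, taylorTerm (negD S) (fun i => (ξ i : ℂ)) k (q γ) * mulV O S (c γ)

/-- The expansion is exact and stops at `m`, because the symbol is a polynomial of degree at most
`m` in `ξ`; there is no remainder to estimate. -/
theorem conjTranspose_eq_sum (m : ℕ) (c : (Fin n → ℕ) → Euc n → ℂ) (ξ : Euc n) :
    conjTranspose O S m c ξ = ∑ k ∈ Finset.range (m + 1),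
      taylorPart O S m c ξ k fun γ => wordPoly (multiWord γ) := by
  simp only [taylorPart]
  rw [Finset.sum_comm, conjTranspose]
  refine Finset.sum_congr rfl fun γ hγ => ?_
  rw [← Finset.sum_mul, sum_taylorTerm_wordPoly negD_comm]
  rw [length_multiWord]
  exact mem_multiIndices.1 hγ

/-- Each further order exchanges one `∂_{ξ_j}` on the symbol for one `i∂_{x_j}` applied outside.
Estimates can thus be proved by induction on `k`, without multinomial coefficients. -/
theorem taylorPart_succ (m : ℕ) (c : (Fin n → ℕ) → Euc n → ℂ) (ξ : Euc n) (k : ℕ)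
    (q : (Fin n → ℕ) → MvPolynomial (Fin n) ℂ) :
    taylorPart O S m c ξ (k + 1) q = ((k + 1 : ℂ))⁻¹ • ∑ j, negD S j *
      taylorPart O S m c ξ k fun γ => MvPolynomial.pderiv j (q γ) := by
  simp only [taylorPart, taylorTerm, smul_mul_assoc, ← Finset.smul_sum, Finset.mul_sum,
    Finset.sum_mul]
  rw [Finset.sum_comm]
  simp only [mul_assoc]

theorem contDiffOn_polySymbol (m : ℕ) {c : (Fin n → ℕ) → Euc n → ℂ}
    (hc : ∀ γ, ContDiffOn ℝ ∞ (c γ) O) (q : (Fin n → ℕ) → MvPolynomial (Fin n) ℂ) (ξ : Euc n) :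
    ContDiffOn ℝ ∞ (fun x => polySymbol m c q x ξ) O :=
  ContDiffOn.sum fun γ _ => (hc γ).mul contDiffOn_const

theorem taylorPart_zero (hSO : (S : Set (Euc n)) ⊆ O) (m : ℕ) {c : (Fin n → ℕ) → Euc n → ℂ}
    (hc : ∀ γ, ContDiffOn ℝ ∞ (c γ) O) (ξ : Euc n)
    (q : (Fin n → ℕ) → MvPolynomial (Fin n) ℂ) (h : testSpace S) :
    (taylorPart O S m c ξ 0 q h).1 = fun x => polySymbol m c q x ξ * h.1 x := by
  funext x
  rw [taylorPart, LinearMap.sum_apply, Submodule.coe_sum, Finset.sum_apply, polySymbol,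
    Finset.sum_mul]
  refine Finset.sum_congr rfl fun γ _ => ?_
  simp [taylorTerm, coe_mulV hSO (hc γ)]
  ring

theorem eval_wordPoly_multiWord (γ : Fin n → ℕ) (z : Fin n → ℂ) :
    MvPolynomial.eval z (wordPoly (multiWord γ)) = ∏ i, z i ^ γ i := by
  rw [wordPoly, map_list_prod, List.map_map]
  have : (MvPolynomial.eval z) ∘ MvPolynomial.X = z := by funext i; simp
  rw [this, Finset.prod_list_map_count]
  simp only [count_multiWord]
  refine Finset.prod_subset (Finset.subset_univ _) fun i _ hi => ?_
  have : γ i = 0 := by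
    rw [← count_multiWord γ i]
    exact List.count_eq_zero.2 (by simpa using hi)
  simp [this]

theorem symbol_eq_polySymbol {Ω : TopologicalSpace.Opens (Euc n)} (m : ℕ)
    (a : (Fin n → ℕ) → moderate Ω) (ε : ℝ) (x ξ : Euc n) :
    symbol m a ε x ξ =
      polySymbol m (fun γ => (a γ).1 ε) (fun γ => wordPoly (multiWord γ)) x ξ := by
  simp [symbol, polySymbol, eval_wordPoly_multiWord]

theorem contDiff_coord (i : Fin n) : ContDiff ℝ ∞ fun ξ : Euc n => ((ξ i : ℝ) : ℂ) :=
  Complex.ofRealCLM.contDiff.comp (EuclideanSpace.proj i : Euc n →L[ℝ] ℝ).contDiff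

theorem contDiff_eval (p : MvPolynomial (Fin n) ℂ) :
    ContDiff ℝ ∞ fun ξ : Euc n => MvPolynomial.eval (fun i => (ξ i : ℂ)) p := by
  induction p using MvPolynomial.induction_on with
  | C a => simpa using contDiff_const
  | add p q hp hq => simpa using hp.add hq
  | mul_X p j hp => simpa using hp.mul (contDiff_coord j)

theorem pd_coord (i j : Fin n) (ξ : Euc n) :
    pd i (fun ξ : Euc n => ((ξ j : ℝ) : ℂ)) ξ = if j = i then 1 else 0 := by
  have hj : HasFDerivAt (fun η : Euc n => ((η j : ℝ) : ℂ))
      (Complex.ofRealCLM.comp (EuclideanSpace.proj j : Euc n →L[ℝ] ℝ)) ξ :=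
    Complex.ofRealCLM.hasFDerivAt.comp ξ (EuclideanSpace.proj j : Euc n →L[ℝ] ℝ).hasFDerivAt
  rw [pd, hj.fderiv]
  by_cases h : j = i <;> simp [h]

theorem pd_eval (p : MvPolynomial (Fin n) ℂ) (i : Fin n) (ξ : Euc n) :
    pd i (fun ξ : Euc n => MvPolynomial.eval (fun i => (ξ i : ℂ)) p) ξ =
      MvPolynomial.eval (fun i => (ξ i : ℂ)) (MvPolynomial.pderiv i p) := by
  induction p using MvPolynomial.induction_on with
  | C a => simp [pd]
  | add p q hp hq =>
    have := pd_add (Ω := ⊤) (contDiff_eval p).contDiffOn (contDiff_eval q).contDiffOn i (mem_univ ξ)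
    simp only [map_add]
    rw [← hp, ← hq]
    exact this
  | mul_X p j hp =>
    have := pd_mul (Ω := ⊤) (contDiff_eval p).contDiffOn (contDiff_coord j).contDiffOn i
      (mem_univ ξ)
    simp only [MvPolynomial.pderiv_mul, MvPolynomial.pderiv_X, map_add, map_mul,
      MvPolynomial.eval_X]
    refine Eq.trans this ?_
    simp only [Pi.add_apply, Pi.mul_apply, hp, pd_coord]
    by_cases h : j = i
    · subst h; simp
    · simp [h]

theorem pd_polySymbol (m : ℕ) (c : (Fin n → ℕ) → Euc n → ℂ)
    (q : (Fin n → ℕ) → MvPolynomial (Fin n) ℂ) (x : Euc n) (j : Fin n) :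
    pd j (polySymbol m c q x) =
      polySymbol m c (fun γ => MvPolynomial.pderiv j (q γ)) x := by
  funext ξ
  have hd : ∀ γ, DifferentiableAt ℝ
      (fun η : Euc n => MvPolynomial.eval (fun i => (η i : ℂ)) (q γ)) ξ := fun γ =>
    (contDiff_eval (q γ)).differentiable (by simp) ξ
  have : HasFDerivAt (polySymbol m c q x) _ ξ :=
    HasFDerivAt.fun_sum fun γ _ => (hd γ).hasFDerivAt.const_mul (c γ x)
  rw [pd, this.fderiv, polySymbol]
  simp only [← pd_eval, pd]
  simp

/-- The iterated partial derivative of a polynomial along a word. -/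
def pderivList (w : List (Fin n)) (p : MvPolynomial (Fin n) ℂ) : MvPolynomial (Fin n) ℂ :=
  w.foldl (fun p i => MvPolynomial.pderiv i p) p

theorem pdList_polySymbol (m : ℕ) (c : (Fin n → ℕ) → Euc n → ℂ) (w : List (Fin n))
    (q : (Fin n → ℕ) → MvPolynomial (Fin n) ℂ) (x : Euc n) :
    pdList w (polySymbol m c q x) = polySymbol m c (fun γ => pderivList w (q γ)) x := by
  induction w generalizing q with
  | nil => rfl
  | cons i w ih => rw [pdList, pd_polySymbol, ih]; rfl

theorem contDiff_polySymbol (m : ℕ) (c : (Fin n → ℕ) → Euc n → ℂ)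
    (q : (Fin n → ℕ) → MvPolynomial (Fin n) ℂ) (x : Euc n) :
    ContDiff ℝ ∞ (polySymbol m c q x) :=
  ContDiff.sum fun γ _ => contDiff_const.mul (contDiff_eval (q γ))

end Transpose

/-! ### Symbol-type estimates -/

section SymbolBound

variable {n : ℕ} {ι : Type*} {L : Filter ι} {O : TopologicalSpace.Opens (Euc n)} {d : ι → ℝ}

/-- The functions `f p` are smooth on `O` for large `p`, and each derivative of order `k ≤ N` is
bounded on `O` by a multiple of `G p * d p ^ k`. -/
def SymbolBound (L : Filter ι) (O : TopologicalSpace.Opens (Euc n)) (d : ι → ℝ) (N : ℕ)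
    (G : ι → Euc n → ℝ) (f : ι → Euc n → ℂ) : Prop :=
  (∀ᶠ p in L, ContDiffOn ℝ ∞ (f p) O) ∧ ∀ w : List (Fin n), w.length ≤ N → ∃ C : ℝ, 0 ≤ C ∧
    ∀ᶠ p in L, ∀ x ∈ O, ‖pdList w (f p) x‖ ≤ C * (G p x * d p ^ w.length)

variable {N : ℕ} {G H : ι → Euc n → ℝ} {f g : ι → Euc n → ℂ}

theorem SymbolBound.of_le {N' : ℕ} (h : SymbolBound L O d N' G f) (hN : N ≤ N') :
    SymbolBound L O d N G f :=
  ⟨h.1, fun w hw => h.2 w (hw.trans hN)⟩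

theorem SymbolBound.congr (h : SymbolBound L O d N G f)
    (hfg : ∀ᶠ p in L, EqOn (g p) (f p) O) : SymbolBound L O d N G g := by
  refine ⟨?_, fun w hw => ?_⟩
  · filter_upwards [h.1, hfg] with p h1 h2
    exact h1.congr h2
  · obtain ⟨C, hC, hw⟩ := h.2 w hw
    refine ⟨C, hC, ?_⟩
    filter_upwards [hw, hfg] with p h1 h2 x hx
    rw [pdList_congr w h2 hx]
    exact h1 x hx

theorem SymbolBound.mono (h : SymbolBound L O d N G f) (hd : ∀ p, 1 ≤ d p) {C : ℝ} (hC : 0 ≤ C)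
    (hGH : ∀ᶠ p in L, ∀ x ∈ O, G p x ≤ C * H p x) : SymbolBound L O d N H f := by
  refine ⟨h.1, fun w hw => ?_⟩
  obtain ⟨D, hD, hw⟩ := h.2 w hw
  refine ⟨D * C, mul_nonneg hD hC, ?_⟩
  filter_upwards [hw, hGH] with p h1 h2 x hx
  refine (h1 x hx).trans ?_
  rw [mul_assoc, ← mul_assoc C]
  exact mul_le_mul_of_nonneg_left (mul_le_mul_of_nonneg_right (h2 x hx)
    (pow_nonneg (zero_le_one.trans (hd p)) _)) hD

theorem SymbolBound.mono' (h : SymbolBound L O d N G f) (hd : ∀ p, 1 ≤ d p)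
    (hGH : ∀ᶠ p in L, ∀ x ∈ O, G p x ≤ H p x) : SymbolBound L O d N H f :=
  h.mono hd zero_le_one (by simpa using hGH)

theorem SymbolBound.pd (h : SymbolBound L O d (N + 1) G f) (i : Fin n) :
    SymbolBound L O d N (fun p x => G p x * d p) (fun p => pd i (f p)) := by
  refine ⟨?_, fun w hw => ?_⟩
  · filter_upwards [h.1] with p hp
    exact contDiffOn_pd hp i
  · obtain ⟨C, hC, hw⟩ := h.2 (i :: w) (by simpa using hw)
    refine ⟨C, hC, ?_⟩
    filter_upwards [hw] with p h1 x hx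
    refine (h1 x hx).trans (le_of_eq ?_)
    rw [List.length_cons, pow_succ']
    ring

/-- Reduces bounds of order `N + 1` to bounds of order `N` for the first derivatives, so that
products and inverses need only the first order Leibniz and quotient rules. -/
theorem SymbolBound.of_pd (h0 : SymbolBound L O d 0 G f)
    (h : ∀ i, SymbolBound L O d N (fun p x => G p x * d p) (fun p => ColombeauPDO.pd i (f p))) :
    SymbolBound L O d (N + 1) G f := by
  refine ⟨h0.1, fun w hw => ?_⟩
  cases w with
  | nil => exact h0.2 [] le_rfl
  | cons i w =>
    obtain ⟨C, hC, hw⟩ := (h i).2 w (by simpa using hw)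
    refine ⟨C, hC, ?_⟩
    filter_upwards [hw] with p h1 x hx
    refine (h1 x hx).trans (le_of_eq ?_)
    rw [List.length_cons, pow_succ']
    ring

theorem SymbolBound.add (hf : SymbolBound L O d N G f) (hg : SymbolBound L O d N G g) :
    SymbolBound L O d N G (fun p => f p + g p) := by
  refine ⟨?_, fun w hw => ?_⟩
  · filter_upwards [hf.1, hg.1] with p h1 h2
    exact h1.add h2
  · obtain ⟨C, hC, h1⟩ := hf.2 w hw
    obtain ⟨D, hD, h2⟩ := hg.2 w hw
    refine ⟨C + D, add_nonneg hC hD, ?_⟩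
    filter_upwards [hf.1, hg.1, h1, h2] with p s1 s2 h1 h2 x hx
    rw [pdList_add w s1 s2 hx, add_mul]
    exact (norm_add_le _ _).trans (add_le_add (h1 x hx) (h2 x hx))

theorem pdList_const_smul (w : List (Fin n)) (c : ℂ) {f : Euc n → ℂ} (hf : ContDiffOn ℝ ∞ f O) :
    EqOn (pdList w (c • f)) (c • pdList w f) O := by
  induction w generalizing f with
  | nil => intro x _; rfl
  | cons i w ih =>
    have : EqOn (ColombeauPDO.pd i (c • f)) (c • ColombeauPDO.pd i f) O := by
      intro x hx
      simp [ColombeauPDO.pd, fderiv_const_smul (diffAt hf hx)]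
    exact (pdList_congr w this).trans (ih (contDiffOn_pd hf i))

theorem SymbolBound.const_smul (hf : SymbolBound L O d N G f) (c : ℂ) :
    SymbolBound L O d N G (fun p => c • f p) := by
  refine ⟨?_, fun w hw => ?_⟩
  · filter_upwards [hf.1] with p h1
    exact contDiffOn_const.smul h1
  · obtain ⟨C, hC, h1⟩ := hf.2 w hw
    refine ⟨‖c‖ * C, mul_nonneg (norm_nonneg _) hC, ?_⟩
    filter_upwards [hf.1, h1] with p s1 h1 x hx
    rw [pdList_const_smul w c s1 hx, Pi.smul_apply, norm_smul, mul_assoc]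
    exact mul_le_mul_of_nonneg_left (h1 x hx) (norm_nonneg _)

theorem SymbolBound.zero (hd : ∀ p, 1 ≤ d p) (hG : ∀ᶠ p in L, ∀ x ∈ O, 0 ≤ G p x) :
    SymbolBound L O d N G (fun _ => 0) := by
  have h0 : ∀ w : List (Fin n), pdList w (0 : Euc n → ℂ) = 0 := by
    intro w
    induction w with
    | nil => rfl
    | cons i w ih =>
      have : ColombeauPDO.pd i (0 : Euc n → ℂ) = 0 := by
        funext x; simp [ColombeauPDO.pd]
      simpa [pdList, this] using ih
  refine ⟨Eventually.of_forall fun p => contDiffOn_const, fun w _ => ⟨1, zero_le_one, ?_⟩⟩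
  filter_upwards [hG] with p hp x hx
  simpa [h0 w] using mul_nonneg (hp x hx) (pow_nonneg (zero_le_one.trans (hd p)) _)

theorem SymbolBound.sum {κ : Type*} (s : Finset κ) {F : κ → ι → Euc n → ℂ}
    (hd : ∀ p, 1 ≤ d p) (hG : ∀ᶠ p in L, ∀ x ∈ O, 0 ≤ G p x)
    (h : ∀ k ∈ s, SymbolBound L O d N G (F k)) :
    SymbolBound L O d N G (fun p => ∑ k ∈ s, F k p) := by
  classical
  induction s using Finset.induction_on with
  | empty => simpa using SymbolBound.zero hd hG
  | insert a s ha ih =>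
    simp only [Finset.sum_insert ha]
    exact (h a (by simp)).add (ih fun k hk => h k (by simp [hk]))

theorem SymbolBound.mul (hf : SymbolBound L O d N G f) (hg : SymbolBound L O d N H g) :
    SymbolBound L O d N (fun p x => G p x * H p x) (fun p => f p * g p) := by
  have base : ∀ {G H : ι → Euc n → ℝ} {f g : ι → Euc n → ℂ}, SymbolBound L O d 0 G f →
      SymbolBound L O d 0 H g →
      SymbolBound L O d 0 (fun p x => G p x * H p x) (fun p => f p * g p) := by
    intro G H f g hf hg
    refine ⟨?_, fun w hw => ?_⟩
    · filter_upwards [hf.1, hg.1] with p h1 h2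
      exact h1.mul h2
    · obtain rfl : w = [] := List.length_eq_zero_iff.1 (Nat.le_zero.1 hw)
      obtain ⟨C, hC, h1⟩ := hf.2 [] le_rfl
      obtain ⟨D, hD, h2⟩ := hg.2 [] le_rfl
      refine ⟨C * D, mul_nonneg hC hD, ?_⟩
      filter_upwards [h1, h2] with p h1 h2 x hx
      have a1 := h1 x hx
      have a2 := h2 x hx
      simp only [pdList, List.length_nil, pow_zero, mul_one, Pi.mul_apply, norm_mul] at a1 a2 ⊢
      calc ‖f p x‖ * ‖g p x‖ ≤ (C * G p x) * (D * H p x) :=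
            mul_le_mul a1 a2 (norm_nonneg _) ((norm_nonneg _).trans a1)
        _ = _ := by ring
  induction N generalizing G H f g with
  | zero => exact base hf hg
  | succ N ih =>
    refine SymbolBound.of_pd (base (hf.of_le (Nat.zero_le _)) (hg.of_le (Nat.zero_le _)))
      fun i => ?_
    have h1 := ih (hf.pd i) (hg.of_le (Nat.le_succ N))
    have h2 := ih (hf.of_le (Nat.le_succ N)) (hg.pd i)
    have e1 : (fun p x => G p x * d p * H p x) = fun p x => G p x * H p x * d p := by
      funext p x; ring
    have e2 : (fun p x => G p x * (H p x * d p)) = fun p x => G p x * H p x * d p := by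
      funext p x; ring
    rw [e1] at h1
    rw [e2] at h2
    refine (h1.add h2).congr ?_
    filter_upwards [hf.1, hg.1] with p s1 s2
    exact pd_mul s1 s2 i

theorem pd_inv {f : Euc n → ℂ} (hf : ContDiffOn ℝ ∞ f O) (h0 : ∀ x ∈ O, f x ≠ 0) (i : Fin n) :
    EqOn (pd i f⁻¹) ((-1 : ℂ) • (ColombeauPDO.pd i f * (f⁻¹ * f⁻¹))) O := by
  have hinv : ContDiffOn ℝ ∞ f⁻¹ O := hf.inv h0
  have h1 : EqOn (f * f⁻¹) (fun _ => 1) O := fun x hx => mul_inv_cancel₀ (h0 x hx)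
  intro x hx
  have h2 := pd_congr h1 i hx
  rw [pd_mul hf hinv i hx] at h2
  have h3 : ColombeauPDO.pd i (fun _ : Euc n => (1 : ℂ)) x = 0 := by simp [ColombeauPDO.pd]
  rw [h3] at h2
  have h4 := h0 x hx
  simp only [Pi.add_apply, Pi.mul_apply, Pi.inv_apply, Pi.smul_apply, smul_eq_mul] at h2 ⊢
  field_simp at h2 ⊢
  linear_combination h2

/-- The bounds on `f` are relative to `|f|` itself. Then `∂_i f⁻¹ = -(∂_i f) f⁻²` has size `|f| d
|f|⁻² = |f|⁻¹ d`, which carries the induction on `N` without any lower bound for `|f|`. -/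
theorem SymbolBound.inv (hd : ∀ p, 1 ≤ d p) (h0 : ∀ᶠ p in L, ∀ x ∈ O, f p x ≠ 0)
    (hf : SymbolBound L O d N (fun p x => ‖f p x‖) f) :
    SymbolBound L O d N (fun p x => ‖f p x‖⁻¹) (fun p => (f p)⁻¹) := by
  have base : SymbolBound L O d 0 (fun p x => ‖f p x‖⁻¹) (fun p => (f p)⁻¹) := by
    refine ⟨?_, fun w hw => ⟨1, zero_le_one, Eventually.of_forall fun p x _ => ?_⟩⟩
    · filter_upwards [hf.1, h0] with p h1 h2
      exact h1.inv h2
    · obtain rfl : w = [] := List.length_eq_zero_iff.1 (Nat.le_zero.1 hw)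
      simp [pdList]
  induction N with
  | zero => exact base
  | succ N ih =>
    refine SymbolBound.of_pd base fun i => ?_
    have h1 := ih (hf.of_le (Nat.le_succ N))
    have h2 := (((hf.pd i).mul (h1.mul h1)).const_smul (-1)).congr
      (g := fun p => ColombeauPDO.pd i (f p)⁻¹) (by
        filter_upwards [hf.1, h0] with p s1 s2
        exact pd_inv s1 s2 i)
    refine h2.mono' hd ?_
    filter_upwards [h0] with p hp x hx
    have : ‖f p x‖ ≠ 0 := norm_ne_zero_iff.2 (hp x hx)
    refine le_of_eq ?_
    field_simp

theorem SymbolBound.fixed (hd : ∀ p, 1 ≤ d p) {K : Set (Euc n)} (hK : IsCompact K)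
    (hOK : (O : Set (Euc n)) ⊆ K) {O' : TopologicalSpace.Opens (Euc n)}
    (hKO : K ⊆ (O' : Set (Euc n))) {f : Euc n → ℂ} (hf : ContDiffOn ℝ ∞ f O') :
    SymbolBound L O d N (fun _ _ => 1) (fun _ => f) := by
  refine ⟨Eventually.of_forall fun _ => hf.mono (hOK.trans hKO), fun w _ => ?_⟩
  obtain ⟨C, hC⟩ := hK.exists_bound_of_continuousOn
    ((contDiffOn_pdList hf w).continuousOn.mono hKO)
  refine ⟨|C|, abs_nonneg _, Eventually.of_forall fun p x hx => ?_⟩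
  refine ((hC x (hOK hx)).trans (le_abs_self C)).trans ?_
  rw [one_mul]
  exact le_mul_of_one_le_right (abs_nonneg _) (one_le_pow₀ (hd p))

variable {S : TopologicalSpace.Compacts (Euc n)}

/-- Induction on `k` through `taylorPart_succ`, which differentiates the family `q`; hence `q` and
`N` stay quantified. The `k` outer `x`-derivatives produce the factor `d ^ k` and use up `k` of the
`N + k` available derivatives. -/
theorem SymbolBound.taylorPart (hSO : (S : Set (Euc n)) ⊆ O) (hd : ∀ p, 1 ≤ d p) (m : ℕ)
    {c : ι → (Fin n → ℕ) → Euc n → ℂ} (hc : ∀ᶠ p in L, ∀ γ, ContDiffOn ℝ ∞ (c p γ) O)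
    {ξ : ι → Euc n} {h : ι → testSpace S} (hG : ∀ᶠ p in L, ∀ x ∈ O, 0 ≤ G p x) (k : ℕ) :
    ∀ (N : ℕ) (q : (Fin n → ℕ) → MvPolynomial (Fin n) ℂ),
    (∀ w : List (Fin n), w.length = k → SymbolBound L O d (N + k) G fun p x =>
      polySymbol m (c p) (fun γ => pderivList w (q γ)) x (ξ p) * (h p).1 x) →
    SymbolBound L O d N (fun p x => G p x * d p ^ k)
      fun p => (ColombeauPDO.taylorPart O S m (c p) (ξ p) k q (h p)).1 := by
  induction k with
  | zero =>
    intro N q hq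
    simp only [pow_zero, mul_one]
    refine (hq [] rfl).congr ?_
    filter_upwards [hc] with p hp x _
    rw [taylorPart_zero hSO m hp]
    rfl
  | succ k ih =>
    intro N q hq
    have h1 : ∀ j : Fin n, SymbolBound L O d N (fun p x => G p x * d p ^ (k + 1)) fun p =>
        Complex.I • ColombeauPDO.pd j (ColombeauPDO.taylorPart O S m (c p) (ξ p) k
          (fun γ => MvPolynomial.pderiv j (q γ)) (h p)).1 := by
      intro j
      have h2 := ih (N + 1) (fun γ => MvPolynomial.pderiv j (q γ)) fun w hw => by
        have := hq (j :: w) (by simp [hw])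
        rw [show N + 1 + k = N + (k + 1) by ring]
        exact this
      have e : (fun p x => G p x * d p ^ k * d p) = fun p x => G p x * d p ^ (k + 1) := by
        funext p x; ring
      have h3 := h2.pd j
      rw [e] at h3
      exact h3.const_smul _
    have hG' : ∀ᶠ p in L, ∀ x ∈ O, 0 ≤ G p x * d p ^ (k + 1) := by
      filter_upwards [hG] with p hp x hx
      exact mul_nonneg (hp x hx) (pow_nonneg (zero_le_one.trans (hd p)) _)
    refine ((SymbolBound.sum Finset.univ hd hG' fun j _ => h1 j).const_smul
      ((k + 1 : ℂ))⁻¹).congr (Eventually.of_forall fun p x _ => ?_)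
    rw [taylorPart_succ, LinearMap.smul_apply, LinearMap.sum_apply]
    simp only [Submodule.coe_smul, Submodule.coe_sum]
    rfl

end SymbolBound

/-! ### Slow scale nets -/

section SlowScale

variable {n : ℕ}

theorem isSlowScale_const {c : ℝ} (hc : 0 < c) : IsSlowScale fun _ => c := by
  refine ⟨fun _ _ => hc, fun p => ⟨c ^ p, ?_⟩⟩
  filter_upwards [ev_unit] with ε hε
  exact le_mul_of_one_le_right (pow_nonneg hc.le _) ((one_le_inv₀ hε.1).2 hε.2)

/-- This is what makes `slowFilter` closed under finite intersections: finitely many estimates, each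
with its own slow scale threshold, hold beyond a common one. -/
theorem IsSlowScale.max {r s : ℝ → ℝ} (hr : IsSlowScale r) (hs : IsSlowScale s) :
    IsSlowScale fun ε => max (r ε) (s ε) := by
  refine ⟨fun ε hε => lt_max_of_lt_left (hr.1 ε hε), fun p => ?_⟩
  obtain ⟨C, hC⟩ := hr.2 p
  obtain ⟨D, hD⟩ := hs.2 p
  refine ⟨C + D, ?_⟩
  filter_upwards [hC, hD, ev_unit] with ε h1 h2 hε
  have p1 : 0 ≤ r ε ^ p := pow_nonneg (hr.1 ε hε).le _
  have p2 : 0 ≤ s ε ^ p := pow_nonneg (hs.1 ε hε).le _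
  rcases max_choice (r ε) (s ε) with h | h <;> rw [h] <;> linarith

theorem IsSlowScale.pow {r : ℝ → ℝ} (hr : IsSlowScale r) (k : ℕ) :
    IsSlowScale fun ε => r ε ^ k := by
  refine ⟨fun ε hε => pow_pos (hr.1 ε hε) _, fun p => ?_⟩
  obtain ⟨C, hC⟩ := hr.2 (k * p)
  exact ⟨C, by simpa only [pow_mul] using hC⟩

/-- The filter on pairs `(ε, ξ)` generated by the sets `{ε < ε₀, ξ ∈ Γ, |ξ| ≥ r_ε}` with `r` of
slow scale. -/
def slowFilter (Γ : Set (Euc n)) : Filter (ℝ × Euc n) where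
  sets := {s | ∃ r, IsSlowScale r ∧ ∃ ε₀ > 0, ∀ ε ∈ Ioo 0 ε₀, ∀ ξ ∈ Γ, r ε ≤ ‖ξ‖ → (ε, ξ) ∈ s}
  univ_sets := ⟨_, isSlowScale_const one_pos, 1, one_pos, fun _ _ _ _ _ => trivial⟩
  sets_of_superset := by
    rintro s t ⟨r, hr, ε₀, hε₀, h⟩ hst
    exact ⟨r, hr, ε₀, hε₀, fun ε hε ξ hξ hrξ => hst (h ε hε ξ hξ hrξ)⟩
  inter_sets := by
    rintro s t ⟨r, hr, ε₀, hε₀, h⟩ ⟨r', hr', ε₀', hε₀', h'⟩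
    refine ⟨_, hr.max hr', min ε₀ ε₀', lt_min hε₀ hε₀', fun ε hε ξ hξ hrξ => ⟨?_, ?_⟩⟩
    · exact h ε ⟨hε.1, hε.2.trans_le (min_le_left _ _)⟩ ξ hξ ((le_max_left _ _).trans hrξ)
    · exact h' ε ⟨hε.1, hε.2.trans_le (min_le_right _ _)⟩ ξ hξ ((le_max_right _ _).trans hrξ)

variable {Γ : Set (Euc n)}

theorem eventually_slowFilter {P : ℝ × Euc n → Prop} : (∀ᶠ p in slowFilter Γ, P p) ↔
    ∃ r, IsSlowScale r ∧ ∃ ε₀ > 0, ∀ ε ∈ Ioo 0 ε₀, ∀ ξ ∈ Γ, r ε ≤ ‖ξ‖ → P (ε, ξ) := Iff.rfl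

theorem eventually_slowFilter_of_le {P : ℝ × Euc n → Prop} {r : ℝ → ℝ} (hr : IsSlowScale r)
    (h : ∀ᶠ ε in 𝓝[>] (0 : ℝ), ∀ ξ ∈ Γ, r ε ≤ ‖ξ‖ → P (ε, ξ)) : ∀ᶠ p in slowFilter Γ, P p := by
  obtain ⟨ε₀, hε₀, h⟩ := (mem_nhdsGT_iff_exists_Ioo_subset).1 h
  exact ⟨r, hr, ε₀, hε₀, fun ε hε => h hε⟩

theorem eventually_slowFilter_fst {P : ℝ → Prop} (h : ∀ᶠ ε in 𝓝[>] (0 : ℝ), P ε) :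
    ∀ᶠ p in slowFilter Γ, P p.1 :=
  eventually_slowFilter_of_le (isSlowScale_const one_pos) (h.mono fun _ h _ _ _ => h)

theorem eventually_slowFilter_mem : ∀ᶠ p in slowFilter Γ, p.2 ∈ Γ :=
  eventually_slowFilter_of_le (isSlowScale_const one_pos) (Eventually.of_forall fun _ _ h _ => h)

theorem eventually_slowFilter_norm {r : ℝ → ℝ} (hr : IsSlowScale r) :
    ∀ᶠ p in slowFilter Γ, r p.1 ≤ ‖p.2‖ :=
  eventually_slowFilter_of_le hr (Eventually.of_forall fun _ _ _ h => h)

/-- Powers of slow scale nets are of slow scale, so `|ξ| ≥ s_ε ^ k` with `k > 1/η` is an admissible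
threshold, and beyond it `s_ε ≤ (1+|ξ|)^{1/k}`. A slow scale factor is thereby traded for an
arbitrarily small power of `|ξ|`, with no power of `ε`. -/
theorem IsSlowScale.eventually_le_rpow {s : ℝ → ℝ} (hs : IsSlowScale s) {η : ℝ} (hη : 0 < η) :
    ∀ᶠ p in slowFilter Γ, s p.1 ≤ (1 + ‖p.2‖) ^ η := by
  obtain ⟨k, hk⟩ := exists_nat_gt η⁻¹
  have hk0 : (0 : ℝ) < k := (inv_pos.2 hη).trans hk
  filter_upwards [eventually_slowFilter_norm (hs.pow k), eventually_slowFilter_fst ev_unit]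
    with p hp hε
  have h1 : s p.1 ^ k ≤ 1 + ‖p.2‖ := by linarith
  have h2 : (1 : ℝ) ≤ 1 + ‖p.2‖ := by linarith [norm_nonneg p.2]
  calc s p.1 = (s p.1 ^ k) ^ ((k : ℝ)⁻¹) :=
        (Real.pow_rpow_inv_natCast (hs.1 _ hε).le (by rintro rfl; simp at hk0)).symm
    _ ≤ (1 + ‖p.2‖) ^ ((k : ℝ)⁻¹) :=
        Real.rpow_le_rpow (pow_nonneg (hs.1 _ hε).le _) h1 (inv_nonneg.2 hk0.le)
    _ ≤ (1 + ‖p.2‖) ^ η := Real.rpow_le_rpow_of_exponent_le h2 (inv_le_of_inv_le₀ hη hk.le)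

end SlowScale

/-! ### Fourier transforms of test functions -/

section Fourier

open MeasureTheory

variable {n : ℕ} {S : TopologicalSpace.Compacts (Euc n)}

/-- The Fourier transform `∫ f(x) e^{-i ξ x} dx`. -/
def hat (f : Euc n → ℂ) (ξ : Euc n) : ℂ := ∫ x, f x * osc ξ x

theorem fourierLoc_eq_hat (φ v : Euc n → ℂ) (ξ : Euc n) :
    fourierLoc φ v ξ = hat (fun x => φ x * v x) ξ := rfl

theorem continuous_osc (ξ : Euc n) : Continuous (osc ξ) := (contDiff_osc ξ).continuous

theorem integrable_mul_osc {f : Euc n → ℂ} (hf : Integrable f) (ξ : Euc n) :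
    Integrable fun x => f x * osc ξ x :=
  hf.mul_bdd (c := 1) (continuous_osc ξ).aestronglyMeasurable
    (Eventually.of_forall fun x => (norm_osc ξ x).le)

theorem norm_hat_le (f : Euc n → ℂ) (ξ : Euc n) : ‖hat f ξ‖ ≤ ∫ x, ‖f x‖ := by
  refine (norm_integral_le_integral_norm _).trans (le_of_eq ?_)
  simp [norm_osc]

theorem integrable_testSpace (g : testSpace S) : Integrable g.1 :=
  g.2.1.continuous.integrable_of_hasCompactSupport (testSpace_hasCompactSupport g)

theorem integral_norm_testSpace_le (g : testSpace S) {B : ℝ} (hB : ∀ x ∈ S, ‖g.1 x‖ ≤ B) :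
    ∫ x, ‖g.1 x‖ ≤ volume.real (S : Set (Euc n)) * B := by
  rw [← setIntegral_eq_integral_of_forall_compl_eq_zero (s := S)
    fun x hx => by simp [g.2.2 x hx]]
  have := norm_setIntegral_le_of_norm_le_const (μ := volume) (f := fun x => ‖g.1 x‖)
    S.isCompact.measure_lt_top (C := B) fun x hx => by simpa using hB x hx
  rw [mul_comm]
  exact (Real.le_norm_self _).trans this

theorem hat_pd (g : testSpace S) (i : Fin n) (ξ : Euc n) :
    hat (pd i g.1) ξ = Complex.I * ξ i * hat g.1 ξ := by
  have h := integral_pd_mul (O := ⊤) (subset_univ _) (contDiff_osc ξ).contDiffOn g i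
  rw [hat, hat, ← integral_const_mul]
  have e1 : ∀ x, pd i g.1 x * osc ξ x = osc ξ x * pd i g.1 x := fun x => mul_comm _ _
  simp only [e1]
  rw [← neg_eq_iff_eq_neg] at h
  rw [← h, ← integral_neg]
  congr 1
  funext x
  rw [pd_osc]
  ring

theorem exists_pdList_testSpace (w : List (Fin n)) (g : testSpace S) :
    ∃ h : testSpace S, h.1 = pdList w g.1 := by
  induction w generalizing g with
  | nil => exact ⟨g, rfl⟩
  | cons i w ih => exact ih (pdV S i g)

theorem hat_pdList_replicate (g : testSpace S) (i : Fin n) (k : ℕ) (ξ : Euc n) :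
    hat (pdList (List.replicate k i) g.1) ξ = (Complex.I * ξ i) ^ k * hat g.1 ξ := by
  induction k generalizing g with
  | zero => simp [pdList]
  | succ k ih =>
    rw [List.replicate_succ, pdList, ← coe_pdV, ih, coe_pdV, hat_pd]
    ring

/-- Either all coordinates are at most `1`, or the largest one dominates the norm. Decay of a
Fourier transform can therefore be read off from repeated derivatives in a single coordinate
direction. -/
theorem one_add_norm_pow_le (ξ : Euc n) (k : ℕ) :
    (1 + ‖ξ‖) ^ k ≤ ((n : ℝ) + 1) ^ k ∨ ∃ i, (1 + ‖ξ‖) ^ k ≤ ((n : ℝ) + 1) ^ k * |ξ i| ^ k := by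
  by_cases h : ∀ i, |ξ i| ≤ 1
  · left
    have hsum : ‖ξ‖ ≤ n := by
      have h1 : ‖ξ‖ ^ 2 ≤ n := by
        rw [EuclideanSpace.norm_sq_eq]
        calc ∑ i, ‖ξ i‖ ^ 2 ≤ ∑ _i : Fin n, (1 : ℝ) :=
              Finset.sum_le_sum fun i _ => pow_le_one₀ (norm_nonneg _) (h i)
          _ = n := by simp
      rcases Nat.eq_zero_or_pos n with rfl | hn
      · have : ‖ξ‖ ^ 2 = 0 := le_antisymm (by simpa using h1) (sq_nonneg _)
        simp [pow_eq_zero_iff] at this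
        simp [this]
      · have : (1 : ℝ) ≤ n := by exact_mod_cast hn
        nlinarith [norm_nonneg ξ]
    exact pow_le_pow_left₀ (by positivity) (by linarith) k
  · right
    push Not at h
    obtain ⟨i₀, hi₀⟩ := h
    obtain ⟨i, -, hi⟩ := Finset.exists_max_image Finset.univ (fun i => |ξ i|) ⟨i₀, Finset.mem_univ _⟩
    refine ⟨i, ?_⟩
    have h1 : 1 ≤ |ξ i| := hi₀.le.trans (hi i₀ (Finset.mem_univ _))
    have h2 : ‖ξ‖ ≤ n * |ξ i| := by
      have hn : (1 : ℝ) ≤ n := by exact_mod_cast i.pos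
      refine le_of_sq_le_sq ?_ (by positivity)
      rw [EuclideanSpace.norm_sq_eq]
      calc ∑ j, ‖ξ j‖ ^ 2 ≤ ∑ _j : Fin n, |ξ i| ^ 2 :=
            Finset.sum_le_sum fun j _ => pow_le_pow_left₀ (norm_nonneg _)
              (hi j (Finset.mem_univ _)) 2
        _ = n * |ξ i| ^ 2 := by simp
        _ ≤ (n * |ξ i|) ^ 2 := by nlinarith [sq_nonneg (|ξ i|)]
    rw [← mul_pow]
    exact pow_le_pow_left₀ (by positivity) (by linarith) k

theorem norm_hat_mul_pow_le (g : testSpace S) (k : ℕ) {B : ℝ} (hB : ∀ x ∈ S, ‖g.1 x‖ ≤ B)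
    (hB' : ∀ i, ∀ x ∈ S, ‖pdList (List.replicate k i) g.1 x‖ ≤ B) (ξ : Euc n) :
    ‖hat g.1 ξ‖ * (1 + ‖ξ‖) ^ k ≤ ((n : ℝ) + 1) ^ k * (volume.real (S : Set (Euc n)) * B) := by
  rcases one_add_norm_pow_le ξ k with h | ⟨i, h⟩
  · rw [mul_comm]
    exact mul_le_mul h ((norm_hat_le _ _).trans (integral_norm_testSpace_le g hB))
      (norm_nonneg _) (by positivity)
  · obtain ⟨h', hh'⟩ := exists_pdList_testSpace (List.replicate k i) g
    have h1 : ‖hat (pdList (List.replicate k i) g.1) ξ‖ ≤ volume.real (S : Set (Euc n)) * B := by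
      rw [← hh']
      refine (norm_hat_le _ _).trans (integral_norm_testSpace_le h' ?_)
      rw [hh']
      exact hB' i
    have h2 : ‖hat (pdList (List.replicate k i) g.1) ξ‖ = |ξ i| ^ k * ‖hat g.1 ξ‖ := by
      rw [hat_pdList_replicate]; simp
    rw [h2] at h1
    calc ‖hat g.1 ξ‖ * (1 + ‖ξ‖) ^ k ≤ ‖hat g.1 ξ‖ * (((n : ℝ) + 1) ^ k * |ξ i| ^ k) :=
          mul_le_mul_of_nonneg_left h (norm_nonneg _)
      _ = ((n : ℝ) + 1) ^ k * (|ξ i| ^ k * ‖hat g.1 ξ‖) := by ring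
      _ ≤ _ := mul_le_mul_of_nonneg_left h1 (by positivity)

theorem fourier_eq_hat (f : Euc n → ℂ) (η : Euc n) :
    FourierTransform.fourier f η = hat f ((2 * Real.pi) • η) := by
  rw [Real.fourier_eq', hat]
  congr 1
  funext x
  rw [smul_eq_mul, mul_comm, osc, inner_smul_left, real_inner_comm]
  congr 2
  push_cast
  simp
  ring

theorem integrable_hat (g : testSpace S) : Integrable fun η => hat g.1 ((2 * Real.pi) • η) := by
  have h := ((FourierTransform.fourier
    ((testSpace_hasCompactSupport g).toSchwartzMap g.2.1))).integrable (μ := volume)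
  rw [SchwartzMap.fourier_coe] at h
  refine h.congr (Eventually.of_forall fun η => ?_)
  exact fourier_eq_hat _ _

theorem testSpace_eq_integral (g : testSpace S) (x : Euc n) :
    g.1 x = ∫ η, hat g.1 ((2 * Real.pi) • η) * osc (-((2 * Real.pi) • η)) x := by
  have h := g.2.1.continuous.fourierInv_fourier_eq (integrable_testSpace g)
    ((integrable_hat g).congr (Eventually.of_forall fun η => (fourier_eq_hat _ _).symm))
  rw [← congrFun h x, Real.fourierInv_eq']
  congr 1
  funext η
  rw [fourier_eq_hat, smul_eq_mul, mul_comm, osc, inner_neg_left, inner_smul_left]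
  congr 2
  push_cast
  simp
  ring

theorem osc_mul_osc (ξ η x : Euc n) : osc ξ x * osc η x = osc (ξ + η) x := by
  rw [osc, osc, osc, ← Complex.exp_add, inner_add_left]
  congr 1
  push_cast
  ring

/-- The convolution theorem, obtained by inserting Fourier inversion for `g` and applying Fubini.
Scaling the frequency by `2π` absorbs the normalising constant of the inversion formula. -/
theorem integral_mul_osc_mul {F : Euc n → ℂ} (hF : Integrable F) (g : testSpace S) (ξ : Euc n) :
    ∫ x, F x * (osc ξ x * g.1 x) =
      ∫ η, hat g.1 ((2 * Real.pi) • η) * hat F (ξ - (2 * Real.pi) • η) := by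
  have e1 : ∀ x, F x * (osc ξ x * g.1 x) =
      ∫ η, (F x * hat g.1 ((2 * Real.pi) • η)) * osc (ξ - (2 * Real.pi) • η) x := by
    intro x
    rw [testSpace_eq_integral g x, ← mul_assoc, ← integral_const_mul]
    congr 1
    funext η
    rw [sub_eq_add_neg, ← osc_mul_osc]
    ring
  have e2 : ∀ η, hat g.1 ((2 * Real.pi) • η) * hat F (ξ - (2 * Real.pi) • η) =
      ∫ x, (F x * hat g.1 ((2 * Real.pi) • η)) * osc (ξ - (2 * Real.pi) • η) x := by
    intro η
    rw [hat.eq_def F, ← integral_const_mul]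
    congr 1
    funext x
    ring
  simp only [e1, e2]
  refine integral_integral_swap ?_
  refine (hF.mul_prod (integrable_hat g)).mul_bdd (c := 1) ?_
    (Eventually.of_forall fun p => (norm_osc _ _).le)
  refine Continuous.aestronglyMeasurable ?_
  simp only [osc]
  fun_prop

theorem exists_integral_bound (n : ℕ) : ∃ I : ℝ, 0 ≤ I ∧
    (Integrable fun η : Euc n => ((1 + ‖(2 * Real.pi) • η‖) ^ (n + 1))⁻¹) ∧
    ∫ η : Euc n, ((1 + ‖(2 * Real.pi) • η‖) ^ (n + 1))⁻¹ = I := by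
  refine ⟨_, integral_nonneg fun η => by positivity, ?_, rfl⟩
  have h := integrable_one_add_norm (E := Euc n) (μ := volume) (r := (n : ℝ) + 1) (by simp)
  have h2 := h.comp_smul (R := 2 * Real.pi) (by positivity)
  refine h2.congr (Eventually.of_forall fun η => ?_)
  simp only
  rw [Real.rpow_neg (by positivity)]
  norm_cast

/-- Splitting of the convolution integral at `|η| = c |ξ|`. -/
theorem exists_norm_integral_mul_osc_mul_le (n : ℕ) : ∃ I : ℝ, 0 ≤ I ∧
    ∀ (S : TopologicalSpace.Compacts (Euc n)) (F : Euc n → ℂ) (_ : Integrable F) (g : testSpace S)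
      (ξ : Euc n) (Γ : Set (Euc n)) (c A A' B B' : ℝ) (l k : ℕ), 0 < c → c ≤ 1 / 2 →
      (∀ η, ‖η‖ ≤ c * ‖ξ‖ → ξ - η ∈ Γ) → ∫ x, ‖F x‖ ≤ A →
      (∀ ζ ∈ Γ, ‖hat F ζ‖ ≤ A' * ((1 + ‖ζ‖) ^ l)⁻¹) → 0 ≤ A' →
      (∀ η, ‖hat g.1 η‖ * (1 + ‖η‖) ^ (n + 1) ≤ B) →
      (∀ η, ‖hat g.1 η‖ * (1 + ‖η‖) ^ (n + 1 + k) ≤ B') →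
      ‖∫ x, F x * (osc ξ x * g.1 x)‖ ≤
        I * (B * A' * 2 ^ l * ((1 + ‖ξ‖) ^ l)⁻¹ + B' * A * (c ^ k)⁻¹ * ((1 + ‖ξ‖) ^ k)⁻¹) := by
  obtain ⟨I, hI, hint, hI'⟩ := exists_integral_bound n
  refine ⟨I, hI, ?_⟩
  intro S F hF g ξ Γ c A A' B B' l k hc hc2 hΓ hA hA' hA'0 hB hB'
  have hA0 : 0 ≤ A := (integral_nonneg fun _ => norm_nonneg _).trans hA
  have hB0 : 0 ≤ B := (by positivity : 0 ≤ ‖hat g.1 0‖ * (1 + ‖(0 : Euc n)‖) ^ (n + 1)).trans (hB 0)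
  have hB'0 : 0 ≤ B' :=
    (by positivity : 0 ≤ ‖hat g.1 0‖ * (1 + ‖(0 : Euc n)‖) ^ (n + 1 + k)).trans (hB' 0)
  rw [integral_mul_osc_mul hF]
  set D := B * A' * 2 ^ l * ((1 + ‖ξ‖) ^ l)⁻¹ + B' * A * (c ^ k)⁻¹ * ((1 + ‖ξ‖) ^ k)⁻¹
  have key : ∀ η : Euc n, ‖hat g.1 η * hat F (ξ - η)‖ ≤ D * ((1 + ‖η‖) ^ (n + 1))⁻¹ := by
    intro η
    rw [norm_mul]
    have hp : 0 < (1 + ‖η‖) ^ (n + 1) := by positivity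
    by_cases h : ‖η‖ ≤ c * ‖ξ‖
    · have h1 : ‖hat F (ξ - η)‖ ≤ A' * (2 ^ l * ((1 + ‖ξ‖) ^ l)⁻¹) := by
        refine (hA' _ (hΓ η h)).trans (mul_le_mul_of_nonneg_left ?_ hA'0)
        have h3 : ‖ξ‖ - ‖η‖ ≤ ‖ξ - η‖ := norm_sub_norm_le _ _
        -- Since `c ≤ 1/2`, the shifted frequency keeps at least half the size of `ξ`.
        have h4 : (1 + ‖ξ‖) / 2 ≤ 1 + ‖ξ - η‖ := by nlinarith [norm_nonneg ξ]
        have h5 : ((1 + ‖ξ‖) / 2) ^ l ≤ (1 + ‖ξ - η‖) ^ l :=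
          pow_le_pow_left₀ (by positivity) h4 l
        calc ((1 + ‖ξ - η‖) ^ l)⁻¹ ≤ (((1 + ‖ξ‖) / 2) ^ l)⁻¹ := inv_anti₀ (by positivity) h5
          _ = _ := by rw [div_pow, inv_div, div_eq_mul_inv]
      have h2 : ‖hat g.1 η‖ ≤ B * ((1 + ‖η‖) ^ (n + 1))⁻¹ := by
        rw [← div_eq_mul_inv, le_div_iff₀ hp]; exact hB η
      calc ‖hat g.1 η‖ * ‖hat F (ξ - η)‖
          ≤ (B * ((1 + ‖η‖) ^ (n + 1))⁻¹) * (A' * (2 ^ l * ((1 + ‖ξ‖) ^ l)⁻¹)) :=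
            mul_le_mul h2 h1 (norm_nonneg _) (by positivity)
        _ = (B * A' * 2 ^ l * ((1 + ‖ξ‖) ^ l)⁻¹) * ((1 + ‖η‖) ^ (n + 1))⁻¹ := by ring
        _ ≤ _ := mul_le_mul_of_nonneg_right (le_add_of_nonneg_right (by positivity))
            (by positivity)
    · push Not at h
      have h1 : ‖hat F (ξ - η)‖ ≤ A := (norm_hat_le _ _).trans hA
      -- Far from the origin `hat F` has only its trivial bound. Of the `n + 1 + k` powers of decay
      -- of `hat g`, `k` are converted into decay in `ξ`, and `n + 1` are kept for integrability in
      -- `η`.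
      have h3 : c * (1 + ‖ξ‖) ≤ 1 + ‖η‖ := by linarith
      have h4 : (c * (1 + ‖ξ‖)) ^ k ≤ (1 + ‖η‖) ^ k := pow_le_pow_left₀ (by positivity) h3 k
      have h2 : ‖hat g.1 η‖ ≤ B' * ((c ^ k)⁻¹ * ((1 + ‖ξ‖) ^ k)⁻¹) * ((1 + ‖η‖) ^ (n + 1))⁻¹ := by
        rw [← mul_inv, ← mul_pow, ← div_eq_mul_inv, ← div_eq_mul_inv, le_div_iff₀ hp,
          le_div_iff₀ (by positivity)]
        refine le_trans ?_ (hB' η)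
        rw [pow_add _ (n + 1), mul_assoc]
        exact mul_le_mul_of_nonneg_left (mul_le_mul_of_nonneg_left h4 hp.le) (norm_nonneg _)
      calc ‖hat g.1 η‖ * ‖hat F (ξ - η)‖
          ≤ (B' * ((c ^ k)⁻¹ * ((1 + ‖ξ‖) ^ k)⁻¹) * ((1 + ‖η‖) ^ (n + 1))⁻¹) * A :=
            mul_le_mul h2 h1 (norm_nonneg _) (by positivity)
        _ = (B' * A * (c ^ k)⁻¹ * ((1 + ‖ξ‖) ^ k)⁻¹) * ((1 + ‖η‖) ^ (n + 1))⁻¹ := by ring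
        _ ≤ _ := mul_le_mul_of_nonneg_right (le_add_of_nonneg_left (by positivity))
            (by positivity)
  refine (norm_integral_le_of_norm_le (hint.const_mul D)
    (Eventually.of_forall fun η => key _)).trans (le_of_eq ?_)
  rw [integral_const_mul, hI', mul_comm]

end Fourier

/-! ### Rapid decrease is stable under multiplication by symbols -/

section Rapid

open MeasureTheory

variable {n : ℕ} {S : TopologicalSpace.Compacts (Euc n)} {O : TopologicalSpace.Opens (Euc n)}

theorem SymbolBound.exists_hat_bound {ι : Type*} {L : Filter ι} {d : ι → ℝ} (hd : ∀ p, 1 ≤ d p)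
    (hSO : (S : Set (Euc n)) ⊆ O) {G : ι → ℝ} (hG : ∀ᶠ p in L, 0 ≤ G p)
    {g : ι → testSpace S} (k : ℕ)
    (hg : SymbolBound L O d k (fun p _ => G p) (fun p => (g p).1)) :
    ∃ C : ℝ, 0 ≤ C ∧ ∀ᶠ p in L, ∀ η, ‖hat (g p).1 η‖ * (1 + ‖η‖) ^ k ≤ C * (G p * d p ^ k) := by
  obtain ⟨C₀, hC₀, h₀⟩ := hg.2 [] (Nat.zero_le _)
  choose C hC h using fun i : Fin n => hg.2 (List.replicate k i) (by simp)
  refine ⟨((n : ℝ) + 1) ^ k * (volume.real (S : Set (Euc n)) * (C₀ + ∑ i, C i)),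
    mul_nonneg (by positivity) (mul_nonneg measureReal_nonneg
      (add_nonneg hC₀ (Finset.sum_nonneg fun i _ => hC i))), ?_⟩
  filter_upwards [h₀, eventually_all.2 h, hG] with p h1 h2 h3 η
  have hdk : 1 ≤ d p ^ k := one_le_pow₀ (hd p)
  have hGd : 0 ≤ G p * d p ^ k := mul_nonneg h3 (zero_le_one.trans hdk)
  have := norm_hat_mul_pow_le (g p) k (B := (C₀ + ∑ i, C i) * (G p * d p ^ k)) ?_ ?_ η
  · refine this.trans (le_of_eq (by ring))
  · intro x hx
    refine (h1 x (hSO hx)).trans ?_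
    simp only [List.length_nil, pow_zero, mul_one]
    exact mul_le_mul (le_add_of_nonneg_right (Finset.sum_nonneg fun i _ => hC i))
      (le_mul_of_one_le_right h3 hdk) h3 (add_nonneg hC₀ (Finset.sum_nonneg fun i _ => hC i))
  · intro i x hx
    refine (h2 i x (hSO hx)).trans ?_
    rw [List.length_replicate]
    refine mul_le_mul_of_nonneg_right ?_ hGd
    have := Finset.single_le_sum (f := C) (fun i _ => hC i) (Finset.mem_univ i)
    linarith

/-- The integral is a convolution of `hat F` and `hat g`. For `|η| ≤ c|ξ|` the frequency `ξ - η`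
lies in `Γ₁`, where `hat F` decays; for larger `|η|` the decay of `hat g` takes over. The amplitude
contributes `ε^{-Q}` once, and its derivatives cost only powers of `1+|ξ|`, so the exponent `M + Q`
is the same for all `l`. -/
theorem rapid_mul {Γ₁ Γ₂ : Set (Euc n)} {c : ℝ} (hc : 0 < c) (hc2 : c ≤ 1 / 2)
    (hΓ : ∀ ξ ∈ Γ₂, ∀ η, ‖η‖ ≤ c * ‖ξ‖ → ξ - η ∈ Γ₁) {F : ℝ → Euc n → ℂ} {M : ℕ} {A : ℝ}
    (hF : ∀ᶠ ε in 𝓝[>] (0 : ℝ), Integrable (F ε) ∧ ∫ x, ‖F ε x‖ ≤ A * (ε ^ M)⁻¹)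
    (hdec : ∀ l : ℕ, ∃ C : ℝ, ∀ᶠ ε in 𝓝[>] (0 : ℝ), ∀ ξ ∈ Γ₁,
      ‖hat (F ε) ξ‖ ≤ C * (ε ^ M)⁻¹ * ((1 + ‖ξ‖) ^ l)⁻¹)
    (hSO : (S : Set (Euc n)) ⊆ O) {δ μ : ℝ} (hδ0 : 0 ≤ δ) (hδ : δ < 1) {Q : ℕ}
    {g : ℝ × Euc n → testSpace S}
    (hg : ∀ N, SymbolBound (slowFilter Γ₂) O (fun p => (1 + ‖p.2‖) ^ δ) N
      (fun p _ => (p.1 ^ Q)⁻¹ * (1 + ‖p.2‖) ^ μ) (fun p => (g p).1)) (l : ℕ) :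
    ∃ C : ℝ, ∀ᶠ p in slowFilter Γ₂, ‖∫ x, F p.1 x * (osc p.2 x * (g p).1 x)‖ ≤
      C * (p.1 ^ (M + Q))⁻¹ * ((1 + ‖p.2‖) ^ l)⁻¹ := by
  obtain ⟨I, hI, key⟩ := exists_norm_integral_mul_osc_mul_le n
  -- The `n + 1` derivatives of `g` needed for integrability cost `(1+|ξ|)^{μ+δ(n+1)}`, which the
  -- order `l'` of decrease of `F` must outweigh. In the far region `k` more derivatives cost `δk`
  -- and gain `k`, so `(1-δ)k` has to reach the same threshold; here `δ < 1` is essential.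
  obtain ⟨l', hl'⟩ := exists_nat_ge ((l : ℝ) + μ + δ * (n + 1 : ℕ))
  obtain ⟨k, hk⟩ := exists_nat_ge (((l : ℝ) + μ + δ * (n + 1 : ℕ)) / (1 - δ))
  rw [div_le_iff₀ (by linarith)] at hk
  have hd : ∀ p : ℝ × Euc n, 1 ≤ (1 + ‖p.2‖) ^ δ := fun p =>
    Real.one_le_rpow (by linarith [norm_nonneg p.2]) hδ0
  have hG : ∀ᶠ p : ℝ × Euc n in slowFilter Γ₂, 0 ≤ (p.1 ^ Q)⁻¹ * (1 + ‖p.2‖) ^ μ := by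
    filter_upwards [eventually_slowFilter_fst ev_unit] with p hp
    exact mul_nonneg (inv_nonneg.2 (pow_nonneg hp.1.le _))
      (Real.rpow_nonneg (by positivity) _)
  obtain ⟨B, hB0, hB⟩ := (hg (n + 1)).exists_hat_bound hd hSO hG (n + 1)
  obtain ⟨B', hB'0, hB'⟩ := (hg (n + 1 + k)).exists_hat_bound hd hSO hG (n + 1 + k)
  obtain ⟨C, hC⟩ := hdec l'
  refine ⟨I * (B * |C| * 2 ^ l' + B' * |A| * (c ^ k)⁻¹), ?_⟩
  filter_upwards [eventually_slowFilter_fst hF, eventually_slowFilter_fst hC, hB, hB',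
    eventually_slowFilter_fst ev_unit, eventually_slowFilter_mem] with p hF hC hB hB' hε hξ
  have hM : 0 ≤ (p.1 ^ M)⁻¹ := inv_nonneg.2 (pow_nonneg hε.1.le _)
  have hQ : 0 ≤ (p.1 ^ Q)⁻¹ := inv_nonneg.2 (pow_nonneg hε.1.le _)
  have h1 := key S (F p.1) hF.1 (g p) p.2 Γ₁ c (|A| * (p.1 ^ M)⁻¹) (|C| * (p.1 ^ M)⁻¹) _ _ l' k hc hc2
    (hΓ _ hξ) (hF.2.trans (mul_le_mul_of_nonneg_right (le_abs_self A) hM))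
    (fun ζ hζ => (hC ζ hζ).trans (mul_le_mul_of_nonneg_right
      (mul_le_mul_of_nonneg_right (le_abs_self C) hM) (by positivity)))
    (mul_nonneg (abs_nonneg _) hM) hB hB'
  refine h1.trans ?_
  have ht : 1 ≤ 1 + ‖p.2‖ := by linarith [norm_nonneg p.2]
  have ht0 : 0 < 1 + ‖p.2‖ := by linarith
  set t := 1 + ‖p.2‖
  have e1 : t ^ μ * (t ^ δ) ^ (n + 1) * (t ^ l')⁻¹ ≤ (t ^ l)⁻¹ := by
    rw [← Real.rpow_natCast (t ^ δ), ← Real.rpow_mul ht0.le, ← Real.rpow_natCast t l',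
      ← Real.rpow_natCast t l, ← Real.rpow_neg ht0.le, ← Real.rpow_neg ht0.le,
      ← Real.rpow_add ht0, ← Real.rpow_add ht0]
    exact Real.rpow_le_rpow_of_exponent_le ht (by linarith)
  have e2 : t ^ μ * (t ^ δ) ^ (n + 1 + k) * (t ^ k)⁻¹ ≤ (t ^ l)⁻¹ := by
    rw [← Real.rpow_natCast (t ^ δ), ← Real.rpow_mul ht0.le, ← Real.rpow_natCast t k,
      ← Real.rpow_natCast t l, ← Real.rpow_neg ht0.le, ← Real.rpow_neg ht0.le,
      ← Real.rpow_add ht0, ← Real.rpow_add ht0]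
    refine Real.rpow_le_rpow_of_exponent_le ht ?_
    push_cast at hk ⊢
    nlinarith
  have hcoef : 0 ≤ (p.1 ^ M)⁻¹ * (p.1 ^ Q)⁻¹ := mul_nonneg hM hQ
  calc I * (B * ((p.1 ^ Q)⁻¹ * t ^ μ * (t ^ δ) ^ (n + 1)) * (|C| * (p.1 ^ M)⁻¹) * 2 ^ l' *
        (t ^ l')⁻¹ + B' * ((p.1 ^ Q)⁻¹ * t ^ μ * (t ^ δ) ^ (n + 1 + k)) *
          (|A| * (p.1 ^ M)⁻¹) * (c ^ k)⁻¹ * (t ^ k)⁻¹)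
      = I * ((p.1 ^ M)⁻¹ * (p.1 ^ Q)⁻¹) * (B * |C| * 2 ^ l' *
          (t ^ μ * (t ^ δ) ^ (n + 1) * (t ^ l')⁻¹) + B' * |A| * (c ^ k)⁻¹ *
          (t ^ μ * (t ^ δ) ^ (n + 1 + k) * (t ^ k)⁻¹)) := by ring
    _ ≤ I * ((p.1 ^ M)⁻¹ * (p.1 ^ Q)⁻¹) * (B * |C| * 2 ^ l' * (t ^ l)⁻¹ +
          B' * |A| * (c ^ k)⁻¹ * (t ^ l)⁻¹) := by
        refine mul_le_mul_of_nonneg_left (add_le_add ?_ ?_) (mul_nonneg hI hcoef)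
        · exact mul_le_mul_of_nonneg_left e1 (by positivity)
        · exact mul_le_mul_of_nonneg_left e2 (by positivity)
    _ = _ := by rw [pow_add, mul_inv]; ring

/-- Along small frequencies the trivial bound suffices. -/
theorem rapidlyDecreasing_of_slowFilter {Γ : Set (Euc n)} {φ : Euc n → ℂ}
    {v : ℝ → Euc n → ℂ} {M : ℕ} {A : ℝ}
    (hF : ∀ᶠ ε in 𝓝[>] (0 : ℝ), ∫ x, ‖φ x * v ε x‖ ≤ A * (ε ^ M)⁻¹)
    (h : ∀ l : ℕ, ∃ C : ℝ, ∀ᶠ p in slowFilter Γ,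
      ‖fourierLoc φ (v p.1) p.2‖ ≤ C * (p.1 ^ M)⁻¹ * ((1 + ‖p.2‖) ^ l)⁻¹) :
    RapidlyDecreasing φ v Γ := by
  -- The additional power of `ε⁻¹` pays for `(1+|ξ|)^l` on `|ξ| < r_ε`. Because `max(1, r_ε)^l =
  -- O(ε⁻¹)` for every `l`, one power serves all orders.
  refine ⟨M + 1, fun l => ?_⟩
  obtain ⟨C, hC⟩ := h l
  obtain ⟨r, hr, ε₀, hε₀, hC⟩ := eventually_slowFilter.1 hC
  obtain ⟨D, hD⟩ := ((isSlowScale_const one_pos).max hr).2 l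
  refine ⟨|C| + |A| * (2 ^ l * |D|), ?_⟩
  filter_upwards [hF, hD, ev_unit, Ioo_mem_nhdsGT hε₀] with ε hF hD hε hε' ξ hξ
  have hM : 0 ≤ (ε ^ M)⁻¹ := inv_nonneg.2 (pow_nonneg hε.1.le _)
  have hM1 : (ε ^ M)⁻¹ ≤ (ε ^ (M + 1))⁻¹ :=
    inv_anti₀ (pow_pos hε.1 _) (pow_le_pow_of_le_one hε.1.le hε.2 (Nat.le_succ M))
  have hM2 : 0 ≤ (ε ^ (M + 1))⁻¹ := hM.trans hM1
  have ht : 0 < (1 + ‖ξ‖) ^ l := by positivity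
  by_cases hrξ : r ε ≤ ‖ξ‖
  · refine (hC ε hε' ξ hξ hrξ).trans (mul_le_mul_of_nonneg_right ?_ (by positivity))
    refine mul_le_mul ?_ hM1 hM (by positivity)
    exact (le_abs_self C).trans (le_add_of_nonneg_right (by positivity))
  · push Not at hrξ
    have h1 : ‖fourierLoc φ (v ε) ξ‖ ≤ |A| * (ε ^ M)⁻¹ :=
      (norm_hat_le _ _).trans (hF.trans (mul_le_mul_of_nonneg_right (le_abs_self A) hM))
    have h2 : (1 + ‖ξ‖) ^ l ≤ 2 ^ l * |D| * ε⁻¹ := by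
      calc (1 + ‖ξ‖) ^ l ≤ (2 * max 1 (r ε)) ^ l := by
            refine pow_le_pow_left₀ (by positivity) ?_ l
            have a1 := le_max_left 1 (r ε)
            have a2 := le_max_right 1 (r ε)
            linarith
        _ = 2 ^ l * max 1 (r ε) ^ l := mul_pow _ _ _
        _ ≤ 2 ^ l * (|D| * ε⁻¹) := by
            refine mul_le_mul_of_nonneg_left (hD.trans ?_) (by positivity)
            exact mul_le_mul_of_nonneg_right (le_abs_self D) (inv_nonneg.2 hε.1.le)
        _ = _ := by ring
    rw [← div_eq_mul_inv, le_div_iff₀ ht]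
    calc ‖fourierLoc φ (v ε) ξ‖ * (1 + ‖ξ‖) ^ l
        ≤ (|A| * (ε ^ M)⁻¹) * (2 ^ l * |D| * ε⁻¹) := mul_le_mul h1 h2 ht.le (by positivity)
      _ = (|A| * (2 ^ l * |D|)) * (ε ^ (M + 1))⁻¹ := by rw [pow_succ, mul_inv]; ring
      _ ≤ _ := mul_le_mul_of_nonneg_right (le_add_of_nonneg_left (abs_nonneg _)) hM2

end Rapid

/-! ### Moderate nets paired with test functions -/

section Nets

open MeasureTheory

variable {n : ℕ} {Ω : TopologicalSpace.Opens (Euc n)} {S : TopologicalSpace.Compacts (Euc n)}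

theorem moderate_exists_integral_bound (hSΩ : (S : Set (Euc n)) ⊆ Ω) (φ : testSpace S)
    (v : moderate Ω) : ∃ (M : ℕ) (A : ℝ), ∀ᶠ ε in 𝓝[>] (0 : ℝ),
      Integrable (fun x => φ.1 x * v.1 ε x) ∧ ∫ x, ‖φ.1 x * v.1 ε x‖ ≤ A * (ε ^ M)⁻¹ := by
  obtain ⟨M, C, hC⟩ := v.2.2 S hSΩ S.isCompact []
  obtain ⟨D, hD⟩ := S.isCompact.exists_bound_of_continuousOn φ.2.1.continuous.continuousOn
  refine ⟨M, volume.real (S : Set (Euc n)) * (|D| * |C|), ?_⟩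
  filter_upwards [hC, ev_unit] with ε hC hε
  have e : (fun x => φ.1 x * v.1 ε x) = (mulV Ω S (v.1 ε) φ).1 := by
    rw [coe_mulV hSΩ (v.2.1 ε hε)]; funext x; exact mul_comm _ _
  refine ⟨e ▸ integrable_testSpace _, ?_⟩
  have := integral_norm_testSpace_le (mulV Ω S (v.1 ε) φ) (B := |D| * |C| * (ε ^ M)⁻¹) ?_
  · rw [← e, ← mul_assoc] at this
    exact this
  · intro x hx
    rw [← e, norm_mul, mul_assoc]
    refine mul_le_mul ((hD x hx).trans (le_abs_self D)) ((hC x hx).trans ?_) (norm_nonneg _)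
      (abs_nonneg _)
    exact mul_le_mul_of_nonneg_right (le_abs_self C) (inv_nonneg.2 (pow_nonneg hε.1.le _))

/-- Puts the decay estimate and the trivial `L¹` bound under one exponent of `ε`, the form in which
`rapid_mul` takes its input. -/
theorem RapidlyDecreasing.exists_common_bound (hSΩ : (S : Set (Euc n)) ⊆ Ω) {φ : testSpace S}
    {v : moderate Ω} {Γ : Set (Euc n)} (h : RapidlyDecreasing φ.1 v.1 Γ) :
    ∃ (M : ℕ) (A : ℝ), (∀ᶠ ε in 𝓝[>] (0 : ℝ), Integrable (fun x => φ.1 x * v.1 ε x) ∧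
      ∫ x, ‖φ.1 x * v.1 ε x‖ ≤ A * (ε ^ M)⁻¹) ∧
    ∀ l : ℕ, ∃ C : ℝ, ∀ᶠ ε in 𝓝[>] (0 : ℝ), ∀ ξ ∈ Γ,
      ‖hat (fun x => φ.1 x * v.1 ε x) ξ‖ ≤ C * (ε ^ M)⁻¹ * ((1 + ‖ξ‖) ^ l)⁻¹ := by
  obtain ⟨M₁, A, hA⟩ := moderate_exists_integral_bound hSΩ φ v
  obtain ⟨M₂, h⟩ := h
  have hpow : ∀ ε ∈ Ioc (0 : ℝ) 1, ∀ {N N' : ℕ}, N ≤ N' → ∀ C : ℝ,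
      C * (ε ^ N)⁻¹ ≤ |C| * (ε ^ N')⁻¹ := by
    intro ε hε N N' hN C
    have h1 : (ε ^ N)⁻¹ ≤ (ε ^ N')⁻¹ :=
      inv_anti₀ (pow_pos hε.1 _) (pow_le_pow_of_le_one hε.1.le hε.2 hN)
    exact mul_le_mul (le_abs_self C) h1 (inv_nonneg.2 (pow_nonneg hε.1.le _)) (abs_nonneg _)
  refine ⟨max M₁ M₂, |A|, ?_, fun l => ?_⟩
  · filter_upwards [hA, ev_unit] with ε h1 hε
    exact ⟨h1.1, h1.2.trans (hpow ε hε (le_max_left _ _) A)⟩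
  · obtain ⟨C, hC⟩ := h l
    refine ⟨|C|, ?_⟩
    filter_upwards [hC, ev_unit] with ε h1 hε ξ hξ
    exact (h1 ξ hξ).trans (mul_le_mul_of_nonneg_right (hpow ε hε (le_max_right _ _) C)
      (by positivity))

theorem isModerate_fixed {f : Euc n → ℂ} (hf : ContDiff ℝ ∞ f) : IsModerate Ω fun _ => f := by
  refine ⟨fun ε _ => hf.contDiffOn, fun K _ hK w => ?_⟩
  obtain ⟨C, hC⟩ := hK.exists_bound_of_continuousOn
    (f := pdList w f) ((contDiffOn_pdList (Ω := ⊤) hf.contDiffOn w).continuousOn.mono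
      (subset_univ _))
  exact ⟨0, C, Eventually.of_forall fun ε x hx => by simpa using hC x hx⟩

/-- A change of representative adds the transform of `φ` times a negligible net. All derivatives of
this product are bounded uniformly in small `ε`, so the transform decreases to any order with no
loss in `ε`. -/
theorem RapidlyDecreasing.of_toG_eq (hSΩ : (S : Set (Euc n)) ⊆ Ω) {φ : testSpace S}
    {v v' : moderate Ω} (hv : toG v = toG v') {Γ : Set (Euc n)}
    (h : RapidlyDecreasing φ.1 v.1 Γ) : RapidlyDecreasing φ.1 v'.1 Γ := by
  have hz : IsNegligible Ω (v'.1 - v.1) := Ideal.Quotient.eq.1 hv.symm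
  have hφz : IsNegligible Ω ((fun _ => φ.1) * (v'.1 - v.1)) :=
    IsModerate.mul_neg (isModerate_fixed φ.2.1) hz
  obtain ⟨M, h⟩ := h
  refine ⟨M, fun l => ?_⟩
  obtain ⟨C, hC⟩ := h l
  -- Order `ε^0` of negligibility suffices, since the target bound already allows `ε^{-M} ≥ 1`.
  obtain ⟨C₀, h₀⟩ := hφz.2 S hSΩ S.isCompact [] 0
  choose D hD using fun i : Fin n => hφz.2 S hSΩ S.isCompact (List.replicate l i) 0
  set B := |C₀| + ∑ i, |D i|
  have hB : 0 ≤ B := add_nonneg (abs_nonneg _) (Finset.sum_nonneg fun i _ => abs_nonneg _)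
  refine ⟨|C| + ((n : ℝ) + 1) ^ l * (volume.real (S : Set (Euc n)) * B), ?_⟩
  filter_upwards [hC, h₀, eventually_all.2 hD, ev_unit] with ε hC h₀ hD hε ξ hξ
  have hM : 1 ≤ (ε ^ M)⁻¹ :=
    (one_le_inv₀ (pow_pos hε.1 _)).2 (pow_le_one₀ hε.1.le hε.2)
  have hzε : ContDiffOn ℝ ∞ (v'.1 ε - v.1 ε) Ω := (v'.2.1 ε hε).sub (v.2.1 ε hε)
  set g := mulV Ω S (v'.1 ε - v.1 ε) φ
  have hg : g.1 = φ.1 * (v'.1 ε - v.1 ε) := by rw [coe_mulV hSΩ hzε, mul_comm]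
  have h1 := norm_hat_mul_pow_le g l (B := B) (fun x hx => by
      have := h₀ x hx
      rw [hg]
      refine this.trans ?_
      rw [pow_zero, mul_one]
      exact (le_abs_self _).trans
        (le_add_of_nonneg_right (Finset.sum_nonneg fun i _ => abs_nonneg _)))
    (fun i x hx => by
      have := hD i x hx
      rw [hg]
      refine this.trans ?_
      rw [pow_zero, mul_one]
      have := Finset.single_le_sum (f := fun i => |D i|) (fun i _ => abs_nonneg _)
        (Finset.mem_univ i)
      have := le_abs_self (D i)
      have := abs_nonneg C₀
      linarith) ξ
  have hv1 : Integrable fun x => φ.1 x * v.1 ε x := by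
    simpa only [mul_comm] using integrable_mul_testSpace hSΩ (v.2.1 ε hε) φ
  have e : fourierLoc φ.1 (v'.1 ε) ξ = fourierLoc φ.1 (v.1 ε) ξ + hat g.1 ξ := by
    rw [fourierLoc_eq_hat, fourierLoc_eq_hat, hat, hat, hat,
      ← integral_add (integrable_mul_osc hv1 ξ) (integrable_mul_osc (integrable_testSpace g) ξ)]
    congr 1
    funext x
    rw [hg]
    simp only [Pi.mul_apply, Pi.sub_apply]
    ring
  have h2 : ‖hat g.1 ξ‖ ≤ ((n : ℝ) + 1) ^ l * (volume.real (S : Set (Euc n)) * B) *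
      ((1 + ‖ξ‖) ^ l)⁻¹ := by
    rwa [← div_eq_mul_inv, le_div_iff₀ (by positivity)]
  rw [e, add_mul, add_mul]
  refine (norm_add_le _ _).trans (add_le_add ((hC ξ hξ).trans ?_) (h2.trans ?_))
  · exact mul_le_mul_of_nonneg_right (mul_le_mul_of_nonneg_right (le_abs_self C)
      (zero_le_one.trans hM)) (by positivity)
  · exact mul_le_mul_of_nonneg_right (le_mul_of_one_le_right
      (mul_nonneg (by positivity) (mul_nonneg measureReal_nonneg hB)) hM) (by positivity)

theorem foldl_gPd_toG (w : List (Fin n)) (v : moderate Ω) :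
    w.foldl (fun u i => gPd i u) (toG v) = toG (w.foldl (fun u i => moderatePd i u) v) := by
  induction w generalizing v with
  | nil => rfl
  | cons i w ih => exact ih (moderatePd i v)

theorem coe_foldl_moderatePd (w : List (Fin n)) (v : moderate Ω) (ε : ℝ) :
    (w.foldl (fun u i => moderatePd i u) v).1 ε = pdList w (v.1 ε) := by
  induction w generalizing v with
  | nil => rfl
  | cons i w ih => exact ih (moderatePd i v)

theorem exists_genOp_representative (m : ℕ) (a : (Fin n → ℕ) → moderate Ω) (v : moderate Ω) :
    ∃ f : moderate Ω, toG f = genOp m (fun γ => toG (a γ)) (toG v) ∧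
      ∀ ε x, f.1 ε x = diffOp m (fun γ => (a γ).1 ε) (v.1 ε) x := by
  refine ⟨∑ γ ∈ multiIndices n m, a γ * ((-Complex.I) ^ len γ •
    (multiWord γ).foldl (fun u i => moderatePd i u) v), ?_, fun ε x => ?_⟩
  · refine (map_sum (Ideal.Quotient.mk (negligible Ω)) _ _).trans ?_
    refine Finset.sum_congr rfl fun γ _ => ?_
    refine (map_mul (Ideal.Quotient.mk (negligible Ω)) _ _).trans ?_
    rw [gD, foldl_gPd_toG]
    rfl
  · rw [AddSubmonoidClass.coe_finsetSum, Finset.sum_apply, Finset.sum_apply, diffOp]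
    refine Finset.sum_congr rfl fun γ _ => ?_
    rw [mpd, ← coe_foldl_moderatePd]
    rfl

end Nets

/-! ### Cones -/

section Cones

variable {n : ℕ}

/-- Take the cone over the ball of half the radius `e` of a ball around `ξ₁` inside `Γ ∩ Γ₁`. After
rescaling `ξ` into the smaller ball, a perturbation of relative size `c` has length at most `e/2`
and stays in the larger one. -/
theorem IsOpenCone.exists_smaller {Γ Γ₁ : Set (Euc n)} (hΓ : IsOpenCone Γ) (hΓ₁ : IsOpenCone Γ₁)
    {ξ₁ : Euc n} (h : ξ₁ ∈ Γ) (h₁ : ξ₁ ∈ Γ₁) : ∃ Γ₂, IsOpenCone Γ₂ ∧ ξ₁ ∈ Γ₂ ∧ Γ₂ ⊆ Γ ∧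
      ∃ c : ℝ, 0 < c ∧ c ≤ 1 / 2 ∧ ∀ ξ ∈ Γ₂, ∀ η, ‖η‖ ≤ c * ‖ξ‖ → ξ - η ∈ Γ₁ := by
  obtain ⟨e, he, hball⟩ := Metric.isOpen_iff.1 (hΓ.1.inter hΓ₁.1) ξ₁ ⟨h, h₁⟩
  have hsub : ∀ ζ ∈ Metric.ball ξ₁ (e / 2), ζ ∈ Γ := fun ζ hζ =>
    (hball (Metric.ball_subset_ball (by linarith) hζ)).1
  refine ⟨⋃ t ∈ Ioi (0 : ℝ), (fun ζ => t • ζ) '' Metric.ball ξ₁ (e / 2),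
    ⟨?_, ?_, ?_⟩, ?_, ?_, min (1 / 2) (e / 2 / (‖ξ₁‖ + e / 2)), ?_, min_le_left _ _, ?_⟩
  · refine isOpen_biUnion fun t ht => ?_
    exact (isOpenMap_smul₀ (ne_of_gt ht)) _ Metric.isOpen_ball
  · simp only [mem_iUnion, not_exists]
    rintro t ht ⟨ζ, hζ, h0⟩
    exact hΓ.2.1 (h0 ▸ hΓ.2.2 ζ (hsub ζ hζ) t ht)
  · intro ξ hξ s hs
    simp only [mem_iUnion] at hξ ⊢
    obtain ⟨t, ht, ζ, hζ, rfl⟩ := hξ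
    exact ⟨s * t, mul_pos hs ht, ζ, hζ, mul_smul s t ζ⟩
  · simp only [mem_iUnion]
    exact ⟨1, mem_Ioi.2 one_pos, ξ₁, Metric.mem_ball_self (by linarith), one_smul _ _⟩
  · intro ξ hξ
    simp only [mem_iUnion] at hξ
    obtain ⟨t, ht, ζ, hζ, rfl⟩ := hξ
    exact hΓ.2.2 ζ (hsub ζ hζ) t ht
  · exact lt_min (by norm_num) (by positivity)
  · intro ξ hξ η hη
    simp only [mem_iUnion] at hξ
    obtain ⟨t, ht, ζ, hζ, rfl⟩ := hξ
    have ht' : 0 < t := ht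
    have hζ' : ‖ζ - ξ₁‖ < e / 2 := mem_ball_iff_norm.1 hζ
    have h1 : ‖ζ‖ ≤ ‖ξ₁‖ + e / 2 := by
      have := norm_le_norm_add_norm_sub' ζ ξ₁
      linarith
    have hpos : 0 < ‖ξ₁‖ + e / 2 := by positivity
    have h2 : ‖t⁻¹ • η‖ ≤ e / 2 := by
      simp only [norm_smul, Real.norm_eq_abs, abs_inv, abs_of_pos ht'] at hη ⊢
      rw [inv_mul_le_iff₀ ht']
      calc ‖η‖ ≤ min (1 / 2) (e / 2 / (‖ξ₁‖ + e / 2)) * (t * ‖ζ‖) := hη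
        _ ≤ (e / 2 / (‖ξ₁‖ + e / 2)) * (t * (‖ξ₁‖ + e / 2)) := by
            refine mul_le_mul (min_le_right _ _) (mul_le_mul_of_nonneg_left h1 ht'.le)
              (by positivity) (by positivity)
        _ = t * (e / 2) := by field_simp
    have h3 : ζ - t⁻¹ • η ∈ Metric.ball ξ₁ e := by
      rw [mem_ball_iff_norm, sub_right_comm]
      exact (norm_sub_le _ _).trans_lt (by linarith)
    have h4 := hΓ₁.2.2 _ (hball h3).2 t ht'
    rwa [smul_sub, smul_smul, mul_inv_cancel₀ ht'.ne', one_smul] at h4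

end Cones

/-! ### The parametrix -/

section Parametrix

open MeasureTheory

variable {n : ℕ} {Ω O : TopologicalSpace.Opens (Euc n)} {S : TopologicalSpace.Compacts (Euc n)}
  {Γ : Set (Euc n)} {m : ℕ} {a : (Fin n → ℕ) → moderate Ω} {δ ρ : ℝ}

/-- The coefficients of the operator, as a family indexed by `(ε, ξ)`. -/
def coeffs (a : (Fin n → ℕ) → moderate Ω) (p : ℝ × Euc n) : (Fin n → ℕ) → Euc n → ℂ :=
  fun γ => (a γ).1 p.1

/-- The derivative `∂_ξ^w P_ε(·, ξ)` of the symbol along a word `w`. -/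
def symbolDeriv (m : ℕ) (a : (Fin n → ℕ) → moderate Ω) (w : List (Fin n)) (p : ℝ × Euc n)
    (x : Euc n) : ℂ :=
  polySymbol m (coeffs a p) (fun γ => pderivList w (wordPoly (multiWord γ))) x p.2

theorem symbolDeriv_nil (p : ℝ × Euc n) (x : Euc n) :
    symbolDeriv m a [] p x = symbol m a p.1 x p.2 :=
  (symbol_eq_polySymbol m a p.1 x p.2).symm

theorem eventually_contDiffOn_coeffs (hO : (O : Set (Euc n)) ⊆ Ω)
    (a : (Fin n → ℕ) → moderate Ω) :
    ∀ᶠ p in slowFilter Γ, ∀ γ, ContDiffOn ℝ ∞ (coeffs a p γ) O := by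
  filter_upwards [eventually_slowFilter_fst ev_unit] with p hp γ
  exact ((a γ).2.1 p.1 hp).mono hO

theorem one_le_bracket_rpow (hδ : 0 ≤ δ) (p : ℝ × Euc n) : 1 ≤ (1 + ‖p.2‖) ^ δ :=
  Real.one_le_rpow (by linarith [norm_nonneg p.2]) hδ

/-- The estimates `∂_x^α ∂_ξ^w P = O(|P| (1 + |ξ|)^{δ|α| - ρ|w|})`. -/
def HypoellipticBound (Γ : Set (Euc n)) (O : TopologicalSpace.Opens (Euc n)) (m : ℕ)
    (a : (Fin n → ℕ) → moderate Ω) (δ ρ : ℝ) : Prop :=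
  ∀ w : List (Fin n), w.length ≤ m → ∀ N, SymbolBound (slowFilter Γ) O
    (fun p => (1 + ‖p.2‖) ^ δ) N
    (fun p x => ‖symbolDeriv m a [] p x‖ * (1 + ‖p.2‖) ^ (-(ρ * w.length))) (symbolDeriv m a w)

/-- Rewrites the mixed multi-index derivatives of hypothesis 2 in terms of words; the
`ξ`-derivatives become formal derivatives of the polynomial symbol. -/
theorem mpd_symbol_eq (hO : (O : Set (Euc n)) ⊆ Ω) {p : ℝ × Euc n} (hp : p.1 ∈ Ioc (0 : ℝ) 1)
    (w v : List (Fin n)) {x : Euc n} (hx : x ∈ O) :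
    mpd (fun i => v.count i) (fun y => mpd (fun i => w.count i)
      (fun η => symbol m a p.1 y η) p.2) x = pdList v (symbolDeriv m a w p) x := by
  have e1 : (fun y => mpd (fun i => w.count i) (fun η => symbol m a p.1 y η) p.2) =
      symbolDeriv m a w p := by
    funext y
    have e2 : (fun η => symbol m a p.1 y η) =
        polySymbol m (coeffs a p) (fun γ => wordPoly (multiWord γ)) y :=
      funext fun η => symbol_eq_polySymbol m a p.1 y η
    rw [e2, mpd, ← pdList_perm (Ω := ⊤) (perm_multiWord_count w)
      (contDiff_polySymbol _ _ _ _).contDiffOn (mem_univ p.2), pdList_polySymbol]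
    rfl
  rw [e1, mpd]
  refine (pdList_perm (perm_multiWord_count v) (Ω := O) ?_ hx).symm
  exact contDiffOn_polySymbol m (fun γ => ((a γ).2.1 p.1 hp).mono hO) _ _

/-- Removes the slow scale factors from hypothesis 2. With at least one derivative, replacing `δ, ρ`
by `δ + η, ρ - η` frees a factor `(1+|ξ|)^η` or more, which dominates `s_ε` along `slowFilter`. -/
theorem hypoellipticBound_of_slowScale (hO : (O : Set (Euc n)) ⊆ Ω) {Γ' : Set (Euc n)}
    (hΓ : Γ ⊆ Γ') {η : ℝ} (hη : 0 < η)
    (h : ∀ α : Fin n → ℕ, ∃ s r : ℝ → ℝ, IsSlowScale s ∧ IsSlowScale r ∧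
      ∃ ε₁ ∈ Ioc (0 : ℝ) 1, ∀ β : Fin n → ℕ, len β ≤ m →
        ∀ ε ∈ Ioo 0 ε₁, ∀ x ∈ O, ∀ ξ ∈ Γ', r ε ≤ ‖ξ‖ →
          ‖mpd α (fun y => mpd β (fun η => symbol m a ε y η) ξ) x‖ ≤
            s ε * ‖symbol m a ε x ξ‖ * (1 + ‖ξ‖) ^ (δ * (len α : ℝ) - ρ * (len β : ℝ))) :
    HypoellipticBound Γ O m a (δ + η) (ρ - η) := by
  intro w hw N
  refine ⟨?_, fun v _ => ⟨1, zero_le_one, ?_⟩⟩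
  · filter_upwards [eventually_contDiffOn_coeffs hO a] with p hp
    exact contDiffOn_polySymbol m hp _ _
  obtain ⟨s, r, hs, hr, ε₁, hε₁, h⟩ := h (fun i => v.count i)
  have hev : ∀ᶠ ε in 𝓝[>] (0 : ℝ), ε ∈ Ioo 0 ε₁ := Ioo_mem_nhdsGT hε₁.1
  filter_upwards [eventually_slowFilter_fst hev, eventually_slowFilter_fst ev_unit,
    eventually_slowFilter_mem, eventually_slowFilter_norm hr, hs.eventually_le_rpow hη]
    with p hp hp1 hpΓ hpr hps x hx
  have ht : 1 ≤ 1 + ‖p.2‖ := by linarith [norm_nonneg p.2]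
  have ht0 : 0 < 1 + ‖p.2‖ := by linarith
  have e : (1 + ‖p.2‖) ^ (-((ρ - η) * w.length)) * ((1 + ‖p.2‖) ^ (δ + η)) ^ v.length =
      (1 + ‖p.2‖) ^ ((δ + η) * v.length - (ρ - η) * w.length) := by
    rw [← Real.rpow_natCast _ v.length, ← Real.rpow_mul ht0.le, ← Real.rpow_add ht0]
    congr 1
    ring
  rw [one_mul, mul_assoc, e]
  -- Without derivatives the exponent leaves no room to absorb `s_ε`, but then the two sides
  -- coincide.
  by_cases hvw : v.length + w.length = 0
  · obtain rfl : v = [] := List.length_eq_zero_iff.1 (by omega)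
    obtain rfl : w = [] := List.length_eq_zero_iff.1 (by omega)
    simp [pdList]
  · have h1 := h (fun i => w.count i) (by rwa [len_count]) p.1 hp x hx p.2 (hΓ hpΓ) hpr
    rw [mpd_symbol_eq hO hp1 w v hx, len_count, len_count] at h1
    refine h1.trans ?_
    rw [symbolDeriv_nil, mul_comm (s p.1), mul_assoc]
    refine mul_le_mul_of_nonneg_left ?_ (norm_nonneg _)
    refine (mul_le_mul_of_nonneg_right hps (Real.rpow_nonneg ht0.le _)).trans ?_
    rw [← Real.rpow_add ht0]
    refine Real.rpow_le_rpow_of_exponent_le ht ?_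
    have : (1 : ℝ) ≤ v.length + w.length := by exact_mod_cast Nat.one_le_iff_ne_zero.2 hvw
    nlinarith

/-- The remainder `1 - e^{iξx} ᵗP e^{-iξx} P_ε(x, ξ)⁻¹` of the first approximation to an inverse
of the transpose. -/
def parametrixError (O : TopologicalSpace.Opens (Euc n)) (S : TopologicalSpace.Compacts (Euc n))
    (m : ℕ) (a : (Fin n → ℕ) → moderate Ω) (p : ℝ × Euc n) : Module.End ℂ (testSpace S) :=
  1 - conjTranspose O S m (coeffs a p) p.2 * mulV O S (symbolDeriv m a [] p)⁻¹

theorem SymbolBound.mulV {ι : Type*} {L : Filter ι} {d : ι → ℝ} {N : ℕ} {G H : ι → Euc n → ℝ}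
    (hSO : (S : Set (Euc n)) ⊆ O) {f : ι → Euc n → ℂ} {g : ι → testSpace S}
    (hf : SymbolBound L O d N G f) (hg : SymbolBound L O d N H fun p => (g p).1) :
    SymbolBound L O d N (fun p x => G p x * H p x) fun p => (mulV O S (f p) (g p)).1 := by
  refine (hf.mul hg).congr ?_
  filter_upwards [hf.1] with p hp
  rw [coe_mulV hSO hp]
  exact fun _ _ => rfl

theorem HypoellipticBound.inv (h : HypoellipticBound Γ O m a δ ρ) (hδ : 0 ≤ δ)
    (h0 : ∀ᶠ p in slowFilter Γ, ∀ x ∈ O, symbolDeriv m a [] p x ≠ 0) (N : ℕ) :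
    SymbolBound (slowFilter Γ) O (fun p => (1 + ‖p.2‖) ^ δ) N
      (fun p x => ‖symbolDeriv m a [] p x‖⁻¹) (fun p => (symbolDeriv m a [] p)⁻¹) := by
  refine SymbolBound.inv (one_le_bracket_rpow hδ) h0 ?_
  simpa using h [] (Nat.zero_le _) N

/-- Estimate for the Taylor terms of the conjugated transpose. -/
theorem HypoellipticBound.taylorPart (h : HypoellipticBound Γ O m a δ ρ) (hδ : 0 ≤ δ)
    (hO : (O : Set (Euc n)) ⊆ Ω) (hSO : (S : Set (Euc n)) ⊆ O) {k : ℕ} (hk : k ≤ m)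
    {G : ℝ × Euc n → Euc n → ℝ} (hG : ∀ᶠ p in slowFilter Γ, ∀ x ∈ O, 0 ≤ G p x)
    {g : ℝ × Euc n → testSpace S}
    (hg : ∀ N, SymbolBound (slowFilter Γ) O (fun p => (1 + ‖p.2‖) ^ δ) N G fun p => (g p).1)
    (N : ℕ) :
    SymbolBound (slowFilter Γ) O (fun p => (1 + ‖p.2‖) ^ δ) N
      (fun p x => ‖symbolDeriv m a [] p x‖ * G p x * (1 + ‖p.2‖) ^ (-((ρ - δ) * k)))
      fun p => (ColombeauPDO.taylorPart O S m (coeffs a p) p.2 k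
        (fun γ => wordPoly (multiWord γ)) (g p)).1 := by
  have h1 := SymbolBound.taylorPart (L := slowFilter Γ) (G := fun p x =>
      ‖symbolDeriv m a [] p x‖ * (1 + ‖p.2‖) ^ (-(ρ * k)) * G p x) (h := g) (ξ := Prod.snd)
    hSO (one_le_bracket_rpow hδ) m (eventually_contDiffOn_coeffs hO a) ?_ k N
    (fun γ => wordPoly (multiWord γ)) ?_
  · refine h1.mono' (one_le_bracket_rpow hδ) (Eventually.of_forall fun p x _ => le_of_eq ?_)
    have ht0 : 0 < 1 + ‖p.2‖ := by linarith [norm_nonneg p.2]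
    -- The `k` derivatives in `ξ` gain `ρk`, while the `k` derivatives in `x` lose `δk`.
    have e : (1 + ‖p.2‖) ^ (-((ρ - δ) * k)) =
        (1 + ‖p.2‖) ^ (-(ρ * k)) * ((1 + ‖p.2‖) ^ δ) ^ k := by
      rw [← Real.rpow_natCast _ k, ← Real.rpow_mul ht0.le, ← Real.rpow_add ht0]
      congr 1
      ring
    rw [e]
    ring
  · filter_upwards [hG] with p hp x hx
    have ht0 : 0 < 1 + ‖p.2‖ := by linarith [norm_nonneg p.2]
    exact mul_nonneg (mul_nonneg (norm_nonneg _) (Real.rpow_nonneg ht0.le _)) (hp x hx)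
  · intro w hw
    have := (h w (hw.le.trans hk) (N + k)).mul (hg (N + k))
    rw [hw] at this
    exact this

/-- The Taylor term of order zero is multiplication by the symbol and cancels against its inverse.
In every other term `|P|` and `|P|⁻¹` cancel in the estimate, leaving the gain `(1+|ξ|)^{-(ρ-δ)k}`
with `k ≥ 1`. Input and output have bounds of the same type, so the lemma can be iterated. -/
theorem parametrixError_bound (h : HypoellipticBound Γ O m a δ ρ) (hδ : 0 ≤ δ) (hδρ : δ ≤ ρ)
    (hO : (O : Set (Euc n)) ⊆ Ω) (hSO : (S : Set (Euc n)) ⊆ O)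
    (h0 : ∀ᶠ p in slowFilter Γ, ∀ x ∈ O, symbolDeriv m a [] p x ≠ 0)
    {G : ℝ × Euc n → ℝ} (hG : ∀ᶠ p in slowFilter Γ, 0 ≤ G p) {g : ℝ × Euc n → testSpace S}
    (hg : ∀ N, SymbolBound (slowFilter Γ) O (fun p => (1 + ‖p.2‖) ^ δ) N
      (fun p _ => G p) fun p => (g p).1) (N : ℕ) :
    SymbolBound (slowFilter Γ) O (fun p => (1 + ‖p.2‖) ^ δ) N
      (fun p _ => G p * (1 + ‖p.2‖) ^ (-(ρ - δ))) fun p => (parametrixError O S m a p (g p)).1 := by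
  have hd := one_le_bracket_rpow (n := n) hδ
  have hinv : ∀ N, SymbolBound (slowFilter Γ) O (fun p => (1 + ‖p.2‖) ^ δ) N
      (fun p x => ‖symbolDeriv m a [] p x‖⁻¹ * G p)
      fun p => (mulV O S (symbolDeriv m a [] p)⁻¹ (g p)).1 := fun N =>
    (h.inv hδ h0 N).mulV hSO (hg N)
  have hterm : ∀ k ∈ Finset.range m, SymbolBound (slowFilter Γ) O (fun p => (1 + ‖p.2‖) ^ δ) N
      (fun p _ => G p * (1 + ‖p.2‖) ^ (-(ρ - δ)))
      fun p => (ColombeauPDO.taylorPart O S m (coeffs a p) p.2 (k + 1)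
        (fun γ => wordPoly (multiWord γ)) (mulV O S (symbolDeriv m a [] p)⁻¹ (g p))).1 := by
    intro k hk
    have := h.taylorPart hδ hO hSO (k := k + 1) (by simpa using hk) (by
      filter_upwards [hG] with p hp x _
      exact mul_nonneg (inv_nonneg.2 (norm_nonneg _)) hp) hinv N
    refine this.mono' hd ?_
    filter_upwards [h0, hG] with p hp hGp x hx
    have hne : ‖symbolDeriv m a [] p x‖ ≠ 0 := norm_ne_zero_iff.2 (hp x hx)
    rw [mul_inv_cancel_left₀ hne]
    refine mul_le_mul_of_nonneg_left ?_ hGp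
    refine Real.rpow_le_rpow_of_exponent_le (by linarith [norm_nonneg p.2]) ?_
    push_cast
    nlinarith [mul_nonneg (sub_nonneg.2 hδρ) (Nat.cast_nonneg (α := ℝ) k)]
  have hsum := (SymbolBound.sum (Finset.range m) hd (by
    filter_upwards [hG] with p hp x _
    exact mul_nonneg hp (Real.rpow_nonneg (by positivity) _)) hterm).const_smul (-1)
  refine hsum.congr ?_
  filter_upwards [eventually_contDiffOn_coeffs hO a, h0] with p hp hp0 x hx
  have hsm : ContDiffOn ℝ ∞ (symbolDeriv m a [] p) O := contDiffOn_polySymbol m hp _ _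
  have e0 : (ColombeauPDO.taylorPart O S m (coeffs a p) p.2 0 (fun γ => wordPoly (multiWord γ))
      (mulV O S (symbolDeriv m a [] p)⁻¹ (g p))).1 x = (g p).1 x := by
    rw [taylorPart_zero hSO m hp, coe_mulV hSO (hsm.inv hp0)]
    exact mul_inv_cancel_left₀ (hp0 x hx) _
  rw [parametrixError, conjTranspose_eq_sum, Finset.sum_range_succ']
  simp only [LinearMap.sub_apply, Module.End.one_apply, Module.End.mul_apply, LinearMap.add_apply,
    LinearMap.sum_apply, Submodule.coe_sub, Submodule.coe_add, Submodule.coe_sum, Pi.sub_apply,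
    Pi.add_apply, Pi.smul_apply, e0, smul_eq_mul]
  ring

theorem parametrixError_pow_bound (h : HypoellipticBound Γ O m a δ ρ) (hδ : 0 ≤ δ) (hδρ : δ ≤ ρ)
    (hO : (O : Set (Euc n)) ⊆ Ω) (hSO : (S : Set (Euc n)) ⊆ O)
    (h0 : ∀ᶠ p in slowFilter Γ, ∀ x ∈ O, symbolDeriv m a [] p x ≠ 0) {ψ : testSpace S}
    (hψ : ∀ N, SymbolBound (slowFilter Γ) O (fun p => (1 + ‖p.2‖) ^ δ) N
      (fun _ _ => 1) fun _ => ψ.1) (k N : ℕ) :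
    SymbolBound (slowFilter Γ) O (fun p => (1 + ‖p.2‖) ^ δ) N
      (fun p _ => ((1 + ‖p.2‖) ^ (-(ρ - δ))) ^ k)
      fun p => ((parametrixError O S m a p ^ k) ψ).1 := by
  induction k generalizing N with
  | zero => simpa using hψ N
  | succ k ih =>
    have := parametrixError_bound h hδ hδρ hO hSO h0 (Eventually.of_forall fun p =>
      pow_nonneg (Real.rpow_nonneg (by positivity) _) k) ih N
    simpa only [pow_succ', Module.End.mul_apply, mul_comm] using this

theorem parametrix_sum_bound (h : HypoellipticBound Γ O m a δ ρ) (hδ : 0 ≤ δ) (hδρ : δ ≤ ρ)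
    (hO : (O : Set (Euc n)) ⊆ Ω) (hSO : (S : Set (Euc n)) ⊆ O)
    (h0 : ∀ᶠ p in slowFilter Γ, ∀ x ∈ O, symbolDeriv m a [] p x ≠ 0) {ψ : testSpace S}
    (hψ : ∀ N, SymbolBound (slowFilter Γ) O (fun p => (1 + ‖p.2‖) ^ δ) N
      (fun _ _ => 1) fun _ => ψ.1) (k N : ℕ) :
    SymbolBound (slowFilter Γ) O (fun p => (1 + ‖p.2‖) ^ δ) N (fun _ _ => 1)
      fun p => (((∑ j ∈ Finset.range k, parametrixError O S m a p ^ j) : Module.End ℂ _) ψ).1 := by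
  have hd := one_le_bracket_rpow (n := n) hδ
  have := SymbolBound.sum (L := slowFilter Γ) (G := fun _ _ => 1) (N := N) (O := O)
    (Finset.range k) hd (Eventually.of_forall fun _ _ _ => zero_le_one)
    (F := fun j p => ((parametrixError O S m a p ^ j) ψ).1) fun j _ =>
      (parametrixError_pow_bound h hδ hδρ hO hSO h0 hψ j N).mono' hd
        (Eventually.of_forall fun p x _ => pow_le_one₀ (Real.rpow_nonneg (by positivity) _)
          (Real.rpow_le_one_of_one_le_of_nonpos (by linarith [norm_nonneg p.2]) (by linarith)))
  simpa only [LinearMap.sum_apply, Submodule.coe_sum] using this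

theorem symbol_upper_bound (a : (Fin n → ℕ) → moderate Ω) (m : ℕ) {K : Set (Euc n)}
    (hK : IsCompact K) (hKΩ : K ⊆ (Ω : Set (Euc n))) :
    ∃ (Q : ℕ) (C : ℝ), 0 ≤ C ∧ ∀ᶠ p in slowFilter Γ, ∀ x ∈ K,
      ‖symbolDeriv m a [] p x‖ ≤ C * ((p.1 ^ Q)⁻¹ * (1 + ‖p.2‖) ^ (m : ℝ)) := by
  choose N C hC using fun γ => (a γ).2.2 K hKΩ hK []
  set Q := ∑ γ ∈ multiIndices n m, N γ
  refine ⟨Q, ∑ γ ∈ multiIndices n m, |C γ|, Finset.sum_nonneg fun _ _ => abs_nonneg _, ?_⟩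
  have hall : ∀ᶠ ε in 𝓝[>] (0 : ℝ), ∀ γ ∈ multiIndices n m, ∀ x ∈ K,
      ‖pdList [] ((a γ).1 ε) x‖ ≤ C γ * (ε ^ N γ)⁻¹ :=
    (Filter.eventually_all_finset _).2 fun γ _ => hC γ
  filter_upwards [eventually_slowFilter_fst hall, eventually_slowFilter_fst ev_unit]
    with p hp hε x hx
  rw [symbolDeriv_nil, symbol, Finset.sum_mul]
  refine (norm_sum_le _ _).trans (Finset.sum_le_sum fun γ hγ => ?_)
  have ht : 1 ≤ 1 + ‖p.2‖ := by linarith [norm_nonneg p.2]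
  have h1 : ‖(a γ).1 p.1 x‖ ≤ |C γ| * (p.1 ^ Q)⁻¹ := by
    refine (hp γ hγ x hx).trans (mul_le_mul (le_abs_self _) ?_
      (inv_nonneg.2 (pow_nonneg hε.1.le _)) (abs_nonneg _))
    exact inv_anti₀ (pow_pos hε.1 _) (pow_le_pow_of_le_one hε.1.le hε.2
      (Finset.single_le_sum (f := N) (fun _ _ => Nat.zero_le _) hγ))
  have h2 : ‖∏ i, ((p.2 i : ℝ) : ℂ) ^ γ i‖ ≤ (1 + ‖p.2‖) ^ (m : ℝ) := by
    rw [norm_prod, Real.rpow_natCast]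
    calc ∏ i, ‖((p.2 i : ℝ) : ℂ) ^ γ i‖ ≤ ∏ i, (1 + ‖p.2‖) ^ γ i := by
          refine Finset.prod_le_prod (fun _ _ => norm_nonneg _) fun i _ => ?_
          rw [norm_pow, Complex.norm_real]
          refine pow_le_pow_left₀ (norm_nonneg _) ?_ _
          linarith [PiLp.norm_apply_le p.2 i]
      _ = (1 + ‖p.2‖) ^ len γ := Finset.prod_pow_eq_pow_sum _ _ _
      _ ≤ (1 + ‖p.2‖) ^ m := pow_le_pow_right₀ ht (mem_multiIndices.1 hγ)
  rw [norm_mul, ← mul_assoc]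
  exact mul_le_mul h1 h2 (norm_nonneg _)
    (mul_nonneg (abs_nonneg _) (inv_nonneg.2 (pow_nonneg hε.1.le _)))

theorem symbol_lower_bound {Γ' : Set (Euc n)} (hΓ : Γ ⊆ Γ') {m₀ : ℝ}
    (h : ∃ q : ℝ, 0 < q ∧ ∃ r : ℝ → ℝ, IsSlowScale r ∧ ∃ ε₀ ∈ Ioc (0 : ℝ) 1,
      ∀ ε ∈ Ioo 0 ε₀, ∀ x ∈ O, ∀ ξ ∈ Γ', r ε ≤ ‖ξ‖ →
        ε ^ q * (1 + ‖ξ‖) ^ m₀ ≤ ‖symbol m a ε x ξ‖) :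
    ∃ Q : ℕ, ∀ᶠ p in slowFilter Γ, ∀ x ∈ O, symbolDeriv m a [] p x ≠ 0 ∧
      ‖symbolDeriv m a [] p x‖⁻¹ ≤ (p.1 ^ Q)⁻¹ * (1 + ‖p.2‖) ^ (-m₀) := by
  obtain ⟨q, hq, r, hr, ε₀, hε₀, h⟩ := h
  obtain ⟨Q, hQ⟩ := exists_nat_ge q
  have hev : ∀ᶠ ε in 𝓝[>] (0 : ℝ), ε ∈ Ioo 0 ε₀ := Ioo_mem_nhdsGT hε₀.1
  refine ⟨Q, ?_⟩
  filter_upwards [eventually_slowFilter_fst hev, eventually_slowFilter_fst ev_unit,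
    eventually_slowFilter_mem, eventually_slowFilter_norm hr] with p hp hε hpΓ hpr x hx
  have ht0 : 0 < 1 + ‖p.2‖ := by linarith [norm_nonneg p.2]
  have h1 : p.1 ^ Q * (1 + ‖p.2‖) ^ m₀ ≤ ‖symbolDeriv m a [] p x‖ := by
    rw [symbolDeriv_nil]
    -- The real exponent `q` is rounded up to the integer `Q`; for `ε ≤ 1` this only weakens the
    -- lower bound.
    refine le_trans (mul_le_mul_of_nonneg_right ?_ (Real.rpow_nonneg ht0.le _))
      (h p.1 hp x hx p.2 (hΓ hpΓ) hpr)
    rw [← Real.rpow_natCast]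
    exact Real.rpow_le_rpow_of_exponent_ge hε.1 hε.2 hQ
  have h2 : 0 < p.1 ^ Q * (1 + ‖p.2‖) ^ m₀ :=
    mul_pos (pow_pos hε.1 _) (Real.rpow_pos_of_pos ht0 _)
  refine ⟨norm_pos_iff.1 (h2.trans_le h1), ?_⟩
  rw [Real.rpow_neg ht0.le, ← mul_inv]
  exact inv_anti₀ h2 h1

end Parametrix

/-! ### Microlocal regularity -/

section Microlocal

open MeasureTheory

variable {n : ℕ} {Ω O : TopologicalSpace.Opens (Euc n)} {S S' : TopologicalSpace.Compacts (Euc n)}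
  {Γ Γ₁ : Set (Euc n)} {m : ℕ} {a : (Fin n → ℕ) → moderate Ω} {δ ρ : ℝ}

/-- Regularity is known for `φ f`, not for `f`. Where `φ` does not vanish, `φ⁻¹` can be moved into
the amplitude. -/
theorem integral_mul_cutoff (hSO : (S : Set (Euc n)) ⊆ O) {φ : Euc n → ℂ}
    (hφ : ContDiffOn ℝ ∞ φ O) (hφ0 : ∀ x ∈ O, φ x ≠ 0) (f : Euc n → ℂ) (h : testSpace S)
    (ξ : Euc n) :
    ∫ x, f x * (osc ξ x * h.1 x) = ∫ x, (φ x * f x) * (osc ξ x * (mulV O S φ⁻¹ h).1 x) := by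
  congr 1
  funext x
  rw [coe_mulV hSO (hφ.inv hφ0)]
  by_cases hx : x ∈ S
  · have := hφ0 x (hSO hx)
    simp only [Pi.mul_apply, Pi.inv_apply]
    field_simp
  · simp [h.2.2 x hx]

theorem fourierLoc_eq_integral (ψ : testSpace S) (v : Euc n → ℂ) (ξ : Euc n) :
    fourierLoc ψ.1 v ξ = ∫ x, v x * (osc ξ x * ψ.1 x) := by
  rw [fourierLoc_eq_hat, hat]
  congr 1
  funext x
  ring

/-- Differential operators whose symbol satisfies the hypoellipticity estimates do not enlarge the
wave front set. -/
theorem rapidlyDecreasing_diffOp (hO : (O : Set (Euc n)) ⊆ Ω) (hSO : (S : Set (Euc n)) ⊆ O)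
    {K : Set (Euc n)} (hK : IsCompact K) (hOK : (O : Set (Euc n)) ⊆ K)
    (hKΩ : K ⊆ (Ω : Set (Euc n))) (h : HypoellipticBound Γ O m a δ ρ) (hδ : 0 ≤ δ) (hδρ : δ ≤ ρ)
    (hδ1 : δ < 1) {c : ℝ} (hc : 0 < c) (hc2 : c ≤ 1 / 2)
    (hΓ : ∀ ξ ∈ Γ, ∀ η, ‖η‖ ≤ c * ‖ξ‖ → ξ - η ∈ Γ₁) (hS'Ω : (S' : Set (Euc n)) ⊆ Ω)
    {φ : testSpace S'} {O' : TopologicalSpace.Opens (Euc n)} (hKO : K ⊆ (O' : Set (Euc n)))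
    (hφ0 : ∀ x ∈ O', φ.1 x ≠ 0) {v f : moderate Ω} (hv : RapidlyDecreasing φ.1 v.1 Γ₁)
    (hf : ∀ ε x, f.1 ε x = diffOp m (fun γ => (a γ).1 ε) (v.1 ε) x) (ψ : testSpace S) :
    RapidlyDecreasing ψ.1 f.1 Γ := by
  have hd := one_le_bracket_rpow (n := n) hδ
  have hψ : ∀ N, SymbolBound (slowFilter Γ) O (fun p => (1 + ‖p.2‖) ^ δ) N
      (fun _ _ => 1) fun _ => ψ.1 := fun N =>
    SymbolBound.fixed hd hK hOK (O' := ⊤) (subset_univ _) ψ.2.1.contDiffOn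
  have hφ : ∀ N, SymbolBound (slowFilter Γ) O (fun p => (1 + ‖p.2‖) ^ δ) N
      (fun _ _ => 1) fun _ => φ.1⁻¹ := fun N =>
    SymbolBound.fixed hd hK hOK (O' := O') hKO (φ.2.1.contDiffOn.inv hφ0)
  -- The Taylor terms are bounded by `|P_ε|`, and moderateness of the coefficients bounds `|P_ε|` by
  -- `ε^{-Q}(1+|ξ|)^m`: an amplitude of the kind admitted in `rapid_mul`.
  obtain ⟨Q, C, hC, hup⟩ := symbol_upper_bound (Γ := Γ) a m hK hKΩ
  have hterm : ∀ N, ∀ k ∈ Finset.range (m + 1), SymbolBound (slowFilter Γ) O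
      (fun p => (1 + ‖p.2‖) ^ δ) N (fun p _ => (p.1 ^ Q)⁻¹ * (1 + ‖p.2‖) ^ (m : ℝ))
      fun p => (taylorPart O S m (coeffs a p) p.2 k (fun γ => wordPoly (multiWord γ)) ψ).1 := by
    intro N k hk
    refine (h.taylorPart hδ hO hSO (k := k) (by simpa [Nat.lt_succ_iff] using hk)
      (Eventually.of_forall fun _ _ _ => zero_le_one) hψ N).mono hd hC ?_
    filter_upwards [hup] with p hp x hx
    refine le_trans ?_ (hp x (hOK hx))
    rw [mul_one]
    refine mul_le_of_le_one_right (norm_nonneg _)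
      (Real.rpow_le_one_of_one_le_of_nonpos (by linarith [norm_nonneg p.2]) ?_)
    exact neg_nonpos.2 (mul_nonneg (sub_nonneg.2 hδρ) (Nat.cast_nonneg _))
  have hGpos : ∀ᶠ p : ℝ × Euc n in slowFilter Γ, ∀ x ∈ O,
      0 ≤ (p.1 ^ Q)⁻¹ * (1 + ‖p.2‖) ^ (m : ℝ) := by
    filter_upwards [eventually_slowFilter_fst ev_unit] with p hp x _
    exact mul_nonneg (inv_nonneg.2 (pow_nonneg hp.1.le _)) (Real.rpow_nonneg (by positivity) _)
  have hg : ∀ N, SymbolBound (slowFilter Γ) O (fun p => (1 + ‖p.2‖) ^ δ) N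
      (fun p _ => (p.1 ^ Q)⁻¹ * (1 + ‖p.2‖) ^ (m : ℝ))
      fun p => (mulV O S φ.1⁻¹ (conjTranspose O S m (coeffs a p) p.2 ψ)).1 := by
    intro N
    have h1 := SymbolBound.sum (Finset.range (m + 1)) hd hGpos (hterm N)
    have h2 := (hφ N).mulV hSO (g := fun p => conjTranspose O S m (coeffs a p) p.2 ψ) (by
      simpa only [conjTranspose_eq_sum, LinearMap.sum_apply, Submodule.coe_sum] using h1)
    simpa only [one_mul] using h2
  obtain ⟨M, A, hF, hdec⟩ := hv.exists_common_bound hS'Ω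
  obtain ⟨M', A', hF'⟩ := moderate_exists_integral_bound (hSO.trans hO) ψ f
  have key := fun l => rapid_mul hc hc2 hΓ hF hdec hSO hδ hδ1 hg l
  refine rapidlyDecreasing_of_slowFilter (M := M + Q + M') (A := |A'|) ?_ fun l => ?_
  · filter_upwards [hF', ev_unit] with ε h1 hε
    refine h1.2.trans (mul_le_mul (le_abs_self _) ?_ (inv_nonneg.2 (pow_nonneg hε.1.le _))
      (abs_nonneg _))
    exact inv_anti₀ (pow_pos hε.1 _) (pow_le_pow_of_le_one hε.1.le hε.2 (by omega))
  · obtain ⟨C, hC⟩ := key l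
    refine ⟨|C|, ?_⟩
    filter_upwards [hC, eventually_slowFilter_fst ev_unit, eventually_contDiffOn_coeffs hO a]
      with p hp hε hco
    have e : fourierLoc ψ.1 (f.1 p.1) p.2 = ∫ x, (φ.1 x * v.1 p.1 x) *
        (osc p.2 x * (mulV O S φ.1⁻¹ (conjTranspose O S m (coeffs a p) p.2 ψ)).1 x) := by
      rw [fourierLoc_eq_integral, ← integral_mul_cutoff hSO φ.2.1.contDiffOn
        (fun x hx => hφ0 x (hKO (hOK hx)))]
      simp only [hf]
      exact integral_diffOp_mul_osc hSO m hco p.2 ((v.2.1 p.1 hε).mono hO) ψ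
    rw [e]
    refine hp.trans (mul_le_mul_of_nonneg_right (mul_le_mul (le_abs_self C) ?_
      (inv_nonneg.2 (pow_nonneg hε.1.le _)) (abs_nonneg _)) (by positivity))
    exact inv_anti₀ (pow_pos hε.1 _) (pow_le_pow_of_le_one hε.1.le hε.2 (by omega))

/-- The hypoellipticity estimates give back regularity of `v` from regularity of `P v`. -/
theorem rapidlyDecreasing_of_diffOp (hO : (O : Set (Euc n)) ⊆ Ω) (hSO : (S : Set (Euc n)) ⊆ O)
    {K : Set (Euc n)} (hK : IsCompact K) (hOK : (O : Set (Euc n)) ⊆ K)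
    (h : HypoellipticBound Γ O m a δ ρ) (hδ : 0 ≤ δ) (hδρ : δ < ρ)
    (hδ1 : δ < 1) {Q : ℕ} {m₀ : ℝ}
    (hlow : ∀ᶠ p in slowFilter Γ, ∀ x ∈ O, symbolDeriv m a [] p x ≠ 0 ∧
      ‖symbolDeriv m a [] p x‖⁻¹ ≤ (p.1 ^ Q)⁻¹ * (1 + ‖p.2‖) ^ (-m₀))
    {c : ℝ} (hc : 0 < c) (hc2 : c ≤ 1 / 2)
    (hΓ : ∀ ξ ∈ Γ, ∀ η, ‖η‖ ≤ c * ‖ξ‖ → ξ - η ∈ Γ₁) (hS'Ω : (S' : Set (Euc n)) ⊆ Ω)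
    {φ : testSpace S'} {O' : TopologicalSpace.Opens (Euc n)} (hKO : K ⊆ (O' : Set (Euc n)))
    (hφ0 : ∀ x ∈ O', φ.1 x ≠ 0) {v f : moderate Ω} (hf' : RapidlyDecreasing φ.1 f.1 Γ₁)
    (hf : ∀ ε x, f.1 ε x = diffOp m (fun γ => (a γ).1 ε) (v.1 ε) x) (ψ : testSpace S) :
    RapidlyDecreasing ψ.1 v.1 Γ := by
  have hd := one_le_bracket_rpow (n := n) hδ
  have h0 : ∀ᶠ p in slowFilter Γ, ∀ x ∈ O, symbolDeriv m a [] p x ≠ 0 :=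
    hlow.mono fun p hp x hx => (hp x hx).1
  have hψ : ∀ N, SymbolBound (slowFilter Γ) O (fun p => (1 + ‖p.2‖) ^ δ) N
      (fun _ _ => 1) fun _ => ψ.1 := fun N =>
    SymbolBound.fixed hd hK hOK (O' := ⊤) (subset_univ _) ψ.2.1.contDiffOn
  have hφ : ∀ N, SymbolBound (slowFilter Γ) O (fun p => (1 + ‖p.2‖) ^ δ) N
      (fun _ _ => 1) fun _ => φ.1⁻¹ := fun N =>
    SymbolBound.fixed hd hK hOK (O' := O') hKO (φ.2.1.contDiffOn.inv hφ0)
  obtain ⟨M, A, hF, hdec⟩ := hf'.exists_common_bound hS'Ω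
  obtain ⟨M₁, A₁, hF₁⟩ := moderate_exists_integral_bound (hSO.trans hO) ψ v
  obtain ⟨M₂, A₂, hF₂⟩ := v.2.2 S (hSO.trans hO) S.isCompact []
  -- The exponent is fixed before `l`: `M` comes from `φ f`, `Q` from the lower bound on the symbol,
  -- `M₁` from the integral of `ψ v`, `M₂` from the supremum of `v`.
  refine rapidlyDecreasing_of_slowFilter (M := M + Q + M₁ + M₂) (A := |A₁|) ?_ fun l => ?_
  · filter_upwards [hF₁, ev_unit] with ε h1 hε
    refine h1.2.trans (mul_le_mul (le_abs_self _) ?_ (inv_nonneg.2 (pow_nonneg hε.1.le _))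
      (abs_nonneg _))
    exact inv_anti₀ (pow_pos hε.1 _) (pow_le_pow_of_le_one hε.1.le hε.2 (by omega))
  -- Enough iterations for `R ^ k` to gain the full order `l`. The number `k` depends on `l` but
  -- influences only constants, not the power of `ε`.
  obtain ⟨k, hk⟩ := exists_nat_ge ((l : ℝ) / (ρ - δ))
  rw [div_le_iff₀ (by linarith)] at hk
  set w : ℝ × Euc n → testSpace S := fun p =>
    ((∑ j ∈ Finset.range k, parametrixError O S m a p ^ j) : Module.End ℂ _) ψ with hw
  have hwb := parametrix_sum_bound h hδ hδρ.le hO hSO h0 hψ k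
  have hg : ∀ N, SymbolBound (slowFilter Γ) O (fun p => (1 + ‖p.2‖) ^ δ) N
      (fun p _ => (p.1 ^ Q)⁻¹ * (1 + ‖p.2‖) ^ (-m₀))
      fun p => (mulV O S φ.1⁻¹ (mulV O S (symbolDeriv m a [] p)⁻¹ (w p))).1 := by
    intro N
    refine ((hφ N).mulV hSO ((h.inv hδ h0 N).mulV hSO (hwb N))).mono' hd ?_
    filter_upwards [hlow] with p hp x hx
    simpa using (hp x hx).2
  obtain ⟨C, hC⟩ := rapid_mul hc hc2 hΓ hF hdec hSO hδ hδ1 hg l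
  obtain ⟨D, hD, hR⟩ := (parametrixError_pow_bound h hδ hδρ.le hO hSO h0 hψ k 0).2 [] le_rfl
  refine ⟨|C| + volume.real (S : Set (Euc n)) * (|A₂| * D), ?_⟩
  filter_upwards [hC, hR, h0, eventually_slowFilter_fst hF₂, eventually_slowFilter_fst ev_unit,
    eventually_contDiffOn_coeffs hO a] with p hC hR h0 hv hε hco
  have hvO : ContDiffOn ℝ ∞ (v.1 p.1) O := (v.2.1 p.1 hε).mono hO
  set T := conjTranspose O S m (coeffs a p) p.2 with hT
  set r := (parametrixError O S m a p ^ k) ψ with hr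
  -- The telescoping identity `(1 - R) ∑_{j<k} R^j = 1 - R^k`, applied to `ψ`, with `1 - R = T P⁻¹`.
  have hψ' : ψ = T (mulV O S (symbolDeriv m a [] p)⁻¹ (w p)) + r := by
    have h1 := mul_neg_geom_sum (parametrixError O S m a p) k
    have h2 : 1 - parametrixError O S m a p = T * mulV O S (symbolDeriv m a [] p)⁻¹ := by
      rw [parametrixError]; abel
    rw [h2] at h1
    have h3 := congrArg (fun E : Module.End ℂ (testSpace S) => E ψ) h1
    simp only [Module.End.mul_apply, LinearMap.sub_apply, Module.End.one_apply] at h3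
    rw [hw, hr, h3, sub_add_cancel]
  have e : fourierLoc ψ.1 (v.1 p.1) p.2 = (∫ x, (φ.1 x * f.1 p.1 x) * (osc p.2 x *
      (mulV O S φ.1⁻¹ (mulV O S (symbolDeriv m a [] p)⁻¹ (w p))).1 x)) +
        ∫ x, v.1 p.1 x * (osc p.2 x * r.1 x) := by
    rw [← integral_mul_cutoff hSO φ.2.1.contDiffOn (fun x hx => hφ0 x (hKO (hOK hx)))]
    simp only [hf]
    rw [show (fun γ => (a γ).1 p.1) = coeffs a p from rfl,
      integral_diffOp_mul_osc hSO m hco p.2 hvO, ← integral_add, fourierLoc_eq_integral]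
    · congr 1
      funext x
      conv_lhs => rw [hψ']
      simp only [Submodule.coe_add, Pi.add_apply]
      ring
    · have := integrable_mul_osc (integrable_mul_testSpace hSO hvO
        (T (mulV O S (symbolDeriv m a [] p)⁻¹ (w p)))) p.2
      refine this.congr (Eventually.of_forall fun x => ?_)
      simp only
      ring
    · have := integrable_mul_osc (integrable_mul_testSpace hSO hvO r) p.2
      refine this.congr (Eventually.of_forall fun x => ?_)
      simp only
      ring
  have ht : 1 ≤ 1 + ‖p.2‖ := by linarith [norm_nonneg p.2]
  have ht0 : 0 < 1 + ‖p.2‖ := by linarith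
  have hdecay : ((1 + ‖p.2‖) ^ (-(ρ - δ))) ^ k ≤ ((1 + ‖p.2‖) ^ l)⁻¹ := by
    rw [← Real.rpow_natCast _ k, ← Real.rpow_mul ht0.le, ← Real.rpow_natCast _ l,
      ← Real.rpow_neg ht0.le]
    exact Real.rpow_le_rpow_of_exponent_le ht (by linarith)
  -- No regularity of `v` is used for the remainder: a supremum bound for `v` and the smallness of
  -- `R^k ψ` suffice.
  have h2 : ‖∫ x, v.1 p.1 x * (osc p.2 x * r.1 x)‖ ≤ volume.real (S : Set (Euc n)) *
      (|A₂| * (p.1 ^ M₂)⁻¹ * (D * ((1 + ‖p.2‖) ^ l)⁻¹)) := by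
    have hvr : (mulV O S (v.1 p.1) r).1 = fun x => v.1 p.1 x * r.1 x := coe_mulV hSO hvO r
    refine le_trans ?_ (integral_norm_testSpace_le (mulV O S (v.1 p.1) r) fun x hx => ?_)
    · refine (norm_integral_le_integral_norm _).trans (le_of_eq ?_)
      congr 1
      funext x
      rw [hvr, norm_mul, norm_mul, norm_mul, norm_osc, one_mul]
    · rw [hvr, norm_mul]
      refine mul_le_mul ((hv x hx).trans ?_) ((hR x (hSO hx)).trans ?_) (norm_nonneg _)
        (mul_nonneg (abs_nonneg _) (inv_nonneg.2 (pow_nonneg hε.1.le _)))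
      · exact mul_le_mul_of_nonneg_right (le_abs_self _) (inv_nonneg.2 (pow_nonneg hε.1.le _))
      · simp only [List.length_nil, pow_zero, mul_one]
        exact mul_le_mul_of_nonneg_left hdecay hD
  have hpow : ∀ N, N ≤ M + Q + M₁ + M₂ → (p.1 ^ N)⁻¹ ≤ (p.1 ^ (M + Q + M₁ + M₂))⁻¹ := fun N hN =>
    inv_anti₀ (pow_pos hε.1 _) (pow_le_pow_of_le_one hε.1.le hε.2 hN)
  have htl : 0 ≤ ((1 + ‖p.2‖) ^ l)⁻¹ := by positivity
  rw [e, add_mul, add_mul]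
  refine (norm_add_le _ _).trans (add_le_add (hC.trans ?_) (h2.trans ?_))
  · refine mul_le_mul_of_nonneg_right (mul_le_mul (le_abs_self C) (hpow _ (by omega))
      (inv_nonneg.2 (pow_nonneg hε.1.le _)) (abs_nonneg _)) htl
  · calc volume.real (S : Set (Euc n)) * (|A₂| * (p.1 ^ M₂)⁻¹ * (D * ((1 + ‖p.2‖) ^ l)⁻¹))
        = volume.real (S : Set (Euc n)) * (|A₂| * D) * (p.1 ^ M₂)⁻¹ * ((1 + ‖p.2‖) ^ l)⁻¹ := by
          ring
      _ ≤ _ := by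
          refine mul_le_mul_of_nonneg_right (mul_le_mul_of_nonneg_left (hpow _ (by omega)) ?_) htl
          exact mul_nonneg measureReal_nonneg (mul_nonneg (abs_nonneg _) hD)

/-- A cut-off function near a point, supported in a small ball inside a given open set. -/
theorem exists_cutoff {V : Set (Euc n)} (hV : IsOpen V) {x₁ : Euc n} (hx₁ : x₁ ∈ V) :
    ∃ (O : TopologicalSpace.Opens (Euc n)) (K : Set (Euc n))
      (S : TopologicalSpace.Compacts (Euc n)) (ψ : testSpace S), IsCompact K ∧
      (S : Set (Euc n)) ⊆ O ∧ (O : Set (Euc n)) ⊆ K ∧ K ⊆ V ∧ ψ.1 x₁ = 1 := by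
  obtain ⟨R, hR, hball⟩ := Metric.nhds_basis_closedBall.mem_iff.1 (hV.mem_nhds hx₁)
  -- Concentric balls: the closed one of radius `R/2` contains the support, the open one of radius
  -- `R` carries the derivative estimates, and its closed version is the compact set for the
  -- hypotheses.
  let b : ContDiffBump x₁ := ⟨R / 4, R / 2, by positivity, by linarith⟩
  refine ⟨⟨Metric.ball x₁ R, Metric.isOpen_ball⟩, Metric.closedBall x₁ R,
    ⟨Metric.closedBall x₁ (R / 2), isCompact_closedBall _ _⟩,
    ⟨fun x => (b x : ℂ), Complex.ofRealCLM.contDiff.comp b.contDiff, fun x hx => ?_⟩,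
    isCompact_closedBall _ _, Metric.closedBall_subset_ball (by linarith),
    Metric.ball_subset_closedBall, hball, ?_⟩
  · have : R / 2 ≤ dist x x₁ := (not_le.1 hx).le
    simp [b.zero_of_le_dist this]
  · have : x₁ ∈ Metric.closedBall x₁ b.rIn := Metric.mem_closedBall_self (by positivity)
    simp [b.one_of_mem_closedBall this]

theorem microlocallyRegular_of_rapidlyDecreasing (hSΩ : (S : Set (Euc n)) ⊆ Ω) (ψ : testSpace S)
    {x₁ ξ₁ : Euc n} (hψ : ψ.1 x₁ = 1) (hΓ : IsOpenCone Γ) (hξ₁ : ξ₁ ∈ Γ) (v : moderate Ω)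
    (h : RapidlyDecreasing ψ.1 v.1 Γ) : MicrolocallyRegular (toG v) x₁ ξ₁ :=
  ⟨v, rfl, ψ.1, ψ.2.1, testSpace_hasCompactSupport ψ, (testSpace_tsupport ψ).trans hSΩ, hψ,
    Γ, hΓ, hξ₁, h⟩

/-- Microlocal hypoellipticity at a single point. -/
theorem microlocallyRegular_genOp_iff (Ω : TopologicalSpace.Opens (Euc n)) (m : ℕ)
    (A : (Fin n → ℕ) → Colombeau Ω)
    (a : (Fin n → ℕ) → moderate Ω)
    (ha : ∀ γ, toG (a γ) = A γ)
    (U Γ : Set (Euc n))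
    (hU : IsOpen U) (hUΩ : U ⊆ (Ω : Set (Euc n)))
    (hΓ : IsOpenCone Γ)
    (m₀ δ ρ : ℝ) (hδ : 0 ≤ δ) (hδρ : δ < ρ) (hρ : ρ ≤ 1)
    (h₁ : ∀ K ⊆ U, IsCompact K →
      ∃ q : ℝ, 0 < q ∧ ∃ r : ℝ → ℝ, IsSlowScale r ∧
        ∃ ε₀ ∈ Ioc (0 : ℝ) 1, ∀ ε ∈ Ioo 0 ε₀, ∀ x ∈ K, ∀ ξ ∈ Γ, r ε ≤ ‖ξ‖ →
          ε ^ q * (1 + ‖ξ‖) ^ m₀ ≤ ‖symbol m a ε x ξ‖)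
    (h₂ : ∀ K ⊆ U, IsCompact K → ∀ α : Fin n → ℕ,
      ∃ s r : ℝ → ℝ, IsSlowScale s ∧ IsSlowScale r ∧
        ∃ ε₁ ∈ Ioc (0 : ℝ) 1, ∀ β : Fin n → ℕ, len β ≤ m →
          ∀ ε ∈ Ioo 0 ε₁, ∀ x ∈ K, ∀ ξ ∈ Γ, r ε ≤ ‖ξ‖ →
            ‖mpd α
                (fun y => mpd β (fun η => symbol m a ε y η) ξ) x‖ ≤
              s ε * ‖symbol m a ε x ξ‖ *
                (1 + ‖ξ‖) ^ (δ * (len α : ℝ) - ρ * (len β : ℝ)))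
    (u : Colombeau Ω) (x₁ ξ₁ : Euc n) (hx₁ : x₁ ∈ U) (hξ₁ : ξ₁ ∈ Γ) :
    MicrolocallyRegular u x₁ ξ₁ ↔ MicrolocallyRegular (genOp m A u) x₁ ξ₁ := by
  obtain rfl : (fun γ => toG (a γ)) = A := funext ha
  -- With this loss `δ + η < ρ - η` still holds, and `δ + η < ρ ≤ 1` as `rapid_mul` requires.
  set η := (ρ - δ) / 4 with hη
  have hη0 : 0 < η := by linarith
  constructor
  · rintro ⟨v, rfl, φ, hφ, hφc, hφΩ, hφ1, Γ₁, hΓ₁, hξΓ₁, hv⟩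
    set S' : TopologicalSpace.Compacts (Euc n) := ⟨tsupport φ, hφc⟩
    let φ' : testSpace S' := ⟨φ, hφ, fun x hx => image_eq_zero_of_notMem_tsupport hx⟩
    let O' : TopologicalSpace.Opens (Euc n) :=
      ⟨{x | φ x ≠ 0}, isOpen_ne_fun hφ.continuous continuous_const⟩
    obtain ⟨O, K, S, ψ, hK, hSO, hOK, hKV, hψ⟩ := exists_cutoff (hU.inter O'.isOpen)
      (x₁ := x₁) ⟨hx₁, by simp [O', hφ1]⟩
    obtain ⟨Γ₂, hΓ₂, hξΓ₂, hΓ₂Γ, c, hc, hc2, hcone⟩ := hΓ.exists_smaller hΓ₁ hξ₁ hξΓ₁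
    have hKU : K ⊆ U := fun x hx => (hKV hx).1
    have hO : (O : Set (Euc n)) ⊆ Ω := (hOK.trans hKU).trans hUΩ
    have hyp : HypoellipticBound Γ₂ O m a (δ + η) (ρ - η) :=
      hypoellipticBound_of_slowScale hO hΓ₂Γ hη0 fun α => by
        obtain ⟨s, r, hs, hr, ε₁, hε₁, h⟩ := h₂ K hKU hK α
        exact ⟨s, r, hs, hr, ε₁, hε₁, fun β hβ ε hε x hx => h β hβ ε hε x (hOK hx)⟩
    obtain ⟨f, hfG, hf⟩ := exists_genOp_representative m a v
    rw [← hfG]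
    exact microlocallyRegular_of_rapidlyDecreasing (hSO.trans hO) ψ hψ hΓ₂ hξΓ₂ f
      (rapidlyDecreasing_diffOp hO hSO hK hOK (hKU.trans hUΩ) hyp (by linarith) (by linarith)
        (by linarith) hc hc2 hcone hφΩ (φ := φ') (O' := O') (fun x hx => (hKV hx).2)
        (fun x hx => hx) hv hf ψ)
  · rintro ⟨f', hf', φ, hφ, hφc, hφΩ, hφ1, Γ₁, hΓ₁, hξΓ₁, hdec⟩
    obtain ⟨v, rfl⟩ := Ideal.Quotient.mk_surjective u
    set S' : TopologicalSpace.Compacts (Euc n) := ⟨tsupport φ, hφc⟩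
    let φ' : testSpace S' := ⟨φ, hφ, fun x hx => image_eq_zero_of_notMem_tsupport hx⟩
    let O' : TopologicalSpace.Opens (Euc n) :=
      ⟨{x | φ x ≠ 0}, isOpen_ne_fun hφ.continuous continuous_const⟩
    obtain ⟨O, K, S, ψ, hK, hSO, hOK, hKV, hψ⟩ := exists_cutoff (hU.inter O'.isOpen)
      (x₁ := x₁) ⟨hx₁, by simp [O', hφ1]⟩
    obtain ⟨Γ₂, hΓ₂, hξΓ₂, hΓ₂Γ, c, hc, hc2, hcone⟩ := hΓ.exists_smaller hΓ₁ hξ₁ hξΓ₁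
    have hKU : K ⊆ U := fun x hx => (hKV hx).1
    have hO : (O : Set (Euc n)) ⊆ Ω := (hOK.trans hKU).trans hUΩ
    have hyp : HypoellipticBound Γ₂ O m a (δ + η) (ρ - η) :=
      hypoellipticBound_of_slowScale hO hΓ₂Γ hη0 fun α => by
        obtain ⟨s, r, hs, hr, ε₁, hε₁, h⟩ := h₂ K hKU hK α
        exact ⟨s, r, hs, hr, ε₁, hε₁, fun β hβ ε hε x hx => h β hβ ε hε x (hOK hx)⟩
    obtain ⟨Q, hlow⟩ := symbol_lower_bound (O := O) (m := m) (a := a) hΓ₂Γ (m₀ := m₀) (by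
      obtain ⟨q, hq, r, hr, ε₀, hε₀, h⟩ := h₁ K hKU hK
      exact ⟨q, hq, r, hr, ε₀, hε₀, fun ε hε x hx => h ε hε x (hOK hx)⟩)
    -- Regularity is given for some representative `f'` of `Pu`; `RapidlyDecreasing.of_toG_eq`
    -- transfers it to the representative `f` computed from `v` and the `a γ`.
    obtain ⟨f, hfG, hf⟩ := exists_genOp_representative m a v
    exact microlocallyRegular_of_rapidlyDecreasing (hSO.trans hO) ψ hψ hΓ₂ hξΓ₂ v
      (rapidlyDecreasing_of_diffOp hO hSO hK hOK hyp (by linarith) (by linarith)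
        (by linarith) hlow hc hc2 hcone hφΩ (φ := φ') (O' := O') (fun x hx => (hKV hx).2)
        (fun x hx => hx) (RapidlyDecreasing.of_toG_eq (φ := φ') hφΩ (hf'.trans hfG.symm) hdec)
        hf ψ)

end Microlocal

end ColombeauPDO

end

/-! ### Equality of the wave front sets over the cone set. -/

theorem mainTheorem1 {n : ℕ} (Ω : TopologicalSpace.Opens (EuclideanSpace ℝ (Fin n))) (m : ℕ)
    (A : (Fin n → ℕ) → ColombeauPDO.Colombeau Ω)
    (a : (Fin n → ℕ) → ColombeauPDO.moderate Ω)
    (ha : ∀ γ, ColombeauPDO.toG (a γ) = A γ)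
    (x₀ ξ₀ : EuclideanSpace ℝ (Fin n)) (U Γ : Set (EuclideanSpace ℝ (Fin n)))
    (hU : IsOpen U) (hUΩ : U ⊆ (Ω : Set (EuclideanSpace ℝ (Fin n))))
    (hΓ : ColombeauPDO.IsOpenCone Γ) (hx₀ : x₀ ∈ U) (hξ₀ : ξ₀ ∈ Γ)
    (m₀ δ ρ : ℝ) (hδ : 0 ≤ δ) (hδρ : δ < ρ) (hρ : ρ ≤ 1)
    (h₁ : ∀ K ⊆ U, IsCompact K →
      ∃ q : ℝ, 0 < q ∧ ∃ r : ℝ → ℝ, ColombeauPDO.IsSlowScale r ∧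
        ∃ ε₀ ∈ Set.Ioc (0 : ℝ) 1, ∀ ε ∈ Set.Ioo 0 ε₀, ∀ x ∈ K, ∀ ξ ∈ Γ, r ε ≤ ‖ξ‖ →
          ε ^ q * (1 + ‖ξ‖) ^ m₀ ≤ ‖ColombeauPDO.symbol m a ε x ξ‖)
    (h₂ : ∀ K ⊆ U, IsCompact K → ∀ α : Fin n → ℕ,
      ∃ s r : ℝ → ℝ, ColombeauPDO.IsSlowScale s ∧ ColombeauPDO.IsSlowScale r ∧
        ∃ ε₁ ∈ Set.Ioc (0 : ℝ) 1, ∀ β : Fin n → ℕ, ColombeauPDO.len β ≤ m →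
          ∀ ε ∈ Set.Ioo 0 ε₁, ∀ x ∈ K, ∀ ξ ∈ Γ, r ε ≤ ‖ξ‖ →
            ‖ColombeauPDO.mpd α
                (fun y => ColombeauPDO.mpd β (fun η => ColombeauPDO.symbol m a ε y η) ξ) x‖ ≤
              s ε * ‖ColombeauPDO.symbol m a ε x ξ‖ *
                (1 + ‖ξ‖) ^ (δ * (ColombeauPDO.len α : ℝ) - ρ * (ColombeauPDO.len β : ℝ))) :
    ∀ u : ColombeauPDO.Colombeau Ω,
      (U ×ˢ Γ) ∩ ColombeauPDO.WFg u = (U ×ˢ Γ) ∩ ColombeauPDO.WFg (ColombeauPDO.genOp m A u) := by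
  intro u
  ext ⟨x₁, ξ₁⟩
  simp only [mem_inter_iff, mem_prod, ColombeauPDO.WFg, mem_ofPred_eq, and_congr_right_iff]
  rintro ⟨hx₁, hξ₁⟩ - -
  exact not_congr (ColombeauPDO.microlocallyRegular_genOp_iff Ω m A a ha U Γ hU hUΩ hΓ m₀ δ ρ hδ hδρ
    hρ h₁ h₂ u x₁ ξ₁ hx₁ hξ₁)
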